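/- For spheres $S_1,\dots,S_n$ in $\mathbb R^d$ (of positive radius; repetitions are allowed), the intersection graph $G$ has vertices $1,\dots,n$, two different vertices $i,j$ being adjacent when $S_i\cap S_j\neq\emptyset$; $\deg(S_i)$ is the degree of $i$ in $G$. A balanced separator of $G$ is a set $\mathcal X$ of vertices such that each connected component of $G\setminus\mathcal X$ contains at most $\tfrac23 n$ vertices. Algorithms are programs for a real RAM: its memory consists of arrays of natural numbers and arrays of exact real numbers, and the following take one step each: access to a memory cell at a computed index, constants (natural or rational), addition and truncated subtraction of natural numbers, the four arithmetic operations on real numbers, conversion of a natural number to a real number, comparisons, branching, and drawing an independent uniform random number from $[0,1]$. The input is $n$ together with the list of the coordinates of the centers and the radii of the spheres; the output is a subset of $\{1,\dots,n\}$. **Theorem.** For every $d\ge 2$ there are constants $C_d,T_d$ and a randomized real RAM program with the following property. For every $n\ge 2$ and all spheres $S_1,\dots,S_n$ in $\mathbb R^d$, the program halts after at most $T_d\,n^2$ steps, whatever the random numbers are, and with probability at least $\tfrac12$ its output is a balanced separator $\mathcal X$ of $G$ with $$|\mathcal X|\le C_d\left(\sum_{i=1}^n \deg(S_i)^{\frac1{d-1}}\right)^{1-\frac1d}.$$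 -/

import Mathlib

/-!
# Sphere separators and a randomized real RAM

Part 1 defines intersection graphs of spheres and balanced separators.
Part 2 defines programs for a randomized real random access machine, with a step count.
-/

/-- The intersection graph of a family of `n` spheres in `ℝ^d`, the `i`-th one with center `c i` and
radius `r i`: two different members of the family are adjacent when the spheres intersect. -/
def sphereGraph {d n : ℕ} (c : Fin n → EuclideanSpace ℝ (Fin d)) (r : Fin n → ℝ) :
    SimpleGraph (Fin n) where
  Adj i j := i ≠ j ∧ (Metric.sphere (c i) (r i) ∩ Metric.sphere (c j) (r j)).Nonempty
  symm := ⟨fun _ _ h => ⟨h.1.symm, by rw [Set.inter_comm]; exact h.2⟩⟩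
  loopless := ⟨fun _ h => h.1 rfl⟩

/-- `X` is a balanced separator of `G`: each connected component of `G ∖ X` contains at most two
thirds of the vertices of `G`. -/
def IsBalancedSeparator {V : Type*} (G : SimpleGraph V) (X : Set V) : Prop :=
  ∀ K : (G.induce Xᶜ).ConnectedComponent, (K.supp.ncard : ℝ) ≤ 2 / 3 * (Nat.card V : ℝ)

namespace RealRAM

/-- The memory of the machine: arrays of natural numbers and arrays of real numbers, of unbounded
length. `natMem a i` is the `i`-th cell of the `a`-th array. `drawn` is the number of random numbers
that have been drawn so far. A program is a finite object and names its arrays by fixed numerals,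
whereas indices into an array can be computed. -/
structure State where
  natMem : ℕ → ℕ → ℕ
  realMem : ℕ → ℕ → ℝ
  drawn : ℕ

/-- Arithmetic on natural numbers (addition and truncated subtraction), with array access. -/
inductive NatExpr : Type
  | const (k : ℕ)
  | get (a : ℕ) (i : NatExpr)
  | add (x y : NatExpr)
  | sub (x y : NatExpr)

/-- Exact real arithmetic: the four operations of the field of real numbers, rational constants,
array access, and the inclusion of the natural numbers. There are no roots, and no rounding. -/
inductive RealExpr : Type
  | const (q : ℚ)
  | get (a : ℕ) (i : NatExpr)
  | ofNat (x : NatExpr)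
  | add (x y : RealExpr)
  | sub (x y : RealExpr)
  | mul (x y : RealExpr)
  | div (x y : RealExpr)

/-- Tests: comparisons, and their Boolean combinations. -/
inductive Test : Type
  | natLt (x y : NatExpr)
  | realLt (x y : RealExpr)
  | not (b : Test)
  | and (b b' : Test)

/-- Programs. -/
inductive Prog : Type
  /-- Do nothing. -/
  | skip
  /-- Store the value of `x` in cell `i` of the array `a` of natural numbers. -/
  | natSet (a : ℕ) (i : NatExpr) (x : NatExpr)
  /-- Store the value of `x` in cell `i` of the array `a` of real numbers. -/
  | realSet (a : ℕ) (i : NatExpr) (x : RealExpr)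
  /-- Store a fresh random number from `[0, 1]` in cell `i` of the array `a` of real numbers. -/
  | sample (a : ℕ) (i : NatExpr)
  /-- First `p`, then `q`. -/
  | seq (p q : Prog)
  /-- If `b` then `p`, else `q`. -/
  | cond (b : Test) (p q : Prog)
  /-- While `b`, do `p`. -/
  | loop (b : Test) (p : Prog)

/-- The value of an expression. -/
def NatExpr.eval (s : State) : NatExpr → ℕ
  | .const k => k
  | .get a i => s.natMem a (i.eval s)
  | .add x y => x.eval s + y.eval s
  | .sub x y => x.eval s - y.eval s

/-- The number of steps needed to evaluate an expression: one for each constant, memory access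
and operation in it. -/
def NatExpr.cost : NatExpr → ℕ
  | .const _ => 1
  | .get _ i => i.cost + 1
  | .add x y => x.cost + y.cost + 1
  | .sub x y => x.cost + y.cost + 1

/-- The value of a real expression. -/
noncomputable def RealExpr.eval (s : State) : RealExpr → ℝ
  | .const q => (q : ℝ)
  | .get a i => s.realMem a (i.eval s)
  | .ofNat x => (x.eval s : ℝ)
  | .add x y => x.eval s + y.eval s
  | .sub x y => x.eval s - y.eval s
  | .mul x y => x.eval s * y.eval s
  | .div x y => x.eval s / y.eval s

/-- The number of steps needed to evaluate a real expression, counted in the same way. -/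
def RealExpr.cost : RealExpr → ℕ
  | .const _ => 1
  | .get _ i => i.cost + 1
  | .ofNat x => x.cost + 1
  | .add x y => x.cost + y.cost + 1
  | .sub x y => x.cost + y.cost + 1
  | .mul x y => x.cost + y.cost + 1
  | .div x y => x.cost + y.cost + 1

/-- The truth of a test. -/
def Test.Holds (s : State) : Test → Prop
  | .natLt x y => x.eval s < y.eval s
  | .realLt x y => x.eval s < y.eval s
  | .not b => ¬ b.Holds s
  | .and b b' => b.Holds s ∧ b'.Holds s

/-- The number of steps needed to evaluate a test. -/
def Test.cost : Test → ℕ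
  | .natLt x y => x.cost + y.cost + 1
  | .realLt x y => x.cost + y.cost + 1
  | .not b => b.cost + 1
  | .and b b' => b.cost + b'.cost + 1

/-- Overwrite one cell of the arrays of natural numbers. -/
def State.setNat (s : State) (a i v : ℕ) : State :=
  { s with natMem := Function.update s.natMem a (Function.update (s.natMem a) i v) }

/-- Overwrite one cell of the arrays of real numbers. -/
noncomputable def State.setReal (s : State) (a i : ℕ) (v : ℝ) : State :=
  { s with realMem := Function.update s.realMem a (Function.update (s.realMem a) i v) }

/-- The sequence of random numbers that the machine draws during a run. -/
abbrev Tape : Type := ℕ → unitInterval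

/-- The law of the random numbers: independent and uniform on `[0, 1]`. -/
noncomputable def tapeLaw : MeasureTheory.Measure Tape :=
  MeasureTheory.Measure.infinitePi fun _ => (MeasureTheory.volume : MeasureTheory.Measure unitInterval)

/-- `Runs ω p s t s'`: when the random numbers are those of `ω`, the program `p` started in the
state `s` halts after `t` steps in the state `s'`. -/
inductive Runs (ω : Tape) : Prog → State → ℕ → State → Prop
  | skip (s : State) : Runs ω .skip s 1 s
  | natSet (s : State) (a : ℕ) (i x : NatExpr) :
      Runs ω (.natSet a i x) s (i.cost + x.cost + 1) (s.setNat a (i.eval s) (x.eval s))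
  | realSet (s : State) (a : ℕ) (i : NatExpr) (x : RealExpr) :
      Runs ω (.realSet a i x) s (i.cost + x.cost + 1) (s.setReal a (i.eval s) (x.eval s))
  | sample (s : State) (a : ℕ) (i : NatExpr) :
      Runs ω (.sample a i) s (i.cost + 1)
        { s.setReal a (i.eval s) (ω s.drawn : ℝ) with drawn := s.drawn + 1 }
  | seq {p q : Prog} {s s' s'' : State} {t t' : ℕ} :
      Runs ω p s t s' → Runs ω q s' t' s'' → Runs ω (.seq p q) s (t + t') s''
  | condTrue {b : Test} {p q : Prog} {s s' : State} {t : ℕ} :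
      b.Holds s → Runs ω p s t s' → Runs ω (.cond b p q) s (b.cost + t + 1) s'
  | condFalse {b : Test} {p q : Prog} {s s' : State} {t : ℕ} :
      ¬ b.Holds s → Runs ω q s t s' → Runs ω (.cond b p q) s (b.cost + t + 1) s'
  | loopDone {b : Test} {p : Prog} {s : State} :
      ¬ b.Holds s → Runs ω (.loop b p) s (b.cost + 1) s
  | loopNext {b : Test} {p : Prog} {s s' s'' : State} {t t' : ℕ} :
      b.Holds s → Runs ω p s t s' → Runs ω (.loop b p) s' t' s'' →
        Runs ω (.loop b p) s (b.cost + t + t' + 1) s''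

/-- The machine is deterministic once the random numbers are fixed: the number of steps and the
final state of a run are unique. -/
theorem Runs.unique {ω : Tape} {p : Prog} {s s₁ s₂ : State} {t₁ t₂ : ℕ}
    (h₁ : Runs ω p s t₁ s₁) (h₂ : Runs ω p s t₂ s₂) : t₁ = t₂ ∧ s₁ = s₂ := by
  induction h₁ generalizing t₂ s₂ with
  | skip | natSet | realSet | sample => cases h₂; exact ⟨rfl, rfl⟩
  | seq _ _ ih ih' =>
    cases h₂ with
    | seq k k' =>
      obtain ⟨rfl, rfl⟩ := ih k
      obtain ⟨rfl, rfl⟩ := ih' k'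
      exact ⟨rfl, rfl⟩
  | condTrue hb _ ih =>
    cases h₂ with
    | condTrue _ k => obtain ⟨rfl, rfl⟩ := ih k; exact ⟨rfl, rfl⟩
    | condFalse hb' _ => exact absurd hb hb'
  | condFalse hb _ ih =>
    cases h₂ with
    | condTrue hb' _ => exact absurd hb' hb
    | condFalse _ k => obtain ⟨rfl, rfl⟩ := ih k; exact ⟨rfl, rfl⟩
  | loopDone hb =>
    cases h₂ with
    | loopDone => exact ⟨rfl, rfl⟩
    | loopNext hb' => exact absurd hb' hb
  | loopNext hb _ _ ih ih' =>
    cases h₂ with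
    | loopDone hb' => exact absurd hb hb'
    | loopNext _ k k' =>
      obtain ⟨rfl, rfl⟩ := ih k
      obtain ⟨rfl, rfl⟩ := ih' k'
      exact ⟨rfl, rfl⟩

/-- The initial state that holds a list of `n` spheres in `ℝ^d`. Cell `0` of the array `0` of
natural numbers holds `n`. For `j < d`, cell `i` of the array `j` of real numbers holds the `j`-th
coordinate of the `i`-th center, and cell `i` of the array `d` holds the `i`-th radius. All other
cells hold `0`, and no random number has been drawn. -/
noncomputable def sphereInput {d n : ℕ} (c : Fin n → EuclideanSpace ℝ (Fin d)) (r : Fin n → ℝ) :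
    State where
  natMem a i := if a = 0 ∧ i = 0 then n else 0
  realMem a i :=
    if hi : i < n then
      if ha : a < d then c ⟨i, hi⟩ ⟨a, ha⟩ else if a = d then r ⟨i, hi⟩ else 0
    else 0
  drawn := 0

/-- The subset of `{0, …, n - 1}` that a final state describes: the set of those `i` for which
cell `i` of the array `1` of natural numbers is not zero. -/
def output (n : ℕ) (s : State) : Set (Fin n) :=
  {i | s.natMem 1 i ≠ 0}

end RealRAM

/-! The separator is produced in a bounded number `K = cellBound d` of rounds, each of which cuts
along a sphere of random radius. Fix a point on every sphere, and let `U` be the subfamily still to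
be treated, at first the vertices of positive degree. A search finds a ball of radius `R` in the
supremum norm, around one of the points, that holds at least a proportion `1 / K` of the points of
`U`, whereas no ball of radius `R / 4` around a point of `U` does. With `ρ = d R` and `q` the
center, the cut is made along the sphere `S` around `q` of radius `t`, uniform in `[ρ, 2ρ]`. A grid
count (`two_mul_card_le_of_sparse`) shows that at most half of `U` has its points within `4ρ` of
`q`, so components inside `S` are small. What lies outside `S` is the next `U`; it has lost a
proportion `1 / K`, so after `K` rounds at most `n / e` spheres are left.

Removing all spheres that meet `S` may cost too much, because nested spheres need not intersect and
no volume bound limits their number. Therefore a vertex of degree `D` is declared critical with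
probability `1 / D`, independently. A sphere of radius below `ρ` has its ball as its cap; any other
has the side with fewer members of `U`. So caps of relevant spheres hold at most half of `U`, and
"lies in the cap of" is a strict order on `U`. A sphere is exposed if it lies in no critical cap of
a relevant sphere. Removed are the exposed spheres that are hit, and all neighbors in `U` of those
among them that are critical. A surviving component that enters the cap of such a critical sphere
cannot leave it, hence is small; any other one misses `S` (`Layout.linked_dichotomy`).

For the size, call a sphere top if it is exposed and critical. Its coin does not influence its
exposure, so `P(exposed) = D · P(top)`. Over a given point `x` let `N` be the number of top caps.
Two top spheres with caps over `x` intersect, since otherwise one would lie in the cap of the other,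
and for adjacent spheres the coin of one is independent of the top event of the other. This gives `E
N² ≤ 3 E N`, whence `E N ≤ 3` (`Layout.sum_topEvent_le`). Each cap contains a ball of radius `min r
ρ` within `4ρ` of `q`, so comparing volumes gives `∑ (min r ρ)^d P(top) ≤ 3 (4ρ)^d`. A sphere is hit
with probability at most `2 min r ρ / ρ`, and Hölder's inequality with exponents `d` and `d / (d -
1)` (`sum_mul_le_of_sum_pow_le`) turns this into the bound on the expected number of hit exposed
spheres. The neighbors of the critical ones cost the same again, as `D · P(top) = P(exposed)`. If `R
= 0`, then a proportion `1 / K` of `U` passes through one point and forms a clique; cliques obey the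
same bound, so all of `U` may be removed. Conditioning on the earlier rounds leaves the coins
independent, and Markov's inequality finishes the estimate.

The search needs only `2n` linear-time steps (`search_optimal`), all geometric tests compare squares
of distances, and the program nests loops of length `n` at most twice (`Cmd.runs_compile`), which
gives the quadratic time bound. -/

namespace SphereSep
open Metric

/-! ### Sides of spheres and the intersection criterion -/

section Geometry
variable {d : ℕ}

/-- The open side of a sphere: the open ball for `true`, the open exterior for `false`. -/
def side (c : EuclideanSpace ℝ (Fin d)) (r : ℝ) (b : Bool) : Set (EuclideanSpace ℝ (Fin d)) :=
  if b then ball c r else (closedBall c r)ᶜ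

/-- The closed side of a sphere. -/
def closedSide (c : EuclideanSpace ℝ (Fin d)) (r : ℝ) (b : Bool) :
    Set (EuclideanSpace ℝ (Fin d)) :=
  if b then closedBall c r else (ball c r)ᶜ

theorem mem_side_true {c x : EuclideanSpace ℝ (Fin d)} {r : ℝ} :
    x ∈ side c r true ↔ dist x c < r := by simp [side]

theorem mem_side_false {c x : EuclideanSpace ℝ (Fin d)} {r : ℝ} :
    x ∈ side c r false ↔ r < dist x c := by simp [side]

theorem mem_closedSide_true {c x : EuclideanSpace ℝ (Fin d)} {r : ℝ} :
    x ∈ closedSide c r true ↔ dist x c ≤ r := by simp [closedSide]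

theorem mem_closedSide_false {c x : EuclideanSpace ℝ (Fin d)} {r : ℝ} :
    x ∈ closedSide c r false ↔ r ≤ dist x c := by simp [closedSide]

theorem sphere_subset_closedSide (c : EuclideanSpace ℝ (Fin d)) (r : ℝ) (b : Bool) :
    sphere c r ⊆ closedSide c r b := by
  intro x hx
  rw [mem_sphere] at hx
  cases b
  · exact mem_closedSide_false.2 hx.ge
  · exact mem_closedSide_true.2 hx.le

theorem closedSide_disjoint_side (c : EuclideanSpace ℝ (Fin d)) (r : ℝ) (b : Bool)
    {x : EuclideanSpace ℝ (Fin d)} (hx : x ∈ closedSide c r b) : x ∉ side c r (!b) := by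
  cases b
  · rw [mem_closedSide_false] at hx
    simpa [mem_side_true] using hx
  · rw [mem_closedSide_true] at hx
    simpa [mem_side_false] using hx

theorem side_subset_closedSide (c : EuclideanSpace ℝ (Fin d)) (r : ℝ) (b : Bool) :
    side c r b ⊆ closedSide c r b := by
  intro x hx
  cases b
  · exact mem_closedSide_false.2 (mem_side_false.1 hx).le
  · exact mem_closedSide_true.2 (mem_side_true.1 hx).le

/-- The line through the centers meets the first sphere in the points farthest from and nearest to
the second center; for equal centers any point of the sphere serves for both. -/
theorem exists_mem_sphere_dist_add (hd : 2 ≤ d) (c₁ c₂ : EuclideanSpace ℝ (Fin d)) {r : ℝ}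
    (hr : 0 < r) :
    (∃ p ∈ sphere c₁ r, dist p c₂ = dist c₁ c₂ + r) ∧
    (∃ p ∈ sphere c₁ r, dist p c₂ = |dist c₁ c₂ - r|) := by
  by_cases h : c₁ = c₂
  · subst h
    have : Nonempty (Fin d) := ⟨⟨0, by omega⟩⟩
    obtain ⟨p, hp⟩ := NormedSpace.sphere_nonempty (x := c₁).2 hr.le
    rw [mem_sphere] at hp
    refine ⟨⟨p, hp, ?_⟩, p, hp, ?_⟩
    · simp [hp]
    · simp [hp, abs_of_pos hr]
  · have hD : 0 < dist c₁ c₂ := dist_pos.2 h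
    have key : ∀ a : ℝ, dist (c₁ + a • (c₁ - c₂)) c₁ = |a| * dist c₁ c₂ ∧
        dist (c₁ + a • (c₁ - c₂)) c₂ = |1 + a| * dist c₁ c₂ := by
      intro a
      constructor
      · rw [dist_eq_norm, dist_eq_norm, add_sub_cancel_left, norm_smul, Real.norm_eq_abs]
      · rw [dist_eq_norm, dist_eq_norm, ← Real.norm_eq_abs, ← norm_smul]
        congr 1
        module
    refine ⟨⟨c₁ + (r / dist c₁ c₂) • (c₁ - c₂), ?_, ?_⟩,
      c₁ + (-(r / dist c₁ c₂)) • (c₁ - c₂), ?_, ?_⟩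
    · rw [mem_sphere, (key _).1, abs_of_pos (by positivity)]
      field_simp
    · rw [(key _).2, abs_of_pos (by positivity)]
      field_simp
    · rw [mem_sphere, (key _).1, abs_neg, abs_of_pos (by positivity)]
      field_simp
    · rw [(key _).2]
      nth_rewrite 2 [← abs_of_pos hD]
      rw [← abs_mul]
      congr 1
      field_simp
      ring

/-- For `d ≥ 2` a sphere is connected, so the distance to `c₂` takes on it every value between its
extremes `|dist c₁ c₂ - r₁|` and `dist c₁ c₂ + r₁`. -/
theorem spheres_meet_iff (hd : 2 ≤ d) {c₁ c₂ : EuclideanSpace ℝ (Fin d)} {r₁ r₂ : ℝ}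
    (hr₁ : 0 < r₁) (_hr₂ : 0 < r₂) :
    (sphere c₁ r₁ ∩ sphere c₂ r₂).Nonempty ↔
      |r₁ - r₂| ≤ dist c₁ c₂ ∧ dist c₁ c₂ ≤ r₁ + r₂ := by
  constructor
  · rintro ⟨x, hx₁, hx₂⟩
    rw [mem_sphere] at hx₁ hx₂
    have h₁ := dist_triangle_left c₁ c₂ x
    have h₂ := dist_triangle x c₁ c₂
    have h₃ := dist_triangle_right x c₁ c₂
    rw [abs_le]
    refine ⟨⟨?_, ?_⟩, ?_⟩ <;> linarith
  · rintro ⟨h₁, h₂⟩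
    rw [abs_le] at h₁
    obtain ⟨⟨p, hp, hpd⟩, q, hq, hqd⟩ := exists_mem_sphere_dist_add hd c₁ c₂ hr₁
    have hconn : IsPreconnected (sphere c₁ r₁) := by
      apply isPreconnected_sphere
      rw [← Module.finrank_eq_rank, finrank_euclideanSpace_fin]
      exact_mod_cast hd
    have hsub := hconn.intermediate_value hq hp
      (f := fun x => dist x c₂) (by fun_prop)
    have : r₂ ∈ Set.Icc (dist q c₂) (dist p c₂) := by
      rw [hpd, hqd]
      constructor
      · rw [abs_le]
        constructor <;> linarith
      · linarith
    obtain ⟨x, hx, hxr⟩ := hsub this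
    exact ⟨x, hx, hxr⟩

theorem sphere_subset_side_true_iff (hd : 2 ≤ d) {c₁ c₂ : EuclideanSpace ℝ (Fin d)} {r₁ r₂ : ℝ}
    (hr₁ : 0 < r₁) : sphere c₁ r₁ ⊆ side c₂ r₂ true ↔ dist c₁ c₂ + r₁ < r₂ := by
  constructor
  · intro h
    obtain ⟨⟨p, hp, hpd⟩, -⟩ := exists_mem_sphere_dist_add hd c₁ c₂ hr₁
    have := mem_side_true.1 (h hp)
    linarith
  · intro h x hx
    rw [mem_sphere] at hx
    rw [mem_side_true]
    have := dist_triangle x c₁ c₂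
    linarith

theorem sphere_subset_side_false_iff (hd : 2 ≤ d) {c₁ c₂ : EuclideanSpace ℝ (Fin d)} {r₁ r₂ : ℝ}
    (hr₁ : 0 < r₁) : sphere c₁ r₁ ⊆ side c₂ r₂ false ↔
      r₁ + r₂ < dist c₁ c₂ ∨ dist c₁ c₂ + r₂ < r₁ := by
  constructor
  · intro h
    obtain ⟨-, p, hp, hpd⟩ := exists_mem_sphere_dist_add hd c₁ c₂ hr₁
    have := mem_side_false.1 (h hp)
    rw [hpd, lt_abs] at this
    rcases this with h | h
    · left; linarith
    · right; linarith
  · intro h x hx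
    rw [mem_sphere] at hx
    rw [mem_side_false]
    have h₁ := dist_triangle_left c₁ c₂ x
    have h₃ := dist_triangle_right x c₁ c₂
    rcases h with h | h <;> linarith

/-- The three ways in which the triangle inequalities can fail are: the second sphere inside the
first, the first inside the second, and each outside the other. -/
theorem sphere_subset_side_of_not_meet (hd : 2 ≤ d) {c₁ c₂ : EuclideanSpace ℝ (Fin d)}
    {r₁ r₂ : ℝ} (hr₁ : 0 < r₁) (hr₂ : 0 < r₂)
    (h : ¬ (sphere c₁ r₁ ∩ sphere c₂ r₂).Nonempty) :
    ∃ b, sphere c₁ r₁ ⊆ side c₂ r₂ b := by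
  rw [spheres_meet_iff hd hr₁ hr₂, not_and_or, not_le, not_le, lt_abs] at h
  rcases h with (h | h) | h
  · exact ⟨false, (sphere_subset_side_false_iff hd hr₁).2 (by right; linarith)⟩
  · exact ⟨true, (sphere_subset_side_true_iff hd hr₁).2 (by linarith)⟩
  · exact ⟨false, (sphere_subset_side_false_iff hd hr₁).2 (by left; linarith)⟩

theorem not_meet_of_subset_side {c₁ c₂ : EuclideanSpace ℝ (Fin d)}
    {r₁ r₂ : ℝ} {b : Bool} (h : sphere c₁ r₁ ⊆ side c₂ r₂ b) :
    ¬ (sphere c₁ r₁ ∩ sphere c₂ r₂).Nonempty := by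
  rintro ⟨x, hx, hx'⟩
  have := closedSide_disjoint_side c₂ r₂ (!b) (sphere_subset_closedSide _ _ _ hx')
  rw [Bool.not_not] at this
  exact this (h hx)

/-- A sphere that meets a sphere on one side of `S`, and misses `S`, is on the same side of `S`. -/
theorem subset_side_of_meet (hd : 2 ≤ d) {c₀ c₁ c₂ : EuclideanSpace ℝ (Fin d)}
    {r₀ r₁ r₂ : ℝ} (hr₀ : 0 < r₀) (hr₁ : 0 < r₁) {b : Bool}
    (h : sphere c₂ r₂ ⊆ side c₀ r₀ b)
    (hmeet : (sphere c₂ r₂ ∩ sphere c₁ r₁).Nonempty)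
    (hmiss : ¬ (sphere c₁ r₁ ∩ sphere c₀ r₀).Nonempty) : sphere c₁ r₁ ⊆ side c₀ r₀ b := by
  obtain ⟨b', hb'⟩ := sphere_subset_side_of_not_meet hd hr₁ hr₀ hmiss
  obtain ⟨x, hx, hx'⟩ := hmeet
  have h1 := side_subset_closedSide _ _ _ (h hx)
  have h2 := hb' hx'
  have : b' = b := by
    by_contra hne
    have hb : b' = !b := by cases b <;> cases b' <;> simp_all
    rw [hb] at h2
    exact closedSide_disjoint_side _ _ _ h1 h2
  exact this ▸ hb'

/-- If two spheres lie on sides of each other, then the opposite closed side of the first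
lies inside the side of the second. -/
theorem closedSide_not_subset_side (hd : 2 ≤ d) {c₁ c₂ : EuclideanSpace ℝ (Fin d)}
    {r₁ r₂ : ℝ} (hr₁ : 0 < r₁) (hr₂ : 0 < r₂) {b b' : Bool}
    (h : sphere c₁ r₁ ⊆ side c₂ r₂ b) (h' : sphere c₂ r₂ ⊆ side c₁ r₁ b') :
    closedSide c₁ r₁ (!b') ⊆ side c₂ r₂ b := by
  intro x hx
  have h₁ := dist_triangle_left c₁ c₂ x
  have h₂ := dist_triangle x c₁ c₂
  have h₃ := dist_triangle_right x c₁ c₂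
  have h₄ := dist_triangle x c₂ c₁
  have hc := dist_comm c₁ c₂
  have hpos : 0 ≤ dist c₁ c₂ := dist_nonneg
  cases b <;> cases b' <;>
    simp only [sphere_subset_side_false_iff hd hr₁, sphere_subset_side_false_iff hd hr₂,
      sphere_subset_side_true_iff hd hr₁, sphere_subset_side_true_iff hd hr₂] at h h' <;>
    simp only [Bool.not_true, Bool.not_false, mem_closedSide_true, mem_closedSide_false,
      mem_side_true, mem_side_false] at hx ⊢
  · rcases h with h | h <;> rcases h' with h' | h' <;> linarith
  · rcases h with h | h <;> linarith
  · rcases h' with h' | h' <;> linarith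
  · linarith

end Geometry
end SphereSep

namespace SphereSep
open Metric

/-! ### Caps, exposed spheres, and what one cut separates -/

section Families
open Classical

/-- A family of spheres, a subfamily `U`, and a sphere with center `q` and radius `ρ` around which
the subfamily is going to be cut. -/
structure Layout (d n : ℕ) where
  c : Fin n → EuclideanSpace ℝ (Fin d)
  r : Fin n → ℝ
  U : Finset (Fin n)
  q : EuclideanSpace ℝ (Fin d)
  ρ : ℝ

namespace Layout
variable {d n : ℕ} (S : Layout d n)

/-- The spheres of the subfamily that lie on a given side of the `k`-th sphere. -/
noncomputable def onSide (k : Fin n) (b : Bool) : Finset (Fin n) :=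
  {l ∈ S.U | sphere (S.c l) (S.r l) ⊆ side (S.c k) (S.r k) b}

/-- The side of the `k`-th sphere that counts as its cap. -/
noncomputable def capSide (k : Fin n) : Bool :=
  decide (S.r k < S.ρ ∨ (S.onSide k true).card ≤ (S.onSide k false).card)

/-- The `j`-th sphere lies in the cap of the `k`-th sphere. -/
def InCap (k j : Fin n) : Prop :=
  sphere (S.c j) (S.r j) ⊆ side (S.c k) (S.r k) (S.capSide k)

/-- The spheres of the subfamily that meet the annulus of radii `ρ` and `2ρ` around `q`. -/
noncomputable def relevant : Finset (Fin n) :=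
  {k ∈ S.U | ∃ x ∈ sphere (S.c k) (S.r k), S.ρ ≤ dist x S.q ∧ dist x S.q ≤ 2 * S.ρ}

/-- The `j`-th sphere counts as hit by the sphere of radius `t` around `q`. -/
def Hit (t : ℝ) (j : Fin n) : Prop :=
  j ∈ S.relevant ∧
    (S.ρ ≤ S.r j ∨ (sphere (S.c j) (S.r j) ∩ sphere S.q t).Nonempty)

/-- No relevant sphere in `Z` has the `j`-th sphere in its cap. -/
def Exposed (Z : Set (Fin n)) (j : Fin n) : Prop :=
  ∀ k ∈ S.relevant, S.InCap k j → k ∉ Z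

/-- The spheres that are removed when the subfamily is cut along the sphere of radius `t`. -/
noncomputable def cut (t : ℝ) (Z : Set (Fin n)) : Finset (Fin n) :=
  {l ∈ S.U | (S.Hit t l ∧ S.Exposed Z l) ∨
    ∃ j, S.Hit t j ∧ S.Exposed Z j ∧ j ∈ Z ∧ (sphereGraph S.c S.r).Adj j l}

variable {S}

theorem capSide_eq_true_of_lt {k : Fin n} (h : S.r k < S.ρ) : S.capSide k = true := by
  simp [capSide, h]

theorem card_onSide_capSide_le {k : Fin n} (h : S.ρ ≤ S.r k) :
    (S.onSide k (S.capSide k)).card ≤ (S.onSide k (!S.capSide k)).card := by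
  unfold capSide
  by_cases h' : (S.onSide k true).card ≤ (S.onSide k false).card
  · simp [h']
  · simpa [h', not_lt.2 h] using (not_le.1 h').le

theorem not_adj_of_inCap {k j : Fin n} (h : S.InCap k j) : ¬ (sphereGraph S.c S.r).Adj j k :=
  fun h' => not_meet_of_subset_side h h'.2

theorem not_inCap_self (hr : ∀ i, 0 < S.r i) (hd : 2 ≤ d) (k : Fin n) : ¬ S.InCap k k := by
  intro h
  have : Nonempty (Fin d) := ⟨⟨0, by omega⟩⟩
  obtain ⟨x, hx⟩ := NormedSpace.sphere_nonempty (x := S.c k).2 (hr k).le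
  exact not_meet_of_subset_side h ⟨x, hx, hx⟩

/-- Two spheres of radius below `ρ` cannot lie strictly inside each other, and a small one has only
smaller ones in its cap, so both radii are at least `ρ`. Then the side of `j` away from its cap lies
in the cap of `k`, which contains `j` in addition, and conversely. Since a cap never holds more
members of `U` than the opposite side, the cardinalities would increase strictly around a cycle. -/
theorem inCap_asymm (hd : 2 ≤ d) (hr : ∀ i, 0 < S.r i) {k j : Fin n} (hk : k ∈ S.U)
    (hj : j ∈ S.U) (h : S.InCap k j) : ¬ S.InCap j k := by
  intro h'
  have small : ∀ a b : Fin n, S.InCap a b → S.InCap b a → S.ρ ≤ S.r a := by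
    intro a b hab hba
    by_contra hlt
    rw [not_le] at hlt
    have h1 := hab
    rw [InCap, capSide_eq_true_of_lt hlt, sphere_subset_side_true_iff hd (hr b)] at h1
    have h0 : 0 ≤ dist (S.c b) (S.c a) := dist_nonneg
    have h2 := hba
    have hb : S.r b < S.ρ := by have := hr b; linarith
    rw [InCap, capSide_eq_true_of_lt hb, sphere_subset_side_true_iff hd (hr a),
      dist_comm] at h2
    have := hr a
    have := hr b
    linarith
  have key : ∀ a b : Fin n, b ∈ S.U → S.InCap a b → S.InCap b a →
      (S.onSide b (!S.capSide b)).card < (S.onSide a (S.capSide a)).card := by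
    intro a b hb hab hba
    apply Finset.card_lt_card
    rw [Finset.ssubset_iff_of_subset]
    · refine ⟨b, ?_, ?_⟩
      · simp only [onSide, Finset.mem_filter]
        exact ⟨hb, hab⟩
      · simp only [onSide, Finset.mem_filter, not_and]
        intro _ hbb
        have : Nonempty (Fin d) := ⟨⟨0, by omega⟩⟩
        obtain ⟨x, hx⟩ := NormedSpace.sphere_nonempty (x := S.c b).2 (hr b).le
        exact not_meet_of_subset_side hbb ⟨x, hx, hx⟩
    · intro l hl
      simp only [onSide, Finset.mem_filter] at hl ⊢
      refine ⟨hl.1, fun x hx => ?_⟩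
      exact closedSide_not_subset_side hd (hr b) (hr a) hab hba
        (side_subset_closedSide _ _ _ (hl.2 hx))
  have h1 := key k j hj h h'
  have h2 := key j k hk h' h
  have h3 := card_onSide_capSide_le (small k j h h')
  have h4 := card_onSide_capSide_le (small j k h' h)
  omega

/-- By asymmetry `k` lies on the side of `j` opposite to the cap of `j`. This upgrades the
containment of a sphere to containment of its cap, which makes `InCap` transitive. -/
theorem closedCap_subset_of_inCap (hd : 2 ≤ d) (hr : ∀ i, 0 < S.r i) {k j : Fin n} (hk : k ∈ S.U)
    (hj : j ∈ S.U) (h : S.InCap k j) :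
    closedSide (S.c j) (S.r j) (S.capSide j) ⊆ side (S.c k) (S.r k) (S.capSide k) := by
  obtain ⟨b, hb⟩ := sphere_subset_side_of_not_meet hd (hr k) (hr j)
    (by rw [Set.inter_comm]; exact not_meet_of_subset_side h)
  have hne : b ≠ S.capSide j := by
    rintro rfl
    exact inCap_asymm hd hr hk hj h hb
  have := closedSide_not_subset_side hd (hr j) (hr k) h hb
  have hb' : (!b) = S.capSide j := by
    cases b <;> cases h' : S.capSide j <;> simp_all
  rwa [hb'] at this

theorem inCap_trans (hd : 2 ≤ d) (hr : ∀ i, 0 < S.r i) {k j i : Fin n} (hk : k ∈ S.U)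
    (hj : j ∈ S.U) (h : S.InCap k j) (h' : S.InCap j i) : S.InCap k i :=
  fun _ hx => closedCap_subset_of_inCap hd hr hk hj h (side_subset_closedSide _ _ _ (h' hx))

/-- If neither sphere were in the cap of the other, each would be on the far side of the other, and
the closed caps would be disjoint. -/
theorem inCap_or_inCap (hd : 2 ≤ d) (hr : ∀ i, 0 < S.r i) {k j : Fin n} (hkj : k ≠ j)
    {x : EuclideanSpace ℝ (Fin d)} (hxk : x ∈ closedSide (S.c k) (S.r k) (S.capSide k))
    (hxj : x ∈ closedSide (S.c j) (S.r j) (S.capSide j))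
    (hadj : ¬ (sphereGraph S.c S.r).Adj k j) : S.InCap k j ∨ S.InCap j k := by
  have hmeet : ¬ (sphere (S.c k) (S.r k) ∩ sphere (S.c j) (S.r j)).Nonempty :=
    fun h => hadj ⟨hkj, h⟩
  obtain ⟨b, hb⟩ := sphere_subset_side_of_not_meet hd (hr k) (hr j) hmeet
  obtain ⟨b', hb'⟩ := sphere_subset_side_of_not_meet hd (hr j) (hr k)
    (by rwa [Set.inter_comm])
  by_cases h1 : b = S.capSide j
  · right; rw [InCap, ← h1]; exact hb
  by_cases h2 : b' = S.capSide k
  · left; rw [InCap, ← h2]; exact hb'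
  exfalso
  have h3 : b' = !S.capSide k := by cases b' <;> cases h : S.capSide k <;> simp_all
  have h4 : (!b) = S.capSide j := by cases b <;> cases h : S.capSide j <;> simp_all
  have := closedSide_not_subset_side hd (hr j) (hr k) hb' hb
  rw [h4, h3] at this
  exact closedSide_disjoint_side _ _ _ hxk (this hxj)

/-- A maximal element of `Z` above `j`. -/
theorem exists_exposed_above (hd : 2 ≤ d) (hr : ∀ i, 0 < S.r i) {Z : Set (Fin n)} {j : Fin n}
    (h : ¬ S.Exposed Z j) : ∃ k ∈ S.relevant, k ∈ Z ∧ S.InCap k j ∧ S.Exposed Z k := by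
  have hU : ∀ k ∈ S.relevant, k ∈ S.U := fun k hk => (Finset.mem_filter.1 hk).1
  let A : Finset (Fin n) := {k ∈ S.relevant | k ∈ Z ∧ S.InCap k j}
  have hA : A.Nonempty := by
    simp only [Exposed] at h
    push Not at h
    obtain ⟨k, hk, hkj, hkZ⟩ := h
    exact ⟨k, Finset.mem_filter.2 ⟨hk, hkZ, hkj⟩⟩
  -- The number of members of `U` in the cap serves as a rank: it grows strictly along `InCap`, so a
  -- maximizer has no critical relevant cap above it.
  obtain ⟨k, hkA, hmax⟩ := A.exists_max_image (fun k => (S.onSide k (S.capSide k)).card) hA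
  obtain ⟨hk, hkZ, hkj⟩ := Finset.mem_filter.1 hkA
  refine ⟨k, hk, hkZ, hkj, fun i hi hik hiZ => ?_⟩
  have hij := inCap_trans hd hr (hU i hi) (hU k hk) hik hkj
  have := hmax i (Finset.mem_filter.2 ⟨hi, hiZ, hij⟩)
  refine absurd this (not_le.2 (Finset.card_lt_card ?_))
  rw [Finset.ssubset_iff_of_subset]
  · refine ⟨k, Finset.mem_filter.2 ⟨hU k hk, hik⟩, fun h => ?_⟩
    exact not_inCap_self hr hd k (Finset.mem_filter.1 h).2
  · intro l hl
    obtain ⟨hl, hl'⟩ := Finset.mem_filter.1 hl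
    exact Finset.mem_filter.2 ⟨hl, inCap_trans hd hr (hU i hi) (hU k hk) hik hl'⟩

/-- Only a sphere `k` of radius below `ρ` needs an argument. Then `j` lies inside it, is small too,
and so meets the sphere of radius `t`. Hence the open ball of `k` contains a point at distance `t`
from `q`; as `S.r k < ρ ≤ t`, this ball cannot swallow the cutting sphere, so its boundary meets it.
-/
theorem hit_of_inCap (hd : 2 ≤ d) (hr : ∀ i, 0 < S.r i) {t : ℝ}
    (ht : S.ρ ≤ t) {k j : Fin n} (hj : S.Hit t j) (hk : k ∈ S.relevant) (h : S.InCap k j) :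
    S.Hit t k := by
  refine ⟨hk, ?_⟩
  by_contra hcon
  push Not at hcon
  obtain ⟨hkρ, hmiss⟩ := hcon
  rw [InCap, capSide_eq_true_of_lt hkρ, sphere_subset_side_true_iff hd (hr j)] at h
  have h0 : 0 ≤ dist (S.c j) (S.c k) := dist_nonneg
  have hrk := hr k
  have hrj := hr j
  obtain ⟨x, hx, hxq⟩ := hj.2.resolve_left (by linarith)
  rw [mem_sphere] at hx hxq
  rw [← Set.not_nonempty_iff_eq_empty, spheres_meet_iff hd hrk (by linarith), not_and_or,
    not_le, not_le, lt_abs] at hmiss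
  have h1 := dist_triangle x (S.c j) (S.c k)
  have h2 := dist_triangle_left (S.c k) S.q x
  have h3 := dist_triangle x (S.c k) S.q
  rcases hmiss with (h' | h') | h' <;> nlinarith [dist_nonneg (x := S.c k) (y := S.q)]

/-- A set of vertices that is connected in the weak sense that properties inherited by neighbors
hold throughout. -/
def Linked (G : SimpleGraph (Fin n)) (K : Set (Fin n)) : Prop :=
  ∀ P : Fin n → Prop, (∃ v ∈ K, P v) → (∀ v ∈ K, ∀ w ∈ K, G.Adj v w → P v → P w) → ∀ v ∈ K, P v

/-- A small relevant sphere encloses only points within `2ρ + 2ρ` of `q`, which `hball` bounds; for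
a large one the cap is the less populated of two disjoint sides. -/
theorem card_onSide_capSide_two_mul_le
    {p : Fin n → EuclideanSpace ℝ (Fin d)} (hp : ∀ i, p i ∈ sphere (S.c i) (S.r i))
    (hball : 2 * ({l ∈ S.U | dist (p l) S.q ≤ 4 * S.ρ} : Finset (Fin n)).card ≤ S.U.card)
    {k : Fin n} (hk : k ∈ S.relevant) :
    2 * (S.onSide k (S.capSide k)).card ≤ S.U.card := by
  by_cases h : S.r k < S.ρ
  · rw [capSide_eq_true_of_lt h]
    refine le_trans (Nat.mul_le_mul_left 2 (Finset.card_le_card ?_)) hball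
    intro l hl
    obtain ⟨hl, hl'⟩ := Finset.mem_filter.1 hl
    refine Finset.mem_filter.2 ⟨hl, ?_⟩
    have h1 := mem_side_true.1 (hl' (hp l))
    obtain ⟨-, x, hx, -, hx2⟩ := Finset.mem_filter.1 hk
    rw [mem_sphere] at hx
    have h2 := dist_triangle (p l) (S.c k) S.q
    have h3 := dist_triangle_left (S.c k) S.q x
    linarith
  · rw [not_lt] at h
    have h1 := card_onSide_capSide_le h
    have h2 : (S.onSide k (S.capSide k)).card + (S.onSide k (!S.capSide k)).card ≤ S.U.card := by
      rw [← Finset.card_union_of_disjoint]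
      · exact Finset.card_le_card (Finset.union_subset (Finset.filter_subset _ _)
          (Finset.filter_subset _ _))
      · rw [Finset.disjoint_left]
        intro l hl hl'
        have h3 := (Finset.mem_filter.1 hl).2 (hp l)
        have h4 := (Finset.mem_filter.1 hl').2 (hp l)
        exact closedSide_disjoint_side _ _ _ (side_subset_closedSide _ _ _ h3) h4
    omega

/-- If `K` has a member in the cap of a hit, exposed, critical sphere `k`, then `K` stays in that
cap, because `k` and its neighbors in `U` are cut. Otherwise no member of `K` meets the cutting
sphere: an exposed one would be cut, and an unexposed one would lie below an exposed critical
sphere, which `hit_of_inCap` shows to be hit. Then all of `K` is on one side, and the inside holds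
at most half of `U`. -/
theorem linked_dichotomy (hd : 2 ≤ d) (hr : ∀ i, 0 < S.r i)
    {p : Fin n → EuclideanSpace ℝ (Fin d)} (hp : ∀ i, p i ∈ sphere (S.c i) (S.r i))
    (hball : 2 * ({l ∈ S.U | dist (p l) S.q ≤ 4 * S.ρ} : Finset (Fin n)).card ≤ S.U.card)
    (hρ : 0 < S.ρ) {t : ℝ} (ht : S.ρ ≤ t) (ht' : t ≤ 2 * S.ρ) {Z : Set (Fin n)} {K : Set (Fin n)}
    (hK : Linked (sphereGraph S.c S.r) K) (hKU : K ⊆ S.U)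
    (hKX : ∀ v ∈ K, v ∉ S.cut t Z) :
    2 * K.ncard ≤ S.U.card ∨ ∀ v ∈ K, t < dist (p v) S.q := by
  have card_of_sub : ∀ T : Finset (Fin n), K ⊆ T → 2 * T.card ≤ S.U.card →
      2 * K.ncard ≤ S.U.card := by
    intro T hT hcard
    have := Set.ncard_le_ncard hT T.finite_toSet
    rw [Set.ncard_coe_finset] at this
    omega
  have ht0 : 0 < t := by linarith
  by_cases hcap : ∃ k ∈ S.relevant, S.Hit t k ∧ k ∈ Z ∧ S.Exposed Z k ∧ ∃ j ∈ K, S.InCap k j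
  · left
    obtain ⟨k, hk, hkH, hkZ, hkE, hj⟩ := hcap
    refine card_of_sub (S.onSide k (S.capSide k)) ?_
      (card_onSide_capSide_two_mul_le hp hball hk)
    have := hK (S.InCap k) hj (by
      intro v hv w hw hvw hkv
      refine subset_side_of_meet hd (hr k) (hr w) hkv hvw.2 fun hwk => hKX w hw ?_
      refine Finset.mem_filter.2 ⟨hKU hw, ?_⟩
      by_cases hwk' : w = k
      · subst hwk'
        exact Or.inl ⟨hkH, hkE⟩
      · exact Or.inr ⟨k, hkH, hkE, hkZ, fun h => hwk' h.symm, by rwa [Set.inter_comm]⟩)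
    intro v hv
    exact Finset.mem_filter.2 ⟨hKU hv, this v hv⟩
  · have hmiss : ∀ v ∈ K, ¬ (sphere (S.c v) (S.r v) ∩ sphere S.q t).Nonempty := by
      intro v hv hmeet
      have hvrel : v ∈ S.relevant := by
        obtain ⟨x, hx, hx'⟩ := hmeet
        rw [mem_sphere] at hx'
        exact Finset.mem_filter.2 ⟨hKU hv, x, hx, by rw [hx']; exact ht, by rw [hx']; exact ht'⟩
      have hH : S.Hit t v := ⟨hvrel, Or.inr hmeet⟩
      by_cases hE : S.Exposed Z v
      · exact hKX v hv (Finset.mem_filter.2 ⟨hKU hv, Or.inl ⟨hH, hE⟩⟩)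
      · obtain ⟨k, hk, hkZ, hkv, hkE⟩ := exists_exposed_above hd hr hE
        exact hcap ⟨k, hk, hit_of_inCap hd hr ht hH hk hkv, hkZ, hkE, v, hv, hkv⟩
    by_cases hin : ∃ v ∈ K, sphere (S.c v) (S.r v) ⊆ side S.q t true
    · left
      have := hK (fun v => sphere (S.c v) (S.r v) ⊆ side S.q t true) hin (by
        intro v hv w hw hvw hkv
        exact subset_side_of_meet hd ht0 (hr w) hkv hvw.2 (hmiss w hw))
      refine card_of_sub _ (fun v hv => ?_) hball
      have h1 := mem_side_true.1 (this v hv (hp v))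
      simp only [Finset.coe_filter, Set.mem_ofPred_eq]
      exact ⟨hKU hv, by linarith⟩
    · right
      intro v hv
      obtain ⟨b, hb⟩ := sphere_subset_side_of_not_meet hd (hr v) ht0 (hmiss v hv)
      cases b
      · exact mem_side_false.1 (hb (hp v))
      · exact absurd ⟨v, hv, hb⟩ hin

/-- The cap of a relevant sphere contains a ball of comparable size close to `q`. -/
theorem exists_ball_subset_cap {j : Fin n} (hr : 0 < S.r j) (hρ : 0 < S.ρ)
    (hj : j ∈ S.relevant) :
    ∃ y, closedBall y (min (S.r j) S.ρ) ⊆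
      closedSide (S.c j) (S.r j) (S.capSide j) ∩ closedBall S.q (4 * S.ρ) := by
  obtain ⟨-, p, hp, -, hpq⟩ := Finset.mem_filter.1 hj
  rw [mem_sphere] at hp
  by_cases h : S.r j < S.ρ
  · refine ⟨S.c j, fun x hx => ?_⟩
    rw [min_eq_left h.le, mem_closedBall] at hx
    rw [capSide_eq_true_of_lt h]
    refine ⟨mem_closedSide_true.2 hx, ?_⟩
    rw [mem_closedBall]
    have h1 := dist_triangle x (S.c j) S.q
    have h2 := dist_triangle_left (S.c j) S.q p
    linarith
  · rw [not_lt] at h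
    have hv : ∀ a : ℝ, dist (p + (a / S.r j) • (p - S.c j)) (S.c j) = |a + S.r j| ∧
        dist (p + (a / S.r j) • (p - S.c j)) p = |a| := by
      intro a
      constructor
      · rw [dist_eq_norm, show p + (a / S.r j) • (p - S.c j) - S.c j =
          (a / S.r j + 1) • (p - S.c j) by module, norm_smul, ← dist_eq_norm, hp,
          Real.norm_eq_abs]
        nth_rewrite 2 [← abs_of_pos hr]
        rw [← abs_mul]
        congr 1
        field_simp
      · rw [dist_eq_norm, add_sub_cancel_left, norm_smul, ← dist_eq_norm, hp, Real.norm_eq_abs,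
          abs_div, abs_of_pos hr]
        field_simp
    rw [min_eq_right h]
    -- The center `y` is obtained by moving `p` by `ρ` along the radius, into the cap. The total
    -- `4ρ` is `2ρ` for `p`, `ρ` for this shift and `ρ` for the radius of the ball.
    have hnear : ∀ y x, dist y p = S.ρ → dist x y ≤ S.ρ → dist x S.q ≤ 4 * S.ρ := by
      intro y x hy hx
      have h1 := dist_triangle x y S.q
      have h2 := dist_triangle y p S.q
      linarith
    cases hcap : S.capSide j
    · refine ⟨p + (S.ρ / S.r j) • (p - S.c j), fun x hx => ?_⟩
      obtain ⟨h1, h2⟩ := hv S.ρ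
      rw [mem_closedBall] at hx
      rw [abs_of_pos (by linarith)] at h1 h2
      refine ⟨mem_closedSide_false.2 ?_, hnear _ x h2 hx⟩
      have h3 := dist_triangle_left (p + (S.ρ / S.r j) • (p - S.c j)) (S.c j) x
      linarith
    · refine ⟨p + ((-S.ρ) / S.r j) • (p - S.c j), fun x hx => ?_⟩
      obtain ⟨h1, h2⟩ := hv (-S.ρ)
      rw [mem_closedBall] at hx
      rw [abs_of_nonneg (by linarith)] at h1
      rw [abs_neg, abs_of_pos hρ] at h2
      refine ⟨mem_closedSide_true.2 ?_, hnear _ x h2 hx⟩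
      have h3 := dist_triangle x (p + ((-S.ρ) / S.r j) • (p - S.c j)) (S.c j)
      linarith

end Layout
end Families
end SphereSep

namespace SphereSep
open Metric MeasureTheory RealRAM

/-! ### Overlap bounds, volumes and Hölder's inequality -/

section Volume

/-- Integrate the sum of the indicators of the balls with weights `e`: it is at most `K` on the
large ball and zero elsewhere. The volume of the unit ball cancels. -/
theorem sum_pow_mul_le_of_overlap_le {d : ℕ} {ι : Type*} (L : Finset ι) (e s : ι → ℝ)
    (y : ι → EuclideanSpace ℝ (Fin d)) (q : EuclideanSpace ℝ (Fin d)) {K R : ℝ}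
    (he : ∀ j ∈ L, 0 ≤ e j) (hs : ∀ j ∈ L, 0 ≤ s j) (hK : 0 ≤ K) (hR : 0 ≤ R)
    (hsub : ∀ j ∈ L, closedBall (y j) (s j) ⊆ closedBall q R)
    (hover : ∀ x, ∀ L' ⊆ L, (∀ j ∈ L', x ∈ closedBall (y j) (s j)) → ∑ j ∈ L', e j ≤ K) :
    ∑ j ∈ L, s j ^ d * e j ≤ K * R ^ d := by
  classical
  set v := (volume : Measure (EuclideanSpace ℝ (Fin d))) (ball 0 1) with hv
  have hv0 : v ≠ 0 := (isOpen_ball.measure_pos _ ⟨0, by simp⟩).ne'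
  have hvt : v ≠ ⊤ := measure_ball_lt_top.ne
  have hvol : ∀ (x : EuclideanSpace ℝ (Fin d)) (a : ℝ), 0 ≤ a →
      volume (closedBall x a) = ENNReal.ofReal (a ^ d) * v := by
    intro x a ha
    rw [Measure.addHaar_closedBall _ _ ha, finrank_euclideanSpace_fin]
  have h1 : ∑ j ∈ L, ENNReal.ofReal (e j) * volume (closedBall (y j) (s j)) ≤
      ENNReal.ofReal K * volume (closedBall q R) := by
    have h2 : ∀ j ∈ L, ENNReal.ofReal (e j) * volume (closedBall (y j) (s j)) =
        ∫⁻ x, (closedBall (y j) (s j)).indicator (fun _ => ENNReal.ofReal (e j)) x := by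
      intro j _
      rw [lintegral_indicator_const isClosed_closedBall.measurableSet]
    rw [Finset.sum_congr rfl h2, ← lintegral_finsetSum _ (fun j _ =>
      measurable_const.indicator isClosed_closedBall.measurableSet),
      ← lintegral_indicator_const isClosed_closedBall.measurableSet]
    refine lintegral_mono fun x => ?_
    by_cases hx : x ∈ closedBall q R
    · rw [Set.indicator_of_mem hx]
      have : ∑ j ∈ L, (closedBall (y j) (s j)).indicator (fun _ => ENNReal.ofReal (e j)) x =
          ENNReal.ofReal (∑ j ∈ L with x ∈ closedBall (y j) (s j), e j) := by
        rw [ENNReal.ofReal_sum_of_nonneg (fun j hj => he j (Finset.mem_filter.1 hj).1),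
          Finset.sum_filter]
        refine Finset.sum_congr rfl fun j _ => ?_
        by_cases hj : x ∈ closedBall (y j) (s j)
        · rw [Set.indicator_of_mem hj, if_pos hj]
        · rw [Set.indicator_of_notMem hj, if_neg hj]
      rw [this]
      exact ENNReal.ofReal_le_ofReal (hover x _ (Finset.filter_subset _ _)
        fun j hj => (Finset.mem_filter.1 hj).2)
    · rw [Set.indicator_of_notMem hx, Finset.sum_eq_zero]
      intro j hj
      exact Set.indicator_of_notMem (fun h => hx (hsub j hj h)) _
  rw [hvol _ _ hR, Finset.sum_congr rfl (fun j hj => by rw [hvol _ _ (hs j hj), ← mul_assoc]),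
    ← Finset.sum_mul, ← mul_assoc, ENNReal.mul_le_mul_iff_left hv0 hvt,
    ← ENNReal.ofReal_mul hK, Finset.sum_congr rfl (fun j hj => (ENNReal.ofReal_mul (he j hj)).symm),
    ← ENNReal.ofReal_sum_of_nonneg (fun j hj => mul_nonneg (he j hj) (pow_nonneg (hs j hj) _)),
    ENNReal.ofReal_le_ofReal_iff (by positivity)] at h1
  simpa only [mul_comm] using h1

/-- Hölder's inequality in the form needed to pass from volumes to numbers of spheres. -/
theorem sum_mul_le_of_sum_pow_le {d : ℕ} (hd : 2 ≤ d) {ι : Type*} (L : Finset ι)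
    (h D e : ι → ℝ) {K : ℝ} (hh : ∀ j ∈ L, 0 ≤ h j) (hD : ∀ j ∈ L, 1 ≤ D j)
    (he : ∀ j ∈ L, 0 ≤ e j) (heD : ∀ j ∈ L, e j * D j ≤ 1)
    (hK : ∑ j ∈ L, h j ^ d * e j ≤ K) :
    ∑ j ∈ L, h j * (D j * e j) ≤
      K ^ (1 / (d : ℝ)) * (∑ j ∈ L, D j ^ (1 / ((d : ℝ) - 1))) ^ (1 - 1 / (d : ℝ)) := by
  have hd2 : (2 : ℝ) ≤ d := by exact_mod_cast hd
  have hd0 : (d : ℝ) ≠ 0 := by linarith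
  have hd1 : (d : ℝ) - 1 ≠ 0 := by linarith
  have hpq : (d : ℝ).HolderConjugate ((d : ℝ) / (d - 1)) := by
    refine Real.HolderConjugate.conjExponent (by linarith)
  -- The term `h D e` is split as `(h D e · D^(-1/d)) · D^(1/d)`. The power `d / (d - 1)` of the
  -- second factor is `D^(1/(d-1))`; the `d`-th power of the first is `h^d (D e)^d / D`, which is at
  -- most `h^d e` because `D e ≤ 1`.
  have key := Real.inner_le_Lp_mul_Lq L
    (fun j => h j * (D j * e j) * D j ^ (-(1 / (d : ℝ)))) (fun j => D j ^ (1 / (d : ℝ))) hpq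
  have e1 : ∀ j ∈ L, h j * (D j * e j) * D j ^ (-(1 / (d : ℝ))) * D j ^ (1 / (d : ℝ)) =
      h j * (D j * e j) := by
    intro j hj
    have : 0 < D j := by linarith [hD j hj]
    rw [mul_assoc, ← Real.rpow_add this, neg_add_cancel, Real.rpow_zero, mul_one]
  rw [Finset.sum_congr rfl e1] at key
  refine key.trans ?_
  have e2 : ∀ j ∈ L, |D j ^ (1 / (d : ℝ))| ^ ((d : ℝ) / (d - 1)) = D j ^ (1 / ((d : ℝ) - 1)) := by
    intro j hj
    have : 0 < D j := by linarith [hD j hj]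
    rw [abs_of_nonneg (Real.rpow_nonneg this.le _), ← Real.rpow_mul this.le]
    congr 1
    field_simp
  have e3 : 1 / ((d : ℝ) / (d - 1)) = 1 - 1 / d := by field_simp
  rw [Finset.sum_congr rfl e2, e3]
  refine mul_le_mul_of_nonneg_right ?_ (Real.rpow_nonneg (Finset.sum_nonneg fun j hj =>
    Real.rpow_nonneg (by linarith [hD j hj]) _) _)
  refine Real.rpow_le_rpow (Finset.sum_nonneg fun j hj => Real.rpow_nonneg (abs_nonneg _) _)
    (le_trans (Finset.sum_le_sum fun j hj => ?_) hK) (by positivity)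
  have hDj : 0 < D j := by linarith [hD j hj]
  have hej := he j hj
  have hhj := hh j hj
  have h4 : (D j ^ (-(1 / (d : ℝ)))) ^ d = (D j)⁻¹ := by
    rw [← Real.rpow_natCast, ← Real.rpow_mul hDj.le, ← Real.rpow_neg_one]
    congr 1
    field_simp
  rw [Real.rpow_natCast, abs_of_nonneg (by positivity), mul_pow, mul_pow, h4, mul_assoc]
  refine mul_le_mul_of_nonneg_left ?_ (by positivity)
  have h5 : (D j * e j) ^ d ≤ D j * e j :=
    pow_le_of_le_one (by positivity) (by rw [mul_comm]; exact heD j hj) (by omega)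
  calc (D j * e j) ^ d * (D j)⁻¹ ≤ D j * e j * (D j)⁻¹ :=
        mul_le_mul_of_nonneg_right h5 (by positivity)
    _ = e j := by field_simp

end Volume

/-! ### A second moment bound -/

section Events

/-- For the number `N` of events that occur, the hypothesis is `E N² ≤ 3 E N`. Expanding `0 ≤ E (N -
3)²` gives `0 ≤ 9 - 3 E N`. -/
theorem sum_measureReal_le {Ω ι : Type*} [MeasurableSpace Ω] (ν : Measure Ω)
    [IsProbabilityMeasure ν] (Q : Finset ι) (E : ι → Set Ω) (hE : ∀ j, MeasurableSet (E j))
    (h : ∑ j ∈ Q, ∑ k ∈ Q, ν.real (E j ∩ E k) ≤ 3 * ∑ j ∈ Q, ν.real (E j)) :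
    ∑ j ∈ Q, ν.real (E j) ≤ 3 := by
  have hind : ∀ A : Set Ω, MeasurableSet A →
      Integrable (A.indicator (fun _ => (1 : ℝ))) ν := fun A hA =>
    (integrable_const _).indicator hA
  have hint : ∀ A : Set Ω, MeasurableSet A →
      ∫ ω, A.indicator (fun _ => (1 : ℝ)) ω ∂ν = ν.real A := fun A hA => by
    rw [integral_indicator_const _ hA, smul_eq_mul, mul_one]
  have h0 : 0 ≤ ∫ ω, ((∑ j ∈ Q, (E j).indicator (fun _ => (1 : ℝ)) ω) - 3) ^ 2 ∂ν :=
    integral_nonneg fun ω => sq_nonneg _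
  have hexp : ∀ ω, ((∑ j ∈ Q, (E j).indicator (fun _ => (1 : ℝ)) ω) - 3) ^ 2 =
      (∑ j ∈ Q, ∑ k ∈ Q, (E j ∩ E k).indicator (fun _ => (1 : ℝ)) ω) -
        6 * (∑ j ∈ Q, (E j).indicator (fun _ => (1 : ℝ)) ω) + 9 := by
    intro ω
    have : ∀ j k, (E j ∩ E k).indicator (fun _ => (1 : ℝ)) ω =
        (E j).indicator (fun _ => (1 : ℝ)) ω * (E k).indicator (fun _ => (1 : ℝ)) ω := by
      intro j k
      by_cases h1 : ω ∈ E j <;> by_cases h2 : ω ∈ E k <;> simp [h1, h2]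
    rw [Finset.sum_congr rfl fun j _ => Finset.sum_congr rfl fun k _ => this j k,
      ← Finset.sum_mul_sum]
    ring
  have i1 : Integrable (fun ω => ∑ j ∈ Q, ∑ k ∈ Q, (E j ∩ E k).indicator (fun _ => (1 : ℝ)) ω) ν :=
    integrable_finsetSum _ fun j _ => integrable_finsetSum _ fun k _ =>
      hind _ ((hE j).inter (hE k))
  have i2 : Integrable (fun ω => ∑ j ∈ Q, (E j).indicator (fun _ => (1 : ℝ)) ω) ν :=
    integrable_finsetSum _ fun j _ => hind _ (hE j)
  have hsplit : ∀ F G : Ω → ℝ, Integrable F ν → Integrable G ν →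
      ∫ ω, (F ω - 6 * G ω + 9) ∂ν = ∫ ω, F ω ∂ν - 6 * ∫ ω, G ω ∂ν + 9 := by
    intro F G hF hG
    rw [integral_add (f := fun ω => F ω - 6 * G ω) (g := fun _ => (9 : ℝ))
      (hF.sub (hG.const_mul 6)) (integrable_const _), integral_sub hF (hG.const_mul 6),
      integral_const_mul]
    simp
  rw [integral_congr_ae (Filter.Eventually.of_forall hexp), hsplit _ _ i1 i2,
    integral_finsetSum _ (fun j _ => hind _ (hE j)),
    integral_finsetSum _ (fun j _ => integrable_finsetSum _ fun k _ =>
      hind _ ((hE j).inter (hE k)))] at h0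
  rw [Finset.sum_congr rfl (fun j _ => hint _ (hE j)),
    Finset.sum_congr rfl (fun j _ => (integral_finsetSum _ (fun k _ =>
      hind _ ((hE j).inter (hE k)))).trans (Finset.sum_congr rfl fun k _ =>
        hint _ ((hE j).inter (hE k))))] at h0
  linarith

end Events
end SphereSep

namespace SphereSep
open Metric MeasureTheory RealRAM

/-! ### Independence of single random numbers -/

section Resampling

/-- Membership in `A` does not depend on the `i`-th random number. -/
def IgnoresCoord (A : Set Tape) (i : ℕ) : Prop :=
  ∀ (ω : Tape) (x : unitInterval), Function.update ω i x ∈ A ↔ ω ∈ A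

/-- Under `ν`, the `i`-th random number is uniform and independent of all others. -/
def CoordIndep (ν : Measure Tape) (i : ℕ) : Prop :=
  ∀ A : Set Tape, MeasurableSet A → IgnoresCoord A i → ∀ B : Set unitInterval, MeasurableSet B →
    ν (A ∩ {ω | ω i ∈ B}) = ν A * volume B

instance : IsProbabilityMeasure tapeLaw := by unfold tapeLaw; infer_instance

theorem measurable_update_tape (i : ℕ) :
    Measurable fun p : Tape × unitInterval => Function.update p.1 i p.2 := by
  refine measurable_pi_iff.2 fun j => ?_
  by_cases h : j = i
  · subst h; simpa using measurable_snd
  · simp only [Function.update_of_ne h]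
    exact (measurable_pi_apply j).comp measurable_fst

/-- Redrawing one entry does not change the law; this is checked on finite boxes, which determine a
product measure. -/
theorem map_update_tapeLaw (i : ℕ) :
    (tapeLaw.prod (volume : Measure unitInterval)).map
      (fun p => Function.update p.1 i p.2) = tapeLaw := by
  refine Measure.eq_infinitePi _ fun s t ht => ?_
  have hbox : ∀ s' : Finset ℕ, MeasurableSet (Set.pi (s' : Set ℕ) t) := fun s' =>
    MeasurableSet.pi s'.countable_toSet fun j _ => ht j
  rw [Measure.map_apply (measurable_update_tape i) (hbox s)]
  by_cases hi : i ∈ s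
  · have : (fun p : Tape × unitInterval => Function.update p.1 i p.2) ⁻¹' Set.pi (s : Set ℕ) t =
        Set.pi ((s.erase i : Finset ℕ) : Set ℕ) t ×ˢ t i := by
      ext ⟨ω, x⟩
      simp only [Set.mem_preimage, Set.mem_pi, Finset.mem_coe, Set.mem_prod, Finset.mem_erase]
      constructor
      · intro h
        refine ⟨fun j hj => ?_, by simpa using h i hi⟩
        simpa [Function.update_of_ne hj.1] using h j hj.2
      · rintro ⟨h, h'⟩ j hj
        by_cases hji : j = i
        · subst hji; simpa using h'
        · simpa [Function.update_of_ne hji] using h j ⟨hji, hj⟩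
    rw [this, Measure.prod_prod, tapeLaw, Measure.infinitePi_pi _ (fun j _ => ht j),
      Finset.prod_erase_mul _ _ hi]
  · have : (fun p : Tape × unitInterval => Function.update p.1 i p.2) ⁻¹' Set.pi (s : Set ℕ) t =
        Set.pi (s : Set ℕ) t ×ˢ Set.univ := by
      ext ⟨ω, x⟩
      simp only [Set.mem_preimage, Set.mem_pi, Finset.mem_coe, Set.mem_prod, Set.mem_univ, and_true]
      refine forall₂_congr fun j hj => ?_
      rw [Function.update_of_ne (show j ≠ i from fun h => hi (h ▸ hj))]
    rw [this, Measure.prod_prod, tapeLaw, Measure.infinitePi_pi _ (fun j _ => ht j)]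
    simp

/-- After redrawing the `i`-th entry from an independent source, the event becomes the rectangle `A
×ˢ B`. -/
theorem coordIndep_tapeLaw (i : ℕ) : CoordIndep tapeLaw i := by
  intro A hA hAi B hB
  nth_rewrite 1 [← map_update_tapeLaw i]
  have hAB : MeasurableSet (A ∩ {ω | ω i ∈ B}) := hA.inter (measurable_pi_apply i hB)
  rw [Measure.map_apply (measurable_update_tape i) hAB]
  have : (fun p : Tape × unitInterval => Function.update p.1 i p.2) ⁻¹' (A ∩ {ω | ω i ∈ B}) =
      A ×ˢ B := by
    ext ⟨ω, x⟩
    simp [hAi ω x]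
  rw [this, Measure.prod_prod]

/-- Needed to condition on the outcome of earlier rounds, which depends neither on the coins of the
vertices nor on the number about to be drawn. -/
theorem CoordIndep.cond {ν : Measure Tape} [IsFiniteMeasure ν] {i : ℕ} (h : CoordIndep ν i)
    {C : Set Tape} (hC : MeasurableSet C) (hCi : IgnoresCoord C i) :
    CoordIndep (ProbabilityTheory.cond ν C) i := by
  intro A hA hAi B hB
  have hCA : IgnoresCoord (C ∩ A) i := fun ω x => and_congr (hCi ω x) (hAi ω x)
  rw [ProbabilityTheory.cond_apply hC, ProbabilityTheory.cond_apply hC, ← Set.inter_assoc,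
    h _ (hC.inter hA) hCA _ hB, mul_assoc]

theorem CoordIndep.real {ν : Measure Tape} {i : ℕ} (h : CoordIndep ν i) {A : Set Tape}
    (hA : MeasurableSet A) (hAi : IgnoresCoord A i) {B : Set unitInterval} (hB : MeasurableSet B) :
    ν.real (A ∩ {ω | ω i ∈ B}) = ν.real A * volume.real B := by
  rw [Measure.real, h A hA hAi B hB, ENNReal.toReal_mul]
  rfl

/-- The numbers `x ∈ [0, 1]` with `x D < 1`. -/
def critSet (D : ℕ) : Set unitInterval := {x | (x : ℝ) * D < 1}

theorem measurableSet_critSet (D : ℕ) : MeasurableSet (critSet D) :=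
  (isOpen_lt (by fun_prop) continuous_const).measurableSet

theorem volume_critSet {D : ℕ} (hD : 1 ≤ D) : volume.real (critSet D) = 1 / (D : ℝ) := by
  have hD' : (1 : ℝ) ≤ D := by exact_mod_cast hD
  have hmem : 1 / (D : ℝ) ∈ unitInterval :=
    ⟨by positivity, by rw [div_le_one (by linarith)]; exact hD'⟩
  have : critSet D = Set.Iio ⟨1 / (D : ℝ), hmem⟩ := by
    ext x
    simp only [critSet, Set.mem_ofPred_eq, Set.mem_Iio, ← Subtype.coe_lt_coe]
    rw [lt_div_iff₀ (by linarith)]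
  rw [this, Measure.real, unitInterval.volume_Iio, ENNReal.toReal_ofReal (by positivity)]

end Resampling

/-! ### Probability that the cutting sphere hits a given sphere -/

namespace Layout
variable {d n : ℕ} {S : Layout d n}

/-- The radius of the separating sphere as a function of a random number. -/
noncomputable def radius (S : Layout d n) (u : unitInterval) : ℝ := S.ρ * (1 + u)

theorem le_radius (hρ : 0 < S.ρ) (u : unitInterval) : S.ρ ≤ S.radius u := by
  have := u.2.1
  unfold radius
  nlinarith

theorem radius_le (hρ : 0 < S.ρ) (u : unitInterval) : S.radius u ≤ 2 * S.ρ := by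
  have := u.2.2
  unfold radius
  nlinarith

theorem measurableSet_hit (hd : 2 ≤ d) (hr : ∀ i, 0 < S.r i) (hρ : 0 < S.ρ) (j : Fin n) :
    MeasurableSet {u : unitInterval | S.Hit (S.radius u) j} := by
  have : {u : unitInterval | S.Hit (S.radius u) j} =
      {_u | j ∈ S.relevant} ∩ ({_u | S.ρ ≤ S.r j} ∪
        ({u | |S.r j - S.radius u| ≤ dist (S.c j) S.q} ∩
          {u | dist (S.c j) S.q ≤ S.r j + S.radius u})) := by
    ext u
    simp only [Hit, Set.mem_ofPred_eq, Set.mem_inter_iff, Set.mem_union]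
    rw [spheres_meet_iff hd (hr j) (by linarith [le_radius hρ u])]
  rw [this]
  unfold radius
  refine (MeasurableSet.const _).inter ((MeasurableSet.const _).union (MeasurableSet.inter ?_ ?_))
  · exact (isClosed_le (by fun_prop) continuous_const).measurableSet
  · exact (isClosed_le continuous_const (by fun_prop)).measurableSet

/-- A small sphere meets the cutting sphere only if `ρ (1 + u)` is within `S.r j` of the distance
from `q` to its center, an interval of length `2 S.r j / ρ` for `u`. For a large sphere the bound
equals `2` and is trivial. -/
theorem volume_hit_le (hr : ∀ i, 0 < S.r i) (hρ : 0 < S.ρ) (j : Fin n) :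
    volume.real {u : unitInterval | S.Hit (S.radius u) j} ≤ 2 * min (S.r j) S.ρ / S.ρ := by
  have hrj := hr j
  by_cases h : S.ρ ≤ S.r j
  · rw [min_eq_right h, mul_div_assoc, div_self hρ.ne']
    exact measureReal_le_one.trans (by norm_num)
  · rw [not_le] at h
    rw [min_eq_left h.le]
    have hsub : Subtype.val '' {u : unitInterval | S.Hit (S.radius u) j} ⊆
        Set.Icc ((dist (S.c j) S.q - S.r j) / S.ρ - 1) ((dist (S.c j) S.q + S.r j) / S.ρ - 1) := by
      rintro _ ⟨u, hu, rfl⟩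
      obtain ⟨x, hx, hx'⟩ := hu.2.resolve_left (not_le.2 h)
      rw [mem_sphere] at hx hx'
      unfold radius at hx'
      have h1 := dist_triangle_left (S.c j) S.q x
      have h2 := dist_triangle x (S.c j) S.q
      constructor
      · rw [sub_le_iff_le_add, div_le_iff₀ hρ]
        linarith
      · rw [le_sub_iff_add_le, le_div_iff₀ hρ]
        linarith
    rw [Measure.real, unitInterval.volume_apply]
    refine (ENNReal.toReal_mono ?_ (measure_mono hsub)).trans ?_
    · rw [Real.volume_Icc]; exact ENNReal.ofReal_ne_top
    · rw [Real.volume_Icc, ENNReal.toReal_ofReal]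
      · apply le_of_eq
        field_simp
        ring
      · have : (dist (S.c j) S.q - S.r j) / S.ρ ≤ (dist (S.c j) S.q + S.r j) / S.ρ :=
          div_le_div_of_nonneg_right (by linarith) hρ.le
        linarith

end Layout
end SphereSep

/-! ### Expected size of one cut -/

namespace SphereSep
open Metric MeasureTheory RealRAM

/-- The critical vertices: a vertex of degree `D` is critical with probability `1 / D`. -/
def critical {n : ℕ} (G : SimpleGraph (Fin n)) (ω : Tape) : Set (Fin n) :=
  {k | ω k ∈ critSet (G.neighborSet k).ncard}

/-- The right-hand side of the bound on the size of the separator, without the constant. -/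
noncomputable def degreeBound (d : ℕ) {n : ℕ} (G : SimpleGraph (Fin n)) : ℝ :=
  (∑ i, ((G.neighborSet i).ncard : ℝ) ^ (1 / ((d : ℝ) - 1))) ^ (1 - 1 / (d : ℝ))

theorem degreeBound_nonneg (d : ℕ) {n : ℕ} (G : SimpleGraph (Fin n)) : 0 ≤ degreeBound d G :=
  Real.rpow_nonneg (Finset.sum_nonneg fun _ _ => Real.rpow_nonneg (Nat.cast_nonneg _) _) _

namespace Layout
variable {d n : ℕ} (S : Layout d n)

/-- The intersection graph of the family. -/
abbrev graph : SimpleGraph (Fin n) := sphereGraph S.c S.r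

/-- The event that the `j`-th sphere lies in no critical cap. -/
def exposedEvent (j : Fin n) : Set Tape := {ω | S.Exposed (critical S.graph ω) j}

/-- The event that the `j`-th sphere is critical and lies in no critical cap. -/
def topEvent (j : Fin n) : Set Tape :=
  S.exposedEvent j ∩ {ω | ω j ∈ critSet (S.graph.neighborSet j).ncard}

variable {S}

theorem measurableSet_exposedEvent (j : Fin n) : MeasurableSet (S.exposedEvent j) := by
  have : S.exposedEvent j = ⋂ k : Fin n, ({_ω | ¬ (k ∈ S.relevant ∧ S.InCap k j)} ∪
      ((fun ω : Tape => ω k) ⁻¹' critSet (S.graph.neighborSet k).ncard)ᶜ) := by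
    ext ω
    simp only [exposedEvent, Exposed, critical, Set.mem_ofPred_eq, Set.mem_iInter, Set.mem_union,
      Set.mem_compl_iff, Set.mem_preimage]
    refine forall_congr' fun k => ?_
    tauto
  rw [this]
  exact MeasurableSet.iInter fun k => (MeasurableSet.const _).union
    (measurable_pi_apply (k : ℕ) (measurableSet_critSet _)).compl

theorem ignoresCoord_exposedEvent {i : ℕ} {j : Fin n}
    (h : ∀ k ∈ S.relevant, S.InCap k j → (k : ℕ) ≠ i) : IgnoresCoord (S.exposedEvent j) i := by
  intro ω x
  simp only [exposedEvent, Exposed, critical, Set.mem_ofPred_eq]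
  refine forall₃_congr fun k hk hkj => ?_
  rw [Function.update_of_ne (h k hk hkj)]

theorem measurableSet_topEvent (j : Fin n) : MeasurableSet (S.topEvent j) :=
  (measurableSet_exposedEvent j).inter (measurable_pi_apply (j : ℕ) (measurableSet_critSet _))

theorem ignoresCoord_topEvent {i : ℕ} {j : Fin n} (hij : (j : ℕ) ≠ i)
    (h : ∀ k ∈ S.relevant, S.InCap k j → (k : ℕ) ≠ i) : IgnoresCoord (S.topEvent j) i := by
  intro ω x
  refine and_congr (ignoresCoord_exposedEvent h ω x) ?_
  simp only [Set.mem_ofPred_eq]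
  rw [Function.update_of_ne hij]

section Expectation
variable {ν : Measure Tape}

/-- No sphere lies in its own cap, so exposure of `j` is independent of the coin of `j`, which
succeeds with probability `1 / D`. -/
theorem measureReal_topEvent (hd : 2 ≤ d) (hr : ∀ i, 0 < S.r i)
    (hν : ∀ i < n, CoordIndep ν i) {j : Fin n} (hD : 1 ≤ (S.graph.neighborSet j).ncard) :
    ν.real (S.topEvent j) * (S.graph.neighborSet j).ncard = ν.real (S.exposedEvent j) := by
  have hD' : (1 : ℝ) ≤ (S.graph.neighborSet j).ncard := by exact_mod_cast hD
  rw [topEvent, (hν j j.2).real (measurableSet_exposedEvent j) (ignoresCoord_exposedEvent ?_)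
    (measurableSet_critSet _), volume_critSet hD]
  · field_simp
  · rintro k - hkj h
    rw [Fin.ext h] at hkj
    exact not_inCap_self hr hd j hkj

variable [IsProbabilityMeasure ν]

/-- The expected number of outermost critical caps over any point is bounded. -/
theorem sum_topEvent_le (hd : 2 ≤ d) (hr : ∀ i, 0 < S.r i) (hν : ∀ i < n, CoordIndep ν i)
    (hU : ∀ j ∈ S.U, 1 ≤ (S.graph.neighborSet j).ncard)
    {x : EuclideanSpace ℝ (Fin d)} {Q : Finset (Fin n)} (hQ : Q ⊆ S.relevant)
    (hx : ∀ j ∈ Q, x ∈ closedSide (S.c j) (S.r j) (S.capSide j)) :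
    ∑ j ∈ Q, ν.real (S.topEvent j) ≤ 3 := by
  classical
  have hrel : ∀ k ∈ S.relevant, k ∈ S.U := fun k hk => (Finset.mem_filter.1 hk).1
  set D : Fin n → ℝ := fun j => (S.graph.neighborSet j).ncard with hD
  have hD1 : ∀ j ∈ Q, 1 ≤ D j := fun j hj => by
    simp only [hD]; exact_mod_cast hU j (hrel j (hQ hj))
  refine sum_measureReal_le ν Q S.topEvent measurableSet_topEvent ?_
  -- The top event of `j` depends on the coin of `j` and on those of spheres whose caps contain `j`.
  -- The latter are not adjacent to `j`, so the coin of a neighbor `k` is independent of it.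
  have half : ∀ j ∈ Q, ∀ k ∈ Q, S.graph.Adj j k →
      ν.real (S.topEvent j ∩ S.topEvent k) ≤ ν.real (S.topEvent j) * (1 / D k) := by
    intro j hj k hk hjk
    rw [hD, ← volume_critSet (hU k (hrel k (hQ hk))),
      ← (hν k k.2).real (measurableSet_topEvent j) (ignoresCoord_topEvent ?_ ?_)
      (measurableSet_critSet _)]
    · exact measureReal_mono (Set.inter_subset_inter_right _ Set.inter_subset_right)
    · exact fun h => hjk.1 (Fin.ext h)
    · rintro i - hij h
      rw [Fin.ext h] at hij
      exact not_adj_of_inCap hij hjk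
  have pair : ∀ j ∈ Q, ∀ k ∈ Q, ν.real (S.topEvent j ∩ S.topEvent k) ≤
      (if S.graph.Adj j k then ν.real (S.topEvent j) / D j else 0) +
      (if S.graph.Adj k j then ν.real (S.topEvent k) / D k else 0) +
      (if j = k then ν.real (S.topEvent j) else 0) := by
    intro j hj k hk
    by_cases hjk : j = k
    · subst hjk
      simp
    · by_cases hadj : S.graph.Adj j k
      · rw [if_pos hadj, if_pos hadj.symm, if_neg hjk, add_zero]
        have hj0 : 0 ≤ ν.real (S.topEvent j) / D j :=
          div_nonneg measureReal_nonneg (by linarith [hD1 j hj])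
        have hk0 : 0 ≤ ν.real (S.topEvent k) / D k :=
          div_nonneg measureReal_nonneg (by linarith [hD1 k hk])
        -- The coin of the vertex of larger degree is used, so that the term is divided by the
        -- degree of its own vertex at worst; summed over the neighbors of that vertex it then costs
        -- one top probability.
        rcases le_total (D j) (D k) with h | h
        · refine (half j hj k hk hadj).trans (le_trans ?_ (le_add_of_nonneg_right hk0))
          rw [div_eq_mul_one_div (ν.real _)]
          exact mul_le_mul_of_nonneg_left (one_div_le_one_div_of_le (by linarith [hD1 j hj]) h)
            measureReal_nonneg
        · rw [Set.inter_comm]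
          refine (half k hk j hj hadj.symm).trans (le_trans ?_ (le_add_of_nonneg_left hj0))
          rw [div_eq_mul_one_div (ν.real _)]
          exact mul_le_mul_of_nonneg_left (one_div_le_one_div_of_le (by linarith [hD1 k hk]) h)
            measureReal_nonneg
      · have hempty : S.topEvent j ∩ S.topEvent k = ∅ := by
          rw [Set.eq_empty_iff_forall_notMem]
          rintro ω ⟨⟨hj1, hj2⟩, hk1, hk2⟩
          -- Both caps contain `x`. As the spheres do not intersect, one lies in the critical cap of
          -- the other and is not exposed.
          rcases inCap_or_inCap hd hr hjk (hx j hj) (hx k hk) hadj with h | h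
          · exact hk1 j (hQ hj) h hj2
          · exact hj1 k (hQ hk) h hk2
        rw [hempty, if_neg hadj, if_neg (fun h => hadj h.symm), if_neg hjk]
        simp
  have deg : ∀ j ∈ Q, ∑ k ∈ Q, (if S.graph.Adj j k then ν.real (S.topEvent j) / D j else 0) ≤
      ν.real (S.topEvent j) := by
    intro j hj
    rw [← Finset.sum_filter, Finset.sum_const, nsmul_eq_mul]
    have hcard : (({k ∈ Q | S.graph.Adj j k} : Finset (Fin n)).card : ℝ) ≤ D j := by
      simp only [hD]
      rw [← Set.ncard_coe_finset]
      exact_mod_cast Set.ncard_le_ncard (fun k hk => (Finset.mem_filter.1 hk).2) (Set.toFinite _)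
    have hpos : 0 < D j := by linarith [hD1 j hj]
    rw [mul_div_assoc', div_le_iff₀ hpos, mul_comm]
    exact mul_le_mul_of_nonneg_left hcard measureReal_nonneg
  have swap : ∑ j ∈ Q, ∑ k ∈ Q, (if S.graph.Adj k j then ν.real (S.topEvent k) / D k else 0) =
      ∑ j ∈ Q, ∑ k ∈ Q, (if S.graph.Adj j k then ν.real (S.topEvent j) / D j else 0) :=
    Finset.sum_comm
  calc ∑ j ∈ Q, ∑ k ∈ Q, ν.real (S.topEvent j ∩ S.topEvent k)
      ≤ ∑ j ∈ Q, ∑ k ∈ Q, ((if S.graph.Adj j k then ν.real (S.topEvent j) / D j else 0) +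
        (if S.graph.Adj k j then ν.real (S.topEvent k) / D k else 0) +
        (if j = k then ν.real (S.topEvent j) else 0)) :=
        Finset.sum_le_sum fun j hj => Finset.sum_le_sum fun k hk => pair j hj k hk
    _ ≤ ∑ j ∈ Q, ν.real (S.topEvent j) + ∑ j ∈ Q, ν.real (S.topEvent j) +
        ∑ j ∈ Q, ν.real (S.topEvent j) := by
        simp only [Finset.sum_add_distrib, swap]
        refine add_le_add (add_le_add (Finset.sum_le_sum deg) (Finset.sum_le_sum deg)) ?_
        refine Finset.sum_le_sum fun j hj => ?_
        rw [Finset.sum_ite_eq, if_pos hj]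
    _ = 3 * ∑ j ∈ Q, ν.real (S.topEvent j) := by ring

/-- Exposure probabilities are degrees times top probabilities. The balls inside the caps overlap at
most `3` times in expectation, so the volume bound applies with the top probabilities as weights,
and Hölder's inequality converts it. The constant comes from `(3 · 8^d)^(1/d) ≤ 24`. -/
theorem sum_hit_mul_le (hd : 2 ≤ d) (hr : ∀ i, 0 < S.r i) (hρ : 0 < S.ρ)
    (hν : ∀ i < n, CoordIndep ν i) (hU : ∀ j ∈ S.U, 1 ≤ (S.graph.neighborSet j).ncard) :
    ∑ j ∈ S.relevant, volume.real {u : unitInterval | S.Hit (S.radius u) j} *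
      ν.real (S.exposedEvent j) ≤ 24 * degreeBound d S.graph := by
  classical
  have hrel : ∀ k ∈ S.relevant, k ∈ S.U := fun k hk => (Finset.mem_filter.1 hk).1
  have hd0 : d ≠ 0 := by omega
  set D : Fin n → ℝ := fun j => (S.graph.neighborSet j).ncard with hD
  have hD1 : ∀ j ∈ S.relevant, 1 ≤ D j := fun j hj => by
    simp only [hD]; exact_mod_cast hU j (hrel j hj)
  have htop : ∀ j ∈ S.relevant, ν.real (S.topEvent j) * D j = ν.real (S.exposedEvent j) :=
    fun j hj => measureReal_topEvent hd hr hν (hU j (hrel j hj))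
  have hm : ∀ j, 0 ≤ min (S.r j) S.ρ := fun j => le_min (hr j).le hρ.le
  choose! y hy using fun (j : Fin n) (hj : j ∈ S.relevant) =>
    exists_ball_subset_cap (hr j) hρ hj
  have hvol := sum_pow_mul_le_of_overlap_le S.relevant (fun j => ν.real (S.topEvent j))
    (fun j => min (S.r j) S.ρ) y S.q (K := 3) (R := 4 * S.ρ) (fun _ _ => measureReal_nonneg)
    (fun j _ => hm j) (by norm_num) (by linarith) (fun j hj => (hy j hj).trans Set.inter_subset_right)
    (fun x L hL hxL => sum_topEvent_le hd hr hν hU hL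
      (fun j hj => (hy j (hL hj) (hxL j hj)).1))
  -- The base `8` is `2 / ρ`, the scaling of the hitting probability, times the radius `4ρ` of the
  -- ball that contains all the balls.
  have hvol' : ∑ j ∈ S.relevant, (2 * min (S.r j) S.ρ / S.ρ) ^ d * ν.real (S.topEvent j) ≤
      3 * 8 ^ d := by
    have : ∀ j, (2 * min (S.r j) S.ρ / S.ρ) ^ d * ν.real (S.topEvent j) =
        (2 / S.ρ) ^ d * (min (S.r j) S.ρ ^ d * ν.real (S.topEvent j)) := by
      intro j
      rw [← mul_assoc, ← mul_pow]
      congr 2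
      ring
    simp only [this]
    rw [← Finset.mul_sum]
    calc (2 / S.ρ) ^ d * ∑ j ∈ S.relevant, min (S.r j) S.ρ ^ d * ν.real (S.topEvent j)
        ≤ (2 / S.ρ) ^ d * (3 * (4 * S.ρ) ^ d) :=
          mul_le_mul_of_nonneg_left hvol (by positivity)
      _ = 3 * 8 ^ d := by
          rw [mul_left_comm, ← mul_pow]
          congr 2
          field_simp
          norm_num
  have hhold := sum_mul_le_of_sum_pow_le hd S.relevant (fun j => 2 * min (S.r j) S.ρ / S.ρ) D
    (fun j => ν.real (S.topEvent j)) (fun j _ => div_nonneg (by linarith [hm j]) hρ.le) hD1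
    (fun _ _ => measureReal_nonneg) (fun j hj => by rw [htop j hj]; exact measureReal_le_one) hvol'
  refine le_trans (Finset.sum_le_sum fun j hj => ?_) (hhold.trans ?_)
  · rw [mul_comm (D j), htop j hj]
    exact mul_le_mul_of_nonneg_right (volume_hit_le hr hρ j) measureReal_nonneg
  · have hd2 : (2 : ℝ) ≤ d := by exact_mod_cast hd
    have h0 : 0 ≤ 1 - 1 / (d : ℝ) := by
      rw [sub_nonneg, div_le_one (by linarith)]; linarith
    refine mul_le_mul ?_ ?_ (Real.rpow_nonneg (Finset.sum_nonneg fun j hj =>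
      Real.rpow_nonneg (by linarith [hD1 j hj]) _) _) (by norm_num)
    · have h24 : ((24 : ℝ) ^ d) ^ (1 / (d : ℝ)) = 24 := by
        rw [one_div, Real.pow_rpow_inv_natCast (by norm_num) hd0]
      rw [← h24]
      refine Real.rpow_le_rpow (by positivity) ?_ (by positivity)
      have : (3 : ℝ) ≤ 3 ^ d := by
        calc (3 : ℝ) = 3 ^ 1 := by norm_num
          _ ≤ 3 ^ d := pow_le_pow_right₀ (by norm_num) (by omega)
      calc (3 : ℝ) * 8 ^ d ≤ 3 ^ d * 8 ^ d := mul_le_mul_of_nonneg_right this (by positivity)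
        _ = 24 ^ d := by rw [← mul_pow]; norm_num
    · refine Real.rpow_le_rpow (Finset.sum_nonneg fun j hj =>
        Real.rpow_nonneg (by linarith [hD1 j hj]) _) ?_ h0
      exact Finset.sum_le_sum_of_subset_of_nonneg (Finset.subset_univ _)
        fun j _ _ => Real.rpow_nonneg (Nat.cast_nonneg _) _

-- Every hit exposed sphere is charged one for itself and, if it is critical, its degree for its
-- neighbors.
open Classical in
theorem card_cut_le (t : ℝ) (Z : Set (Fin n)) :
    (S.cut t Z).card ≤ ∑ j ∈ S.relevant, ((if S.Hit t j ∧ S.Exposed Z j then 1 else 0) +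
      (if S.Hit t j ∧ S.Exposed Z j ∧ j ∈ Z then (S.graph.neighborSet j).ncard else 0)) := by
  have hsub : S.cut t Z ⊆ ({j ∈ S.relevant | S.Hit t j ∧ S.Exposed Z j} : Finset (Fin n)) ∪
      ({j ∈ S.relevant | S.Hit t j ∧ S.Exposed Z j ∧ j ∈ Z} : Finset (Fin n)).biUnion
        (fun j => (S.graph.neighborSet j).toFinset) := by
    intro l hl
    rw [Finset.mem_union]
    rcases (Finset.mem_filter.1 hl).2 with h | ⟨j, hj, hjE, hjZ, hadj⟩
    · exact Or.inl (Finset.mem_filter.2 ⟨h.1.1, h⟩)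
    · exact Or.inr (Finset.mem_biUnion.2 ⟨j, Finset.mem_filter.2 ⟨hj.1, hj, hjE, hjZ⟩,
        Set.mem_toFinset.2 hadj⟩)
  refine (Finset.card_le_card hsub).trans ((Finset.card_union_le _ _).trans ?_)
  rw [Finset.sum_add_distrib, ← Finset.sum_filter, ← Finset.sum_filter, ← Finset.card_eq_sum_ones]
  refine Nat.add_le_add_left (Finset.card_biUnion_le.trans (Finset.sum_le_sum fun j _ => ?_)) _
  rw [Set.ncard_eq_toFinset_card']

/-- The expected number of spheres removed in one cut. -/
theorem lintegral_card_cut_le (hd : 2 ≤ d) (hr : ∀ i, 0 < S.r i) (hρ : 0 < S.ρ)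
    (hν : ∀ i < n, CoordIndep ν i) {τ : ℕ} (hτ : n ≤ τ) (hντ : CoordIndep ν τ)
    (hU : ∀ j ∈ S.U, 1 ≤ (S.graph.neighborSet j).ncard) :
    ∫⁻ ω, ((S.cut (S.radius (ω τ)) (critical S.graph ω)).card : ENNReal) ∂ν ≤
      ENNReal.ofReal (48 * degreeBound d S.graph) := by
  classical
  have hrel : ∀ k ∈ S.relevant, k ∈ S.U := fun k hk => (Finset.mem_filter.1 hk).1
  set H : Fin n → Set unitInterval := fun j => {u | S.Hit (S.radius u) j} with hH
  have hHm : ∀ j, MeasurableSet (H j) := fun j => measurableSet_hit hd hr hρ j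
  set A : Fin n → Set Tape := fun j => S.exposedEvent j ∩ {ω | ω τ ∈ H j} with hA
  set B : Fin n → Set Tape := fun j => S.topEvent j ∩ {ω | ω τ ∈ H j} with hB
  have hAm : ∀ j, MeasurableSet (A j) := fun j =>
    (measurableSet_exposedEvent j).inter (measurable_pi_apply τ (hHm j))
  have hBm : ∀ j, MeasurableSet (B j) := fun j =>
    (measurableSet_topEvent j).inter (measurable_pi_apply τ (hHm j))
  -- The random number for the radius sits beyond the first `n` tape entries, which are the coins of
  -- the vertices.
  have hne : ∀ k : Fin n, (k : ℕ) ≠ τ := fun k => by omega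
  have hAr : ∀ j, ν.real (A j) = ν.real (S.exposedEvent j) * volume.real (H j) := fun j =>
    hντ.real (measurableSet_exposedEvent j) (ignoresCoord_exposedEvent fun k _ _ => hne k) (hHm j)
  have hBr : ∀ j, ν.real (B j) = ν.real (S.topEvent j) * volume.real (H j) := fun j =>
    hντ.real (measurableSet_topEvent j) (ignoresCoord_topEvent (hne j) fun k _ _ => hne k) (hHm j)
  have hpt : ∀ ω, ((S.cut (S.radius (ω τ)) (critical S.graph ω)).card : ENNReal) ≤
      ∑ j ∈ S.relevant, ((A j).indicator (fun _ => 1) ω +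
        (B j).indicator (fun _ => ((S.graph.neighborSet j).ncard : ENNReal)) ω) := by
    intro ω
    refine (Nat.cast_le.2 (card_cut_le _ _)).trans (le_of_eq ?_)
    push_cast
    refine Finset.sum_congr rfl fun j _ => ?_
    simp only [Set.indicator_apply]
    congr 2
    · exact propext and_comm
    · refine propext ⟨fun h => ⟨⟨h.2.1, h.2.2⟩, h.1⟩, fun h => ⟨h.2, h.1.1, h.1.2⟩⟩
  refine (lintegral_mono hpt).trans ?_
  have hmeas : ∀ j, Measurable fun ω => (A j).indicator (fun _ => (1 : ENNReal)) ω +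
      (B j).indicator (fun _ => ((S.graph.neighborSet j).ncard : ENNReal)) ω := fun j =>
    (measurable_const.indicator (hAm j)).add (measurable_const.indicator (hBm j))
  rw [lintegral_finsetSum _ (fun j _ => hmeas j)]
  -- Both charges have the same expectation, since `D · P(top) = P(exposed)`; hence the factor `2`.
  have hterm : ∀ j ∈ S.relevant, ∫⁻ ω, ((A j).indicator (fun _ => 1) ω +
      (B j).indicator (fun _ => ((S.graph.neighborSet j).ncard : ENNReal)) ω) ∂ν =
      ENNReal.ofReal (2 * (volume.real (H j) * ν.real (S.exposedEvent j))) := by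
    intro j hj
    rw [lintegral_add_left (measurable_const.indicator (hAm j)),
      lintegral_indicator_const (hAm j), lintegral_indicator_const (hBm j), one_mul,
      ← ofReal_measureReal, ← ofReal_measureReal, ← ENNReal.ofReal_natCast,
      ← ENNReal.ofReal_mul (Nat.cast_nonneg _),
      ← ENNReal.ofReal_add measureReal_nonneg
        (mul_nonneg (Nat.cast_nonneg _) measureReal_nonneg), hAr, hBr,
      ← measureReal_topEvent hd hr hν (hU j (hrel j hj))]
    congr 1
    ring
  rw [Finset.sum_congr rfl hterm, ← ENNReal.ofReal_sum_of_nonneg (fun j _ =>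
    mul_nonneg (by norm_num) (mul_nonneg measureReal_nonneg measureReal_nonneg)),
    ← Finset.mul_sum]
  refine ENNReal.ofReal_le_ofReal ?_
  have := sum_hit_mul_le hd hr hρ hν hU
  linarith

end Expectation
end Layout
end SphereSep

namespace SphereSep

/-! ### Searching for a small ball with many points -/

section Search
open Classical
variable {X : Type*} [PseudoMetricSpace X] {n : ℕ}

/-- The largest distance between the `i`-th point and a point with index in `V`. -/
noncomputable def spread (y : Fin n → X) (V : Finset (Fin n)) (i : Fin n) : ℝ :=
  (V.sup fun l => nndist (y i) (y l) : NNReal)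

/-- The indices in `U` of points at distance at most `R` from the `i`-th point. -/
noncomputable def nearby (y : Fin n → X) (U : Finset (Fin n)) (R : ℝ) (i : Fin n) :
    Finset (Fin n) := {l ∈ U | dist (y i) (y l) ≤ R}

theorem spread_nonneg (y : Fin n → X) (V : Finset (Fin n)) (i : Fin n) : 0 ≤ spread y V i :=
  NNReal.coe_nonneg _

theorem dist_le_spread (y : Fin n → X) {V : Finset (Fin n)} (i : Fin n) {l : Fin n} (hl : l ∈ V) :
    dist (y i) (y l) ≤ spread y V i := by
  rw [← coe_nndist, spread, NNReal.coe_le_coe]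
  exact Finset.le_sup (f := fun l => nndist (y i) (y l)) hl

theorem exists_dist_eq_spread (y : Fin n → X) {V : Finset (Fin n)} (i : Fin n) (hV : V.Nonempty) :
    ∃ l ∈ V, dist (y i) (y l) = spread y V i := by
  obtain ⟨l, hl, h⟩ := Finset.exists_mem_eq_sup V hV fun l => nndist (y i) (y l)
  exact ⟨l, hl, by rw [spread, h, coe_nndist]⟩

theorem spread_le (y : Fin n → X) {V : Finset (Fin n)} (i : Fin n) {M : ℝ} (h0 : 0 ≤ M)
    (hle : ∀ l ∈ V, dist (y i) (y l) ≤ M) : spread y V i ≤ M := by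
  by_cases hV : V.Nonempty
  · obtain ⟨l, hl, h⟩ := exists_dist_eq_spread y i hV
    exact h ▸ hle l hl
  · rw [Finset.not_nonempty_iff_eq_empty] at hV
    subst hV
    simpa [spread] using h0

/-- The search for a small ball around a point that contains a definite proportion of all points:
`ptr` is the next candidate for the center, and `ctr` and `rad` describe the current ball. -/
structure SearchState (n : ℕ) where
  ptr : ℕ
  ctr : Fin n
  rad : ℝ

/-- The candidate with the given index is the center of a ball much smaller than the current one. -/
def Improves (y : Fin n → X) (U : Finset (Fin n)) (K : ℕ) (R : ℝ) (i : Fin n) : Prop :=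
  i ∈ U ∧ 0 < R ∧ U.card ≤ K * (nearby y U (R / 4) i).card

/-- One step of the search. -/
noncomputable def searchStep (y : Fin n → X) (U : Finset (Fin n)) (K : ℕ) (x : SearchState n) :
    SearchState n :=
  if h : x.ptr < n then
    if Improves y U K x.rad ⟨x.ptr, h⟩ then
      ⟨x.ptr, ⟨x.ptr, h⟩, spread y (nearby y U (x.rad / 4) ⟨x.ptr, h⟩) ⟨x.ptr, h⟩⟩
    else ⟨x.ptr + 1, x.ctr, x.rad⟩
  else x

/-- The points fall into at most `m` clusters of diameter at most `2 R`. -/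
def Clusters (y : Fin n → X) (R : ℝ) (m : ℕ) : Prop :=
  ∃ f : Fin n → Fin n, (Finset.univ.image f).card ≤ m ∧
    ∀ i j, f i = f j → dist (y i) (y j) ≤ 2 * R

/-- The clusters at scale `R'` have diameter at most `R / 2`, so `a` and `b` are in different ones.
Their union has diameter at most `R / 2 + R + R / 2`, so it is a legitimate cluster at scale `R`.
This bounds the number of times the radius can shrink. -/
theorem Clusters.merge {y : Fin n → X} {R R' : ℝ} {m : ℕ} (h : Clusters y R' m) (hR : 0 < R)
    (hR' : R' ≤ R / 4) {a b : Fin n} (hab : dist (y a) (y b) = R) : Clusters y R (m - 1) := by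
  obtain ⟨f, hf, hdiam⟩ := h
  have hne : f a ≠ f b := fun h => by
    have := hdiam a b h
    linarith
  refine ⟨fun x => if f x = f a then f b else f x, ?_, fun i j hij => ?_⟩
  · have hsub : Finset.univ.image (fun x => if f x = f a then f b else f x) ⊆
        (Finset.univ.image f).erase (f a) := by
      intro z hz
      obtain ⟨x, -, rfl⟩ := Finset.mem_image.1 hz
      rw [Finset.mem_erase]
      by_cases hx : f x = f a
      · rw [if_pos hx]
        exact ⟨hne.symm, Finset.mem_image_of_mem f (Finset.mem_univ b)⟩
      · rw [if_neg hx]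
        exact ⟨hx, Finset.mem_image_of_mem f (Finset.mem_univ x)⟩
    refine (Finset.card_le_card hsub).trans ?_
    rw [Finset.card_erase_of_mem (Finset.mem_image_of_mem f (Finset.mem_univ a))]
    omega
  · have far : ∀ i j, f i = f a → f j = f b → dist (y i) (y j) ≤ 2 * R := by
      intro i j hi hj
      have h1 := hdiam i a hi
      have h2 := hdiam b j hj.symm
      have h3 := dist_triangle4 (y i) (y a) (y b) (y j)
      linarith
    have near : ∀ i j, f i = f j → dist (y i) (y j) ≤ 2 * R := fun i j h => by
      have := hdiam i j h
      linarith
    by_cases hi : f i = f a <;> by_cases hj : f j = f a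
    · exact near i j (hi.trans hj.symm)
    · simp only [if_pos hi, if_neg hj] at hij
      exact far i j hi hij.symm
    · simp only [if_neg hi, if_pos hj] at hij
      rw [dist_comm]
      exact far j i hj hij
    · simp only [if_neg hi, if_neg hj] at hij
      exact near i j hij

/-- The invariant of the search after `t` steps. -/
structure SearchInv (y : Fin n → X) (U : Finset (Fin n)) (K t : ℕ) (x : SearchState n) : Prop where
  ptr_le : x.ptr ≤ n
  ctr_mem : U.Nonempty → x.ctr ∈ U
  rad_nonneg : 0 ≤ x.rad
  card_le : U.card ≤ K * (nearby y U x.rad x.ctr).card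
  lt_card : 0 < x.rad → ∀ i ∈ U, (i : ℕ) < x.ptr →
    K * (nearby y U (x.rad / 4) i).card < U.card
  attained : 0 < x.rad → ∃ i j, dist (y i) (y j) = x.rad
  -- Here `k` counts the shrinkings so far; every other step with the pointer below `n` has advanced
  -- it. Each shrinking raises by one the number of clusters needed at the current scale.
  progress : ∃ k, (x.ptr < n → x.ptr + k = t) ∧ ∀ m, Clusters y x.rad m → k + 1 ≤ m

theorem nearby_mono (y : Fin n → X) (U : Finset (Fin n)) {R R' : ℝ} (h : R ≤ R') (i : Fin n) :
    nearby y U R i ⊆ nearby y U R' i := by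
  intro l hl
  rw [nearby, Finset.mem_filter] at hl ⊢
  exact ⟨hl.1, hl.2.trans h⟩

theorem searchInv_init (y : Fin n → X) (U : Finset (Fin n)) {K : ℕ} (hK : 1 ≤ K) {i : Fin n}
    (hi : U.Nonempty → i ∈ U) : SearchInv y U K 0 ⟨0, i, spread y U i⟩ where
  ptr_le := Nat.zero_le _
  ctr_mem := hi
  rad_nonneg := spread_nonneg _ _ _
  card_le := by
    have : nearby y U (spread y U i) i = U :=
      Finset.filter_true_of_mem fun l hl => dist_le_spread y i hl
    simp only [this]
    exact Nat.le_mul_of_pos_left _ hK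
  lt_card _ _ _ h := absurd h (Nat.not_lt_zero _)
  attained h := by
    by_cases hU : U.Nonempty
    · obtain ⟨l, -, hl⟩ := exists_dist_eq_spread y i hU
      exact ⟨i, l, hl⟩
    · rw [Finset.not_nonempty_iff_eq_empty] at hU
      subst hU
      simp [spread] at h
  progress := ⟨0, fun _ => rfl, fun m ⟨f, hf, _⟩ => le_trans (by
    rw [zero_add, Nat.one_le_iff_ne_zero, ← Nat.pos_iff_ne_zero, Finset.card_pos]
    exact ⟨f i, Finset.mem_image_of_mem f (Finset.mem_univ i)⟩) hf⟩

/-- A rejected candidate never has to be examined again, because the radius only decreases and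
smaller balls contain fewer points. An accepted one divides the radius by at least `4`, so
`Clusters.merge` applies to the pair that attains the old radius. -/
theorem SearchInv.step {y : Fin n → X} {U : Finset (Fin n)} {K t : ℕ} {x : SearchState n}
    (h : SearchInv y U K t x) : SearchInv y U K (t + 1) (searchStep y U K x) := by
  obtain ⟨k, hk, hclus⟩ := h.progress
  unfold searchStep
  by_cases hx : x.ptr < n
  · rw [dif_pos hx]
    by_cases himp : Improves y U K x.rad ⟨x.ptr, hx⟩
    · rw [if_pos himp]
      obtain ⟨hmem, hpos, hcard⟩ := himp
      set i : Fin n := ⟨x.ptr, hx⟩ with hi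
      set V := nearby y U (x.rad / 4) i with hV
      have hiV : i ∈ V := by
        rw [hV, nearby, Finset.mem_filter, dist_self]
        exact ⟨hmem, by linarith⟩
      have hle : spread y V i ≤ x.rad / 4 :=
        spread_le y i (by linarith) fun l hl => (Finset.mem_filter.1 hl).2
      refine ⟨h.ptr_le, fun _ => hmem, spread_nonneg _ _ _, ?_, ?_, ?_, k + 1, fun _ => ?_, ?_⟩
      · refine hcard.trans (Nat.mul_le_mul_left K (Finset.card_le_card fun l hl => ?_))
        rw [nearby, Finset.mem_filter]
        exact ⟨(Finset.mem_filter.1 hl).1, dist_le_spread y i hl⟩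
      · intro _ j hj hjlt
        refine lt_of_le_of_lt (Nat.mul_le_mul_left K (Finset.card_le_card ?_))
          (h.lt_card hpos j hj hjlt)
        exact nearby_mono y U (by simp only; linarith) j
      · intro _
        obtain ⟨l, -, hl⟩ := exists_dist_eq_spread y i ⟨i, hiV⟩
        exact ⟨i, l, hl⟩
      · have := hk hx
        simp only
        omega
      · intro m hm
        obtain ⟨a, b, hab⟩ := h.attained hpos
        have := hclus _ (hm.merge hpos hle hab)
        omega
    · rw [if_neg himp]
      refine ⟨hx, h.ctr_mem, h.rad_nonneg, h.card_le, ?_, h.attained, k, fun _ => ?_, hclus⟩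
      · intro hpos j hj hjlt
        rcases Nat.lt_succ_iff_lt_or_eq.1 hjlt with hlt | heq
        · exact h.lt_card hpos j hj hlt
        · have hj' : j = ⟨x.ptr, hx⟩ := Fin.ext heq
          subst hj'
          by_contra hcon
          exact himp ⟨hj, hpos, not_lt.1 hcon⟩
      · have := hk hx
        simp only
        omega
  · rw [dif_neg hx]
    exact ⟨h.ptr_le, h.ctr_mem, h.rad_nonneg, h.card_le, h.lt_card, h.attained, k,
      fun h' => absurd h' hx, hclus⟩

/-- The result of the search. -/
noncomputable def search (y : Fin n → X) (U : Finset (Fin n)) (K : ℕ) (i : Fin n) :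
    SearchState n :=
  (searchStep y U K)^[2 * n] ⟨0, i, spread y U i⟩

theorem searchInv_search (y : Fin n → X) (U : Finset (Fin n)) {K : ℕ} (hK : 1 ≤ K) {i : Fin n}
    (hi : U.Nonempty → i ∈ U) : SearchInv y U K (2 * n) (search y U K i) := by
  have : ∀ t, SearchInv y U K t ((searchStep y U K)^[t] ⟨0, i, spread y U i⟩) := by
    intro t
    induction t with
    | zero => exact searchInv_init y U hK hi
    | succ t ih => rw [Function.iterate_succ_apply']; exact ih.step
  exact this _

theorem search_optimal (y : Fin n → X) (U : Finset (Fin n)) {K : ℕ} (hK : 1 ≤ K) {i : Fin n}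
    (hi : U.Nonempty → i ∈ U) (hpos : 0 < (search y U K i).rad) :
    ∀ j ∈ U, K * (nearby y U ((search y U K i).rad / 4) j).card < U.card := by
  have h := searchInv_search y U hK hi
  obtain ⟨k, hk, hclus⟩ := h.progress
  -- Singletons are clusters at any nonnegative scale, so there were at most `n - 1` shrinkings; in
  -- `2n` steps the pointer must have reached `n`.
  have hcl : Clusters y (search y U K i).rad n :=
    ⟨id, by simp, fun a b hab => by
      rw [id, id] at hab
      rw [hab, dist_self]
      linarith⟩
  have hkn := hclus n hcl
  intro j hj
  refine h.lt_card hpos j hj ?_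
  have := h.ptr_le
  have := j.2
  by_contra hcon
  have := hk (by omega)
  omega

end Search

/-! ### Comparing a large ball with small ones by a grid -/

section Grid

/-- A bound on the number of cells of a grid that is used to compare balls of different radii. -/
def cellBound (d : ℕ) : ℕ := 2 * (32 * d + 1) ^ d

theorem one_le_cellBound (d : ℕ) : 1 ≤ cellBound d := by
  have : 0 < (32 * d + 1) ^ d := by positivity
  unfold cellBound
  omega

-- Cut the cube around `z` into cells of side `R / 4`. The points of one cell lie in the ball of
-- radius `R / 4` around any of them, so each cell holds at most a proportion `1 / cellBound d` of
-- `U`, and `cellBound d` is twice the number of cells.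
open Classical in
theorem two_mul_card_le_of_sparse {d n : ℕ} (y : Fin n → Fin d → ℝ) (U : Finset (Fin n)) {R : ℝ}
    (hR : 0 < R) (h : ∀ i ∈ U, cellBound d * (nearby y U (R / 4) i).card < U.card)
    (z : Fin d → ℝ) {V : Finset (Fin n)} (hVU : V ⊆ U) (hV : ∀ l ∈ V, dist (y l) z ≤ 4 * (d * R)) :
    2 * V.card ≤ U.card := by
  let g : Fin n → Fin d → ℤ := fun l a => ⌊(y l a - z a + 4 * (d * R)) / (R / 4)⌋
  -- The width `8 d R` consists of `32 d` intervals of length `R / 4`; one more index is needed for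
  -- the closed right end.
  let T : Finset (Fin d → ℤ) := Fintype.piFinset fun _ => Finset.Ico (0 : ℤ) (32 * d + 1)
  have hT : T.card = (32 * d + 1) ^ d := by
    simp only [T, Fintype.card_piFinset, Int.card_Ico, Finset.prod_const, Finset.card_univ,
      Fintype.card_fin]
    congr 1
  have hmaps : ∀ l ∈ V, g l ∈ T := by
    intro l hl
    have hc : ∀ a, |y l a - z a| ≤ 4 * (d * R) := fun a =>
      (dist_le_pi_dist (y l) z a).trans (hV l hl)
    simp only [T, Fintype.mem_piFinset, Finset.mem_Ico, g]
    intro a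
    have := abs_le.1 (hc a)
    constructor
    · exact Int.floor_nonneg.2 (div_nonneg (by linarith) (by linarith))
    · rw [Int.lt_add_one_iff, ← Int.cast_le (R := ℝ)]
      refine (Int.floor_le _).trans ?_
      rw [div_le_iff₀ (by linarith)]
      push_cast
      linarith
  have hfib : ∀ b ∈ T, cellBound d * ({l ∈ V | g l = b} : Finset (Fin n)).card ≤ U.card := by
    intro b _
    by_cases hne : ({l ∈ V | g l = b} : Finset (Fin n)).Nonempty
    · obtain ⟨i, hi⟩ := hne
      obtain ⟨hiV, hib⟩ := Finset.mem_filter.1 hi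
      refine le_trans (Nat.mul_le_mul_left _ (Finset.card_le_card fun l hl => ?_))
        (h i (hVU hiV)).le
      obtain ⟨hlV, hlb⟩ := Finset.mem_filter.1 hl
      rw [nearby, Finset.mem_filter]
      refine ⟨hVU hlV, (dist_pi_le_iff (by linarith)).2 fun a => ?_⟩
      have hfl : g i a = g l a := by rw [hib, hlb]
      have := Int.abs_sub_lt_one_of_floor_eq_floor hfl
      rw [← sub_div, abs_div, abs_of_pos (show 0 < R / 4 by linarith), div_lt_one (by linarith),
        add_sub_add_right_eq_sub, sub_sub_sub_cancel_right] at this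
      exact this.le
    · rw [Finset.not_nonempty_iff_eq_empty] at hne
      simp [hne]
  have hsum : cellBound d * V.card ≤ T.card * U.card := by
    rw [Finset.card_eq_sum_card_fiberwise hmaps, Finset.mul_sum, ← smul_eq_mul,
      ← Finset.sum_const]
    exact Finset.sum_le_sum hfib
  rw [hT, cellBound] at hsum
  have hpos : 0 < (32 * d + 1) ^ d := by positivity
  rw [mul_assoc, mul_left_comm] at hsum
  exact Nat.le_of_mul_le_mul_left hsum hpos

end Grid
end SphereSep

namespace SphereSep
open Metric MeasureTheory RealRAM

/-! ### The randomized construction and its balance -/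

section Algorithm
variable {d n : ℕ}

/-- A point of the `i`-th sphere. -/
noncomputable def pt (c : Fin n → EuclideanSpace ℝ (Fin d)) (r : Fin n → ℝ) (i : Fin n) :
    EuclideanSpace ℝ (Fin d) :=
  WithLp.toLp 2 fun a => c i a + if (a : ℕ) = 0 then r i else 0

theorem pt_mem_sphere (hd : 2 ≤ d) (c : Fin n → EuclideanSpace ℝ (Fin d)) {r : Fin n → ℝ}
    (hr : ∀ i, 0 < r i) (i : Fin n) : pt c r i ∈ sphere (c i) (r i) := by
  have : pt c r i = c i + EuclideanSpace.single ⟨0, by omega⟩ (r i) := by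
    ext a
    simp only [pt, PiLp.add_apply, PiLp.single_apply, Fin.ext_iff]
  rw [mem_sphere, this, dist_self_add_left, PiLp.norm_single, Real.norm_eq_abs,
    abs_of_pos (hr i)]

/-- The coordinates of the points chosen on the spheres, with the supremum distance. -/
noncomputable def coords (c : Fin n → EuclideanSpace ℝ (Fin d)) (r : Fin n → ℝ) (i : Fin n) :
    Fin d → ℝ := (pt c r i).ofLp

theorem dist_ofLp_le (x y : EuclideanSpace ℝ (Fin d)) : dist x.ofLp y.ofLp ≤ dist x y :=
  (dist_pi_le_iff dist_nonneg).2 fun a => by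
    rw [dist_eq_norm, dist_eq_norm, ← PiLp.sub_apply]
    exact PiLp.norm_apply_le (x - y) a

/-- The factor `d` is cruder than the square root of `d`, but it is rational, so that the machine
can compute `ρ`. -/
theorem dist_le_mul_dist_ofLp (x y : EuclideanSpace ℝ (Fin d)) :
    dist x y ≤ d * dist x.ofLp y.ofLp := by
  rw [EuclideanSpace.dist_eq]
  refine Real.sqrt_le_iff.2 ⟨by positivity, ?_⟩
  have hd : (d : ℝ) ≤ (d : ℝ) ^ 2 := by
    exact_mod_cast Nat.le_self_pow two_ne_zero d
  calc ∑ a, dist (x a) (y a) ^ 2 ≤ ∑ _a : Fin d, dist x.ofLp y.ofLp ^ 2 :=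
        Finset.sum_le_sum fun a _ => pow_le_pow_left₀ dist_nonneg (dist_le_pi_dist _ _ a) 2
    _ = d * dist x.ofLp y.ofLp ^ 2 := by simp
    _ ≤ d ^ 2 * dist x.ofLp y.ofLp ^ 2 := mul_le_mul_of_nonneg_right hd (by positivity)
    _ = (d * dist x.ofLp y.ofLp) ^ 2 := by ring

variable [NeZero n]

open Classical in
/-- The index at which the search starts. -/
noncomputable def startIndex (U : Finset (Fin n)) : Fin n :=
  if h : U.Nonempty then U.max' h else 0

theorem startIndex_mem {U : Finset (Fin n)} (h : U.Nonempty) : startIndex U ∈ U := by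
  rw [startIndex, dif_pos h]
  exact U.max'_mem h

variable (c : Fin n → EuclideanSpace ℝ (Fin d)) (r : Fin n → ℝ)

/-- The ball found by the search in the subfamily `U`. -/
noncomputable def found (U : Finset (Fin n)) : SearchState n :=
  search (coords c r) U (cellBound d) (startIndex U)

/-- The layout along which the subfamily `U` is cut. -/
noncomputable def layout (U : Finset (Fin n)) : Layout d n :=
  ⟨c, r, U, pt c r (found c r U).ctr, d * (found c r U).rad⟩

open Classical in
/-- The part of the subfamily that remains to be cut. -/
noncomputable def next (U : Finset (Fin n)) (u : unitInterval) : Finset (Fin n) :=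
  if (found c r U).rad = 0 then ∅
  else {l ∈ U | (layout c r U).radius u < dist (pt c r l) (layout c r U).q}

open Classical in
/-- The spheres that are removed when the subfamily `U` is treated. -/
noncomputable def removed (U : Finset (Fin n)) (u : unitInterval) (Z : Set (Fin n)) :
    Finset (Fin n) :=
  if (found c r U).rad = 0 then U else (layout c r U).cut ((layout c r U).radius u) Z

open Classical in
/-- The subfamily that remains to be cut after `s` steps. -/
noncomputable def hist (ω : Tape) : ℕ → Finset (Fin n)
  | 0 => {i | 1 ≤ ((sphereGraph c r).neighborSet i).ncard}
  | s + 1 => next c r (hist ω s) (ω (n + s))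

/-- The spheres removed in the `s`-th step. -/
noncomputable def removedAt (ω : Tape) (s : ℕ) : Finset (Fin n) :=
  removed c r (hist c r ω s) (ω (n + s)) (critical (sphereGraph c r) ω)

/-- The separator. -/
def separator (ω : Tape) : Set (Fin n) := {i | ∃ s < cellBound d, i ∈ removedAt c r ω s}

variable {c r}

theorem found_inv (U : Finset (Fin n)) :
    SearchInv (coords c r) U (cellBound d) (2 * n) (found c r U) :=
  searchInv_search _ _ (one_le_cellBound d) startIndex_mem

theorem rad_pos {U : Finset (Fin n)} (h : (found c r U).rad ≠ 0) : 0 < (found c r U).rad :=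
  lt_of_le_of_ne (found_inv U).rad_nonneg h.symm

theorem layout_rho_pos (hd : 2 ≤ d) {U : Finset (Fin n)} (h : (found c r U).rad ≠ 0) :
    0 < (layout c r U).ρ := by
  have : (0 : ℝ) < d := by exact_mod_cast (by omega : 0 < d)
  exact mul_pos this (rad_pos h)

-- A Euclidean ball of radius `4ρ = 4 d R` lies in the cube to which the grid count applies, and the
-- search guarantees the sparsity hypothesis at radius `R / 4`.
open Classical in
theorem card_near_le {U : Finset (Fin n)} (h : (found c r U).rad ≠ 0) :
    2 * ({l ∈ U | dist (pt c r l) (layout c r U).q ≤ 4 * (layout c r U).ρ} :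
      Finset (Fin n)).card ≤ U.card := by
  refine two_mul_card_le_of_sparse (coords c r) U (rad_pos h)
    (search_optimal _ _ (one_le_cellBound d) startIndex_mem (rad_pos h))
    (layout c r U).q.ofLp (Finset.filter_subset _ _) fun l hl => ?_
  exact (dist_ofLp_le _ _).trans (Finset.mem_filter.1 hl).2

theorem next_subset (U : Finset (Fin n)) (u : unitInterval) : next c r U u ⊆ U := by
  unfold next
  split_ifs
  · exact Finset.empty_subset _
  · exact Finset.filter_subset _ _

theorem removed_subset (U : Finset (Fin n)) (u : unitInterval) (Z : Set (Fin n)) :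
    removed c r U u Z ⊆ U := by
  classical
  unfold removed
  split_ifs
  · exact subset_rfl
  · exact Finset.filter_subset _ _

theorem hist_subset (ω : Tape) (s : ℕ) : hist c r ω s ⊆ hist c r ω 0 := by
  induction s with
  | zero => exact subset_rfl
  | succ s ih => exact (next_subset _ _).trans ih

theorem one_le_ncard_of_mem_hist {ω : Tape} {s : ℕ} {i : Fin n} (h : i ∈ hist c r ω s) :
    1 ≤ ((sphereGraph c r).neighborSet i).ncard := by
  have := hist_subset ω s h
  rw [hist, Finset.mem_filter] at this
  exact this.2

/-- The points of the ball found by the search have Euclidean distance at most `ρ` from `q`, hence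
do not lie outside the cutting sphere; they are at least a proportion `1 / cellBound d` of `U`. -/
theorem card_next_le (hd : 2 ≤ d) (U : Finset (Fin n)) (u : unitInterval) :
    ((next c r U u).card : ℝ) ≤ (1 - 1 / (cellBound d : ℝ)) * U.card := by
  classical
  have hK : (1 : ℝ) ≤ cellBound d := by exact_mod_cast one_le_cellBound d
  have hK0 : (0 : ℝ) < cellBound d := by linarith
  by_cases h : (found c r U).rad = 0
  · rw [next, if_pos h]
    simp only [Finset.card_empty, Nat.cast_zero]
    refine mul_nonneg ?_ (Nat.cast_nonneg _)
    rw [sub_nonneg, div_le_one hK0]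
    exact hK
  · have hinv := found_inv (c := c) (r := r) U
    set x := found c r U with hx
    have hdisj : Disjoint (next c r U u) (nearby (coords c r) U x.rad x.ctr) := by
      rw [Finset.disjoint_left]
      intro l hl hl'
      rw [next, if_neg h, Finset.mem_filter] at hl
      rw [nearby, Finset.mem_filter, dist_comm] at hl'
      have h1 := Layout.le_radius (layout_rho_pos hd h) u
      have h2 := dist_le_mul_dist_ofLp (pt c r l) (layout c r U).q
      have h3 : dist (pt c r l).ofLp (layout c r U).q.ofLp ≤ x.rad := hl'.2
      have h4 : (d : ℝ) * dist (pt c r l).ofLp (layout c r U).q.ofLp ≤ d * x.rad :=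
        mul_le_mul_of_nonneg_left h3 (Nat.cast_nonneg _)
      have h5 : (layout c r U).ρ = d * x.rad := rfl
      linarith [hl.2]
    have hle : (next c r U u).card + (nearby (coords c r) U x.rad x.ctr).card ≤ U.card := by
      rw [← Finset.card_union_of_disjoint hdisj]
      exact Finset.card_le_card (Finset.union_subset (next_subset _ _) (Finset.filter_subset _ _))
    have hle' : ((next c r U u).card : ℝ) + (nearby (coords c r) U x.rad x.ctr).card ≤ U.card := by
      exact_mod_cast hle
    have hc : (U.card : ℝ) ≤ cellBound d * (nearby (coords c r) U x.rad x.ctr).card := by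
      exact_mod_cast hinv.card_le
    have : (U.card : ℝ) / cellBound d ≤ (nearby (coords c r) U x.rad x.ctr).card := by
      rw [div_le_iff₀ hK0]; linarith
    rw [sub_mul, one_mul, one_div_mul_eq_div]
    linarith

/-- With `K = cellBound d` rounds the remaining proportion is at most `(1 - 1/K)^K ≤ 1/e < 2/3`. -/
theorem card_hist_le (hd : 2 ≤ d) (ω : Tape) :
    ((hist c r ω (cellBound d)).card : ℝ) ≤ 2 / 3 * n := by
  have hK : (1 : ℝ) ≤ cellBound d := by exact_mod_cast one_le_cellBound d
  have hK0 : (0 : ℝ) < cellBound d := by linarith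
  have h0 : 0 ≤ 1 - 1 / (cellBound d : ℝ) := by
    rw [sub_nonneg, div_le_one hK0]
    exact hK
  have key : ∀ s, ((hist c r ω s).card : ℝ) ≤ (1 - 1 / (cellBound d : ℝ)) ^ s * n := by
    intro s
    induction s with
    | zero =>
      rw [pow_zero, one_mul]
      exact_mod_cast (Finset.card_le_univ _).trans (by simp)
    | succ s ih =>
      refine (card_next_le hd _ _).trans ?_
      rw [pow_succ', mul_assoc]
      exact mul_le_mul_of_nonneg_left ih h0
  refine (key _).trans (mul_le_mul_of_nonneg_right ?_ (Nat.cast_nonneg _))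
  calc (1 - 1 / (cellBound d : ℝ)) ^ cellBound d
      ≤ Real.exp (-(1 / (cellBound d : ℝ))) ^ cellBound d :=
        pow_le_pow_left₀ h0 (Real.one_sub_le_exp_neg _) _
    _ = Real.exp (-1) := by
        rw [← Real.exp_nat_mul]
        congr 1
        field_simp
    _ ≤ 2 / 3 := by
        rw [Real.exp_neg, inv_le_comm₀ (Real.exp_pos 1) (by norm_num)]
        linarith [Real.exp_one_gt_d9]

/-- A linked set of vertices that avoids the separator is small. -/
theorem ncard_le_of_linked (hd : 2 ≤ d) (hr : ∀ i, 0 < r i) (ω : Tape) {K : Set (Fin n)}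
    (hK : Layout.Linked (sphereGraph c r) K) (hne : K.Nonempty) (hK0 : K ⊆ hist c r ω 0)
    (hKX : ∀ v ∈ K, v ∉ separator c r ω) : (K.ncard : ℝ) ≤ 2 / 3 * n := by
  -- In each round the set is either found to be small or passes entirely to the next subfamily. A
  -- round with radius zero removes the whole subfamily, so no nonempty set can survive it.
  have key : ∀ s ≤ cellBound d, (K.ncard : ℝ) ≤ 2 / 3 * n ∨ K ⊆ hist c r ω s := by
    intro s
    induction s with
    | zero => exact fun _ => Or.inr hK0
    | succ s ih =>
      intro hs
      rcases ih (by omega) with h | hKs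
      · exact Or.inl h
      have hrem : ∀ v ∈ K, v ∉ removedAt c r ω s := fun v hv h => hKX v hv ⟨s, hs, h⟩
      by_cases h : (found c r (hist c r ω s)).rad = 0
      · obtain ⟨v, hv⟩ := hne
        refine absurd (hKs hv) (fun hv' => hrem v hv ?_)
        rw [removedAt, removed, if_pos h]
        exact hv'
      · have hρ := layout_rho_pos hd h
        rcases Layout.linked_dichotomy (S := layout c r (hist c r ω s)) hd hr
          (pt_mem_sphere hd c hr) (card_near_le h) hρ
          (Layout.le_radius hρ (ω (n + s))) (Layout.radius_le hρ (ω (n + s)))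
          (Z := critical (sphereGraph c r) ω) hK hKs (fun v hv hv' => hrem v hv (by
            rw [removedAt, removed, if_neg h]; exact hv')) with h1 | h1
        · left
          have h2 : (hist c r ω s).card ≤ n := (Finset.card_le_univ _).trans (by simp)
          have h3 : 2 * K.ncard ≤ n := h1.trans h2
          have h4 : 2 * (K.ncard : ℝ) ≤ n := by exact_mod_cast h3
          have h5 : (0 : ℝ) ≤ n := Nat.cast_nonneg n
          linarith
        · right
          intro v hv
          rw [hist, next, if_neg h, Finset.mem_coe, Finset.mem_filter]
          exact ⟨hKs hv, h1 v hv⟩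
  rcases key _ le_rfl with h | h
  · exact h
  · refine le_trans ?_ (card_hist_le (c := c) (r := r) hd ω)
    rw [← Set.ncard_coe_finset]
    exact_mod_cast Set.ncard_le_ncard h (Set.toFinite _)

theorem isBalancedSeparator_separator (hd : 2 ≤ d) (hn : 2 ≤ n) (hr : ∀ i, 0 < r i) (ω : Tape) :
    IsBalancedSeparator (sphereGraph c r) (separator c r ω) := by
  intro K
  let K' : Set (Fin n) := Subtype.val '' K.supp
  have hcard : K.supp.ncard = K'.ncard := (Set.ncard_image_of_injective _
    Subtype.val_injective).symm
  rw [hcard, Nat.card_eq_fintype_card, Fintype.card_fin]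
  have hlink : Layout.Linked (sphereGraph c r) K' := by
    rintro P ⟨_, ⟨v, hv, rfl⟩, hPv⟩ hP _ ⟨w, hw, rfl⟩
    have hreach : ((sphereGraph c r).induce (separator c r ω)ᶜ).Reachable v w :=
      SimpleGraph.ConnectedComponent.exact (hv.trans hw.symm)
    obtain ⟨p⟩ := hreach
    induction p with
    | nil => exact hPv
    | @cons a b e hab p ih =>
      have hb : b ∈ K.supp := by
        rw [SimpleGraph.ConnectedComponent.mem_supp_iff] at hv ⊢
        rw [← hv]
        exact (SimpleGraph.ConnectedComponent.sound hab.reachable).symm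
      exact ih hb (hP a ⟨a, hv, rfl⟩ b ⟨b, hb, rfl⟩ hab hPv) hw
  have hne : K'.Nonempty := K.nonempty_supp.image _
  -- The initial subfamily omits the isolated vertices. A component that contains one is a single
  -- vertex, and `1 ≤ 2/3 * n` because `n ≥ 2`.
  by_cases hiso : K' ⊆ hist c r ω 0
  · refine ncard_le_of_linked hd hr ω hlink hne hiso ?_
    rintro _ ⟨v, -, rfl⟩
    exact v.2
  · obtain ⟨v, hv, hv'⟩ := Set.not_subset.1 hiso
    have hdeg : (sphereGraph c r).neighborSet v = ∅ := by
      by_contra h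
      refine hv' ?_
      rw [hist, Finset.mem_coe, Finset.mem_filter]
      exact ⟨Finset.mem_univ _, (Set.ncard_pos (Set.toFinite _)).2
        (Set.nonempty_iff_ne_empty.2 h)⟩
    have hsub : K' ⊆ {v} := hlink (fun w => w = v) ⟨v, hv, rfl⟩ (by
      rintro a - b - hab rfl
      have : b ∈ (sphereGraph c r).neighborSet a := hab
      rw [hdeg] at this
      exact this.elim)
    have h1 := Set.ncard_le_ncard hsub (Set.finite_singleton v)
    rw [Set.ncard_singleton] at h1
    have h2 : (K'.ncard : ℝ) ≤ 1 := by exact_mod_cast h1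
    have h3 : (2 : ℝ) ≤ n := by exact_mod_cast hn
    linarith

end Algorithm
end SphereSep

namespace SphereSep
open Metric MeasureTheory RealRAM

/-! ### Expected size of the separator -/

section Cost
variable {d n : ℕ}

/-- A clique is not much larger than the bound. -/
theorem card_le_of_clique (hd : 2 ≤ d) (G : SimpleGraph (Fin n)) {A : Finset (Fin n)}
    (hA : ∀ i ∈ A, ∀ j ∈ A, i ≠ j → G.Adj i j) (hdeg : ∀ i ∈ A, 1 ≤ (G.neighborSet i).ncard) :
    (A.card : ℝ) ≤ 2 * degreeBound d G := by
  classical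
  have hd2 : (2 : ℝ) ≤ d := by exact_mod_cast hd
  have hd1 : (0 : ℝ) < (d : ℝ) - 1 := by linarith
  have h0 : 0 ≤ 1 - 1 / (d : ℝ) := by
    rw [sub_nonneg, div_le_one (by linarith)]; linarith
  -- Each member has degree at least `A.card - 1` and at least `1`, hence at least `a`. The degree
  -- sum is then at least `a · a^(1/(d-1)) = a^(d/(d-1))`.
  set a : ℝ := (A.card : ℝ) / 2 with ha
  have ha0 : 0 ≤ a := by positivity
  have hle : ∀ i ∈ A, a ≤ (G.neighborSet i).ncard := by
    intro i hi
    have h1 : A.card - 1 ≤ (G.neighborSet i).ncard := by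
      rw [← Finset.card_erase_of_mem hi, ← Set.ncard_coe_finset]
      refine Set.ncard_le_ncard (fun j hj => ?_) (Set.toFinite _)
      rw [Finset.mem_coe, Finset.mem_erase] at hj
      exact hA i hi j hj.2 hj.1.symm
    have h2 := hdeg i hi
    have h3 : A.card ≤ 2 * (G.neighborSet i).ncard := by omega
    have h4 : (A.card : ℝ) ≤ 2 * (G.neighborSet i).ncard := by exact_mod_cast h3
    rw [ha]
    linarith
  have hsum : a ^ ((d : ℝ) / (d - 1)) ≤
      ∑ i, ((G.neighborSet i).ncard : ℝ) ^ (1 / ((d : ℝ) - 1)) := by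
    by_cases hz : a = 0
    · rw [hz, Real.zero_rpow (by positivity)]
      exact Finset.sum_nonneg fun _ _ => Real.rpow_nonneg (Nat.cast_nonneg _) _
    have hapos : 0 < a := lt_of_le_of_ne ha0 (Ne.symm hz)
    calc a ^ ((d : ℝ) / (d - 1)) = a * a ^ (1 / ((d : ℝ) - 1)) := by
          nth_rewrite 2 [← Real.rpow_one a]
          rw [← Real.rpow_add hapos]
          congr 1
          field_simp
          ring
      _ ≤ A.card * a ^ (1 / ((d : ℝ) - 1)) :=
          mul_le_mul_of_nonneg_right (by rw [ha]; linarith [(Nat.cast_nonneg A.card : (0:ℝ) ≤ _)])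
            (Real.rpow_nonneg ha0 _)
      _ = ∑ _i ∈ A, a ^ (1 / ((d : ℝ) - 1)) := by rw [Finset.sum_const, nsmul_eq_mul]
      _ ≤ ∑ i ∈ A, ((G.neighborSet i).ncard : ℝ) ^ (1 / ((d : ℝ) - 1)) :=
          Finset.sum_le_sum fun i hi => Real.rpow_le_rpow ha0 (hle i hi) (by positivity)
      _ ≤ _ := Finset.sum_le_sum_of_subset_of_nonneg (Finset.subset_univ _)
          fun i _ _ => Real.rpow_nonneg (Nat.cast_nonneg _) _
  have : a ≤ degreeBound d G := by
    calc a = (a ^ ((d : ℝ) / (d - 1))) ^ (1 - 1 / (d : ℝ)) := by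
          rw [← Real.rpow_mul ha0]
          have : (d : ℝ) / (d - 1) * (1 - 1 / d) = 1 := by field_simp
          rw [this, Real.rpow_one]
      _ ≤ _ := Real.rpow_le_rpow (Real.rpow_nonneg ha0 _) hsum h0
  linarith

variable [NeZero n] {c : Fin n → EuclideanSpace ℝ (Fin d)} {r : Fin n → ℝ}

/-- Radius zero means that a proportion `1 / cellBound d` of the chosen points coincide, so that
many spheres share a point and form a clique. -/
theorem card_le_of_rad_eq_zero (hd : 2 ≤ d) (hr : ∀ i, 0 < r i) {U : Finset (Fin n)}
    (hU : ∀ i ∈ U, 1 ≤ ((sphereGraph c r).neighborSet i).ncard)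
    (h : (found c r U).rad = 0) :
    (U.card : ℝ) ≤ 2 * cellBound d * degreeBound d (sphereGraph c r) := by
  have hinv := found_inv (c := c) (r := r) U
  have hcard := hinv.card_le
  rw [h] at hcard
  have hmem : ∀ l ∈ nearby (coords c r) U 0 (found c r U).ctr,
      l ∈ U ∧ pt c r l = pt c r (found c r U).ctr := by
    intro l hl
    rw [nearby, Finset.mem_filter] at hl
    exact ⟨hl.1, (WithLp.ofLp_injective 2
      (dist_le_zero.1 hl.2 : (pt c r (found c r U).ctr).ofLp = (pt c r l).ofLp)).symm⟩
  have hcl := card_le_of_clique hd (sphereGraph c r)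
    (A := nearby (coords c r) U 0 (found c r U).ctr)
    (fun i hi j hj hij => ⟨hij, pt c r i, pt_mem_sphere hd c hr i, by
      rw [(hmem i hi).2, ← (hmem j hj).2]; exact pt_mem_sphere hd c hr j⟩)
    (fun i hi => hU i (hmem i hi).1)
  have hcard' : (U.card : ℝ) ≤ cellBound d *
      (nearby (coords c r) U 0 (found c r U).ctr).card := by exact_mod_cast hcard
  calc (U.card : ℝ) ≤ cellBound d * (nearby (coords c r) U 0 (found c r U).ctr).card := hcard'
    _ ≤ cellBound d * (2 * degreeBound d (sphereGraph c r)) :=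
        mul_le_mul_of_nonneg_left hcl (Nat.cast_nonneg _)
    _ = _ := by ring

theorem lintegral_card_removed_le (hd : 2 ≤ d) (hr : ∀ i, 0 < r i) {ν : Measure Tape}
    [IsProbabilityMeasure ν] (hν : ∀ i < n, CoordIndep ν i) {τ : ℕ} (hτ : n ≤ τ)
    (hντ : CoordIndep ν τ) {U : Finset (Fin n)}
    (hU : ∀ i ∈ U, 1 ≤ ((sphereGraph c r).neighborSet i).ncard) :
    ∫⁻ ω, ((removed c r U (ω τ) (critical (sphereGraph c r) ω)).card : ENNReal) ∂ν ≤
      ENNReal.ofReal (48 * cellBound d * degreeBound d (sphereGraph c r)) := by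
  have hK : (1 : ℝ) ≤ cellBound d := by exact_mod_cast one_le_cellBound d
  have hB := degreeBound_nonneg d (sphereGraph c r)
  by_cases h : (found c r U).rad = 0
  · simp only [removed, if_pos h, lintegral_const, measure_univ, mul_one]
    rw [← ENNReal.ofReal_natCast]
    refine ENNReal.ofReal_le_ofReal ((card_le_of_rad_eq_zero hd hr hU h).trans ?_)
    refine mul_le_mul_of_nonneg_right ?_ hB
    linarith
  · simp only [removed, if_neg h]
    refine (Layout.lintegral_card_cut_le (S := layout c r U) hd hr (layout_rho_pos hd h) hν hτ hντ
      hU).trans (ENNReal.ofReal_le_ofReal ?_)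
    refine mul_le_mul_of_nonneg_right ?_ hB
    linarith

theorem measurableSet_next_eq (U V : Finset (Fin n)) : MeasurableSet {u | next c r U u = V} := by
  classical
  by_cases h : (found c r U).rad = 0
  · simp only [next, if_pos h]
    exact MeasurableSet.const _
  · have : {u | next c r U u = V} = ⋂ l : Fin n, {u | l ∈ next c r U u ↔ l ∈ V} := by
      ext u
      simp [Finset.ext_iff]
    rw [this]
    refine MeasurableSet.iInter fun l => ?_
    have hl : MeasurableSet {u | l ∈ next c r U u} := by
      have : {u | l ∈ next c r U u} = {_u | l ∈ U} ∩
          {u | (layout c r U).radius u < dist (pt c r l) (layout c r U).q} := by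
        ext u
        simp only [next, if_neg h, Finset.mem_filter, Set.mem_ofPred_eq, Set.mem_inter_iff]
      rw [this]
      unfold Layout.radius
      exact (MeasurableSet.const _).inter
        (isOpen_lt (by fun_prop) continuous_const).measurableSet
    by_cases hlV : l ∈ V
    · simpa only [hlV, iff_true] using hl
    · simp only [hlV, iff_false]
      exact hl.compl

theorem measurableSet_hist_eq (s : ℕ) (V : Finset (Fin n)) :
    MeasurableSet {ω | hist c r ω s = V} := by
  induction s generalizing V with
  | zero => simp only [hist]; exact MeasurableSet.const _
  | succ s ih =>
    have : {ω | hist c r ω (s + 1) = V} = ⋃ U : Finset (Fin n),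
        {ω | hist c r ω s = U} ∩ (fun ω : Tape => ω (n + s)) ⁻¹' {u | next c r U u = V} := by
      ext ω
      simp [hist]
    rw [this]
    exact MeasurableSet.iUnion fun U => (ih U).inter
      (measurable_pi_apply _ (measurableSet_next_eq U V))

/-- The first `s` rounds use only the tape entries `n, …, n + s - 1` to determine the subfamily; the
coins affect only what is removed. -/
theorem hist_update {s i : ℕ} (hi : i < n ∨ n + s ≤ i) (ω : Tape) (x : unitInterval) :
    hist c r (Function.update ω i x) s = hist c r ω s := by
  induction s with
  | zero => rfl
  | succ s ih =>
    rw [hist, hist, ih (by omega), Function.update_of_ne (by omega)]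

theorem measurableSet_mem_removed (hd : 2 ≤ d) (hr : ∀ i, 0 < r i) (U : Finset (Fin n)) (τ : ℕ)
    (l : Fin n) :
    MeasurableSet {ω : Tape | l ∈ removed c r U (ω τ) (critical (sphereGraph c r) ω)} := by
  classical
  by_cases h : (found c r U).rad = 0
  · simp only [removed, if_pos h]
    exact MeasurableSet.const _
  · set S := layout c r U with hS
    have hH : ∀ j, MeasurableSet {ω : Tape | S.Hit (S.radius (ω τ)) j} := fun j =>
      (show Measurable fun ω : Tape => ω τ from measurable_pi_apply τ)
        (Layout.measurableSet_hit (S := S) hd hr (layout_rho_pos hd h) j)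
    have : {ω : Tape | l ∈ removed c r U (ω τ) (critical (sphereGraph c r) ω)} =
        {_ω | l ∈ U} ∩ (({ω | S.Hit (S.radius (ω τ)) l} ∩ S.exposedEvent l) ∪
          ⋃ j : Fin n, ({ω | S.Hit (S.radius (ω τ)) j} ∩ S.topEvent j ∩
            {_ω | (sphereGraph c r).Adj j l})) := by
      ext ω
      simp only [removed, if_neg h, Layout.cut, Finset.mem_filter, Set.mem_ofPred_eq,
        Set.mem_inter_iff, Set.mem_union, Set.mem_iUnion, Layout.topEvent, Layout.exposedEvent]
      refine and_congr Iff.rfl (or_congr Iff.rfl (exists_congr fun j => ?_))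
      constructor
      · rintro ⟨h1, h2, h3, h4⟩
        exact ⟨⟨h1, h2, h3⟩, h4⟩
      · rintro ⟨⟨h1, h2, h3⟩, h4⟩
        exact ⟨h1, h2, h3, h4⟩
    rw [this]
    refine (MeasurableSet.const _).inter (((hH l).inter (Layout.measurableSet_exposedEvent l)).union
      (MeasurableSet.iUnion fun j => ((hH j).inter (Layout.measurableSet_topEvent j)).inter
        (MeasurableSet.const _)))

theorem measurable_card_removedAt (hd : 2 ≤ d) (hr : ∀ i, 0 < r i) (s : ℕ) :
    Measurable fun ω => ((removedAt c r ω s).card : ENNReal) := by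
  classical
  have hmem : ∀ l, MeasurableSet {ω | l ∈ removedAt c r ω s} := by
    intro l
    have : {ω | l ∈ removedAt c r ω s} = ⋃ U : Finset (Fin n), {ω | hist c r ω s = U} ∩
        {ω | l ∈ removed c r U (ω (n + s)) (critical (sphereGraph c r) ω)} := by
      ext ω
      simp [removedAt]
    rw [this]
    exact MeasurableSet.iUnion fun U => (measurableSet_hist_eq s U).inter
      (measurableSet_mem_removed hd hr U _ l)
  have : (fun ω => ((removedAt c r ω s).card : ENNReal)) =
      fun ω => ∑ l, {ω | l ∈ removedAt c r ω s}.indicator (fun _ => (1 : ENNReal)) ω := by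
    funext ω
    simp [Set.indicator_apply]
  rw [this]
  exact Finset.measurable_fun_sum _ fun l _ => measurable_const.indicator (hmem l)

/-- Condition on the subfamily `U` present at round `s`. The coins and the entry `n + s` keep their
law and independence, so the bound for a fixed `U` applies to each piece; the probabilities of the
pieces add up to one. -/
theorem lintegral_card_removedAt_le (hd : 2 ≤ d) (hr : ∀ i, 0 < r i) (s : ℕ) :
    ∫⁻ ω, ((removedAt c r ω s).card : ENNReal) ∂tapeLaw ≤
      ENNReal.ofReal (48 * cellBound d * degreeBound d (sphereGraph c r)) := by
  set A : Finset (Fin n) → Set Tape := fun U => {ω | hist c r ω s = U} with hA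
  have hAm : ∀ U, MeasurableSet (A U) := measurableSet_hist_eq s
  have hAi : ∀ U i, i < n ∨ n + s ≤ i → IgnoresCoord (A U) i := fun U i hi ω x => by
    simp only [hA, Set.mem_ofPred_eq, hist_update hi]
  have hdisj : Pairwise (Function.onFun Disjoint A) := fun U V hUV =>
    Set.disjoint_left.2 fun ω hU hV => hUV (hU.symm.trans hV)
  have hunion : ⋃ U, A U = Set.univ := by
    ext ω
    simp [hA]
  have hpiece : ∀ U, ∫⁻ ω in A U, ((removedAt c r ω s).card : ENNReal) ∂tapeLaw ≤
      tapeLaw (A U) * ENNReal.ofReal (48 * cellBound d * degreeBound d (sphereGraph c r)) := by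
    intro U
    -- Conditioning requires positive probability; null pieces contribute nothing.
    by_cases h0 : tapeLaw (A U) = 0
    · rw [Measure.restrict_eq_zero.2 h0]
      simp
    · have hne : (A U).Nonempty := by
        by_contra h
        rw [Set.not_nonempty_iff_eq_empty] at h
        exact h0 (by rw [h, measure_empty])
      obtain ⟨ω₀, hω₀⟩ := hne
      have : IsProbabilityMeasure (ProbabilityTheory.cond tapeLaw (A U)) :=
        ProbabilityTheory.cond_isProbabilityMeasure h0
      have hb := lintegral_card_removed_le (c := c) (r := r) (U := U) (τ := n + s) hd hr
        (ν := ProbabilityTheory.cond tapeLaw (A U))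
        (fun i hi => (coordIndep_tapeLaw i).cond (hAm U) (hAi U i (Or.inl hi))) (by omega)
        ((coordIndep_tapeLaw (n + s)).cond (hAm U) (hAi U _ (Or.inr le_rfl)))
        (fun i hi => one_le_ncard_of_mem_hist (ω := ω₀) (s := s) (by
          rw [show hist c r ω₀ s = U from hω₀]; exact hi))
      rw [ProbabilityTheory.cond, lintegral_smul_measure, smul_eq_mul] at hb
      rw [setLIntegral_congr_fun (hAm U) (g := fun ω =>
        ((removed c r U (ω (n + s)) (critical (sphereGraph c r) ω)).card : ENNReal))
        (fun ω hω => by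
          simp only [removedAt]
          rw [show hist c r ω s = U from hω])]
      calc _ = tapeLaw (A U) * ((tapeLaw (A U))⁻¹ * ∫⁻ ω in A U,
            ((removed c r U (ω (n + s)) (critical (sphereGraph c r) ω)).card : ENNReal)
              ∂tapeLaw) := by
            rw [← mul_assoc, ENNReal.mul_inv_cancel h0 (measure_ne_top _ _), one_mul]
        _ ≤ _ := mul_le_mul_right hb _
  rw [← setLIntegral_univ, ← hunion, lintegral_iUnion hAm hdisj, tsum_fintype]
  refine (Finset.sum_le_sum fun U _ => hpiece U).trans ?_
  rw [← Finset.sum_mul, ← tsum_fintype (L := .unconditional _), ← measure_iUnion hdisj hAm, hunion, measure_univ, one_mul]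

/-- The constant in the bound on the size of the separator. -/
def sizeConst (d : ℕ) : ℝ := 96 * cellBound d ^ 2

theorem ncard_separator_le (ω : Tape) : (separator c r ω).ncard ≤
    ∑ s ∈ Finset.range (cellBound d), (removedAt c r ω s).card := by
  classical
  have : separator c r ω =
      ((Finset.range (cellBound d)).biUnion fun s => removedAt c r ω s : Finset (Fin n)) := by
    ext i
    simp [separator]
  rw [this, Set.ncard_coe_finset]
  exact Finset.card_biUnion_le

/-- Markov's inequality at twice the bound on the expectation: `96 K² = 2 · K · 48 K` for `K =
cellBound d` rounds. -/
theorem half_le_measure_separator (hd : 2 ≤ d) (hr : ∀ i, 0 < r i) :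
    (1 / 2 : ENNReal) ≤ tapeLaw {ω | ((separator c r ω).ncard : ℝ) ≤
      sizeConst d * degreeBound d (sphereGraph c r)} := by
  have hK : (1 : ℝ) ≤ cellBound d := by exact_mod_cast one_le_cellBound d
  set B := degreeBound d (sphereGraph c r) with hB
  have hB0 : 0 ≤ B := degreeBound_nonneg d _
  have hC : 0 < sizeConst d := by unfold sizeConst; positivity
  -- Markov's inequality needs a positive threshold. If `B = 0`, a vertex of positive degree would
  -- be a one-element clique violating the clique bound, so nothing is ever removed.
  by_cases hBz : B = 0
  · have : {ω | ((separator c r ω).ncard : ℝ) ≤ sizeConst d * B} = Set.univ := by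
      rw [Set.eq_univ_iff_forall]
      intro ω
      have hempty : hist c r ω 0 = ∅ := by
        rw [Finset.eq_empty_iff_forall_notMem]
        intro i hi
        have h1 := one_le_ncard_of_mem_hist hi
        have h2 := card_le_of_clique hd (sphereGraph c r) (A := {i})
          (fun a ha b hb hab => by
            rw [Finset.mem_singleton] at ha hb
            exact absurd (ha.trans hb.symm) hab)
          (fun a ha => by rw [Finset.mem_singleton] at ha; exact ha ▸ h1)
        rw [← hB, hBz, Finset.card_singleton] at h2
        norm_num at h2
      have hsep : separator c r ω = ∅ := by
        rw [Set.eq_empty_iff_forall_notMem]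
        rintro i ⟨s, -, hi⟩
        have := hist_subset ω s (removed_subset _ _ _ hi)
        rw [hempty] at this
        exact absurd this (Finset.notMem_empty i)
      simp [hsep, hBz]
    rw [this, measure_univ]
    simp
  have hBpos : 0 < B := lt_of_le_of_ne hB0 (Ne.symm hBz)
  set N : Tape → ENNReal := fun ω => ∑ s ∈ Finset.range (cellBound d),
    ((removedAt c r ω s).card : ENNReal) with hN
  have hNm : Measurable N := Finset.measurable_fun_sum _ fun s _ =>
    measurable_card_removedAt hd hr s
  have hNi : ∫⁻ ω, N ω ∂tapeLaw ≤ ENNReal.ofReal (sizeConst d * B / 2) := by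
    rw [lintegral_finsetSum _ fun s _ => measurable_card_removedAt hd hr s]
    refine (Finset.sum_le_sum fun s _ => lintegral_card_removedAt_le hd hr s).trans ?_
    rw [Finset.sum_const, Finset.card_range, nsmul_eq_mul, ← ENNReal.ofReal_natCast,
      ← ENNReal.ofReal_mul (Nat.cast_nonneg _)]
    refine ENNReal.ofReal_le_ofReal (le_of_eq ?_)
    rw [sizeConst]
    ring
  have hpos : 0 < sizeConst d * B := by positivity
  have hmarkov : tapeLaw {ω | ENNReal.ofReal (sizeConst d * B) ≤ N ω} ≤ 1 / 2 := by
    refine (meas_ge_le_lintegral_div hNm.aemeasurable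
      (by rw [Ne, ENNReal.ofReal_eq_zero, not_le]; exact hpos) ENNReal.ofReal_ne_top).trans ?_
    refine (ENNReal.div_le_div_right hNi _).trans (le_of_eq ?_)
    rw [← ENNReal.ofReal_div_of_pos hpos, div_div_cancel_left' hpos.ne']
    rw [ENNReal.ofReal_inv_of_pos (by norm_num)]
    simp
  have hmeas : MeasurableSet {ω | ENNReal.ofReal (sizeConst d * B) ≤ N ω} :=
    measurableSet_le measurable_const hNm
  have hcompl : (1 / 2 : ENNReal) ≤ tapeLaw {ω | ENNReal.ofReal (sizeConst d * B) ≤ N ω}ᶜ := by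
    rw [prob_compl_eq_one_sub hmeas]
    calc (1 / 2 : ENNReal) = 1 - 1 / 2 := by simp
      _ ≤ _ := tsub_le_tsub_left hmarkov 1
  refine hcompl.trans (measure_mono fun ω hω => ?_)
  rw [Set.mem_compl_iff, Set.mem_ofPred_eq, not_le] at hω
  have h1 : (((separator c r ω).ncard : ℕ) : ENNReal) ≤ N ω := by
    simp only [hN]
    exact_mod_cast ncard_separator_le ω
  have h2 := h1.trans hω.le
  rw [← ENNReal.ofReal_natCast, ENNReal.ofReal_le_ofReal_iff hpos.le] at h2
  exact h2

end Cost
end SphereSep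

namespace SphereSep
open RealRAM

/-! ### A structured language with bounded loops, and its running time -/

section Machine

/-- Programs whose only loops run a counter through the numbers below the content of cell `0` of
the array `0`. -/
inductive Cmd : Type
  | skip
  | natSet (a : ℕ) (i x : NatExpr)
  | realSet (a : ℕ) (i : NatExpr) (x : RealExpr)
  | sample (a : ℕ) (i : NatExpr)
  | seq (p q : Cmd)
  | cond (b : Test) (p q : Cmd)
  | for_ (a : ℕ) (p : Cmd)

/-- The content of cell `0` of an array of natural numbers. -/
abbrev cell (a : ℕ) : NatExpr := .get a (.const 0)

/-- The content of cell `0` of an array of real numbers. -/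
abbrev rcell (a : ℕ) : RealExpr := .get a (.const 0)

namespace Cmd

/-- Translation to programs of the machine. -/
def compile : Cmd → Prog
  | skip => .skip
  | natSet a i x => .natSet a i x
  | realSet a i x => .realSet a i x
  | sample a i => .sample a i
  | seq p q => .seq p.compile q.compile
  | cond b p q => .cond b p.compile q.compile
  | for_ a p => .seq (.natSet a (.const 0) (.const 0))
      (.loop (.natLt (cell a) (cell 0))
        (.seq p.compile (.natSet a (.const 0) (.add (cell a) (.const 1)))))

open Classical in
/-- The final state of a run. -/
noncomputable def den (ω : Tape) : Cmd → State → State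
  | skip, s => s
  | natSet a i x, s => s.setNat a (i.eval s) (x.eval s)
  | realSet a i x, s => s.setReal a (i.eval s) (x.eval s)
  | sample a i, s => { s.setReal a (i.eval s) (ω s.drawn : ℝ) with drawn := s.drawn + 1 }
  | seq p q, s => q.den ω (p.den ω s)
  | cond b p q, s => if b.Holds s then p.den ω s else q.den ω s
  | for_ a p, s => (fun s => (p.den ω s).setNat a 0 ((p.den ω s).natMem a 0 + 1))^[s.natMem 0 0]
      (s.setNat a 0 0)

/-- The program may write to the given array of natural numbers. -/
def WritesNat : Cmd → ℕ → Prop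
  | natSet a _ _, b => b = a
  | seq p q, b => p.WritesNat b ∨ q.WritesNat b
  | cond _ p q, b => p.WritesNat b ∨ q.WritesNat b
  | for_ a p, b => b = a ∨ p.WritesNat b
  | _, _ => False

/-- The program may write to the given array of real numbers. -/
def WritesReal : Cmd → ℕ → Prop
  | realSet a _ _, b => b = a
  | sample a _, b => b = a
  | seq p q, b => p.WritesReal b ∨ q.WritesReal b
  | cond _ p q, b => p.WritesReal b ∨ q.WritesReal b
  | for_ _ p, b => p.WritesReal b
  | _, _ => False

/-- The program may draw random numbers. -/
def Draws : Cmd → Prop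
  | sample _ _ => True
  | seq p q => p.Draws ∨ q.Draws
  | cond _ p q => p.Draws ∨ q.Draws
  | for_ _ p => p.Draws
  | _ => False

/-- The loops do not interfere with their counters and bounds. -/
def WF : Cmd → Prop
  | seq p q => p.WF ∧ q.WF
  | cond _ p q => p.WF ∧ q.WF
  | for_ a p => p.WF ∧ a ≠ 0 ∧ ¬ p.WritesNat a ∧ ¬ p.WritesNat 0
  | _ => True

/-- The nesting depth of the loops. -/
def depth : Cmd → ℕ
  | seq p q => max p.depth q.depth
  | cond _ p q => max p.depth q.depth
  | for_ _ p => p.depth + 1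
  | _ => 0

/-- The constant in the bound on the running time. -/
def timeConst : Cmd → ℕ
  | skip => 1
  | natSet _ i x => i.cost + x.cost + 1
  | realSet _ i x => i.cost + x.cost + 1
  | sample _ i => i.cost + 1
  | seq p q => p.timeConst + q.timeConst
  | cond b p q => b.cost + p.timeConst + q.timeConst + 1
  -- Apart from its body, a pass costs `12` steps for test, increment and control; the final failing
  -- test costs `6` and the initial reset of the counter `3`.
  | for_ _ p => p.timeConst + 21

variable {ω : Tape}

theorem iterate_induction {α : Type*} (f : α → α) (P : α → Prop) (hP : ∀ x, P x → P (f x)) :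
    ∀ (k : ℕ) (x : α), P x → P (f^[k] x)
  | 0, _, hx => hx
  | k + 1, x, hx => by
    rw [Function.iterate_succ_apply']
    exact hP _ (iterate_induction f P hP k x hx)

theorem natMem_den {p : Cmd} {b : ℕ} (h : ¬ p.WritesNat b) (s : State) :
    (p.den ω s).natMem b = s.natMem b := by
  induction p generalizing s with
  | skip => rfl
  | natSet a i x => exact Function.update_of_ne h _ _
  | realSet | sample => rfl
  | seq p q ihp ihq =>
    rw [WritesNat, not_or] at h
    rw [den, ihq h.2, ihp h.1]
  | cond t p q ihp ihq =>
    rw [WritesNat, not_or] at h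
    rw [den]
    split_ifs
    · exact ihp h.1 s
    · exact ihq h.2 s
  | for_ a p ih =>
    rw [WritesNat, not_or] at h
    rw [den]
    refine iterate_induction _ (fun s' : State => s'.natMem b = s.natMem b) (fun s' hs' => ?_) _ _ ?_
    · rw [← hs', ← ih h.2 s']
      exact Function.update_of_ne h.1 _ _
    · exact Function.update_of_ne h.1 _ _

theorem realMem_den {p : Cmd} {b : ℕ} (h : ¬ p.WritesReal b) (s : State) :
    (p.den ω s).realMem b = s.realMem b := by
  induction p generalizing s with
  | skip | natSet => rfl
  | realSet | sample => exact Function.update_of_ne h _ _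
  | seq p q ihp ihq =>
    rw [WritesReal, not_or] at h
    rw [den, ihq h.2, ihp h.1]
  | cond t p q ihp ihq =>
    rw [WritesReal, not_or] at h
    rw [den]
    split_ifs
    · exact ihp h.1 s
    · exact ihq h.2 s
  | for_ a p ih =>
    rw [den]
    refine iterate_induction _ (fun s' : State => s'.realMem b = s.realMem b) (fun s' hs' => ?_) _ _ ?_
    · exact (ih h s').trans hs'
    · rfl

theorem drawn_den {p : Cmd} (h : ¬ p.Draws) (s : State) : (p.den ω s).drawn = s.drawn := by
  induction p generalizing s with
  | skip | natSet | realSet => rfl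
  | sample => exact absurd trivial h
  | seq p q ihp ihq =>
    rw [Draws, not_or] at h
    rw [den, ihq h.2, ihp h.1]
  | cond t p q ihp ihq =>
    rw [Draws, not_or] at h
    rw [den]
    split_ifs
    · exact ihp h.1 s
    · exact ihq h.2 s
  | for_ a p ih =>
    rw [den]
    refine iterate_induction _ (fun s' : State => s'.drawn = s.drawn) (fun s' hs' => ?_) _ _ ?_
    · exact (ih h s').trans hs'
    · rfl

/-- Rule for loops. The invariant may use that arrays that are not written are unchanged. -/
theorem den_for {a : ℕ} {p : Cmd} (hwf : (for_ a p).WF) {s : State} (I : ℕ → State → Prop)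
    (h0 : I 0 (s.setNat a 0 0))
    (hstep : ∀ k < s.natMem 0 0, ∀ s' : State,
      (∀ b, ¬ (for_ a p).WritesNat b → s'.natMem b = s.natMem b) →
      (∀ b, ¬ p.WritesReal b → s'.realMem b = s.realMem b) →
      s'.natMem a 0 = k → I k s' → I (k + 1) ((p.den ω s').setNat a 0 (k + 1))) :
    I (s.natMem 0 0) ((for_ a p).den ω s) := by
  obtain ⟨-, -, hpa, -⟩ := hwf
  have key : ∀ k ≤ s.natMem 0 0, ∀ s', s' =
      (fun s => (p.den ω s).setNat a 0 ((p.den ω s).natMem a 0 + 1))^[k] (s.setNat a 0 0) →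
      (∀ b, ¬ (for_ a p).WritesNat b → s'.natMem b = s.natMem b) ∧
      (∀ b, ¬ p.WritesReal b → s'.realMem b = s.realMem b) ∧
      s'.natMem a 0 = k ∧ I k s' := by
    intro k
    induction k with
    | zero =>
      rintro - s' rfl
      refine ⟨fun b hb => ?_, fun _ _ => rfl, by simp [State.setNat], h0⟩
      rw [WritesNat, not_or] at hb
      exact Function.update_of_ne hb.1 _ _
    | succ k ih =>
      rintro hk s' rfl
      obtain ⟨h1, h2, h3, h4⟩ := ih (by omega) _ rfl
      rw [Function.iterate_succ_apply']
      set s₁ := (fun s => (p.den ω s).setNat a 0 ((p.den ω s).natMem a 0 + 1))^[k] (s.setNat a 0 0)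
      have hc : (p.den ω s₁).natMem a 0 = k := by rw [natMem_den hpa, h3]
      rw [hc]
      refine ⟨fun b hb => ?_, fun b hb => ?_, by simp [State.setNat], hstep k hk s₁ h1 h2 h3 h4⟩
      · have hb' := hb
        rw [WritesNat, not_or] at hb'
        rw [← h1 b hb, ← natMem_den hb'.2 s₁]
        exact Function.update_of_ne hb'.1 _ _
      · rw [← h2 b hb]
        exact realMem_den hb s₁
  exact (key _ le_rfl _ rfl).2.2.2

/-- The body of a loop changes neither its counter nor its bound, so every loop makes exactly `n`
passes, and each nesting level contributes one factor `n`. -/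
theorem runs_compile (p : Cmd) (hwf : p.WF) {n : ℕ} (hn : 1 ≤ n) (hp0 : ¬ p.WritesNat 0) (s : State)
    (hs : s.natMem 0 0 = n) :
    ∃ t, Runs ω p.compile s t (p.den ω s) ∧ t ≤ p.timeConst * n ^ p.depth := by
  induction p generalizing s with
  | skip => exact ⟨_, .skip s, by simp [timeConst, depth]⟩
  | natSet a i x => exact ⟨_, .natSet s a i x, by simp [timeConst, depth]⟩
  | realSet a i x => exact ⟨_, .realSet s a i x, by simp [timeConst, depth]⟩
  | sample a i => exact ⟨_, .sample s a i, by simp [timeConst, depth]⟩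
  | seq p q ihp ihq =>
    rw [WritesNat, not_or] at hp0
    obtain ⟨t, ht, htle⟩ := ihp hwf.1 hp0.1 s hs
    obtain ⟨t', ht', htle'⟩ := ihq hwf.2 hp0.2 (p.den ω s) (by rw [natMem_den hp0.1, hs])
    refine ⟨_, ht.seq ht', ?_⟩
    rw [timeConst, depth, add_mul]
    exact add_le_add
      (htle.trans (Nat.mul_le_mul_left _ (Nat.pow_le_pow_right hn (le_max_left _ _))))
      (htle'.trans (Nat.mul_le_mul_left _ (Nat.pow_le_pow_right hn (le_max_right _ _))))
  | cond b p q ihp ihq =>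
    rw [WritesNat, not_or] at hp0
    have h1 : 1 ≤ n ^ (max p.depth q.depth) := Nat.one_le_pow _ _ hn
    have hb : b.cost ≤ b.cost * n ^ (max p.depth q.depth) := Nat.le_mul_of_pos_right _ h1
    by_cases hh : b.Holds s
    · obtain ⟨t, ht, htle⟩ := ihp hwf.1 hp0.1 s hs
      refine ⟨_, by rw [den, if_pos hh]; exact .condTrue hh ht, ?_⟩
      have := htle.trans (Nat.mul_le_mul_left _ (Nat.pow_le_pow_right hn
        (le_max_left p.depth q.depth)))
      rw [timeConst, depth]
      simp only [add_mul, one_mul]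
      omega
    · obtain ⟨t, ht, htle⟩ := ihq hwf.2 hp0.2 s hs
      refine ⟨_, by rw [den, if_neg hh]; exact .condFalse hh ht, ?_⟩
      have := htle.trans (Nat.mul_le_mul_left _ (Nat.pow_le_pow_right hn
        (le_max_right p.depth q.depth)))
      rw [timeConst, depth]
      simp only [add_mul, one_mul]
      omega
  | for_ a p ih =>
    obtain ⟨hwfp, ha0, hpa, hp0'⟩ := hwf
    set f : State → State := fun s => (p.den ω s).setNat a 0 ((p.den ω s).natMem a 0 + 1) with hf
    have key : ∀ m k, m + k = n → ∀ s' : State, s'.natMem 0 0 = n → s'.natMem a 0 = k →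
        ∃ t, Runs ω (.loop (.natLt (cell a) (cell 0))
          (.seq p.compile (.natSet a (.const 0) (.add (cell a) (.const 1))))) s' t (f^[m] s') ∧
          t ≤ m * (p.timeConst * n ^ p.depth + 12) + 6 := by
      intro m
      induction m with
      | zero =>
        intro k hk s' h0 hak
        refine ⟨_, .loopDone ?_, ?_⟩
        · simp [Test.Holds, NatExpr.eval, h0, hak, ← hk]
        · simp [Test.cost, NatExpr.cost]
      | succ m ihm =>
        intro k hk s' h0 hak
        obtain ⟨t, ht, htle⟩ := ih hwfp hp0' s' h0
        obtain ⟨t', ht', htle'⟩ := ihm (k + 1) (by omega) (f s')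
          (by
            rw [← h0, ← natMem_den (ω := ω) hp0' s']
            exact congrFun (Function.update_of_ne ha0.symm _ _) 0)
          (by simp [hf, State.setNat, natMem_den hpa, hak])
        refine ⟨_, Runs.loopNext (t' := t') (s'' := f^[m] (f s')) ?_
          (ht.seq (.natSet _ a (.const 0) (.add (cell a) (.const 1)))) ?_, ?_⟩
        · simp only [Test.Holds, NatExpr.eval, h0, hak]
          omega
        · exact ht'
        · simp only [Test.cost, NatExpr.cost, Nat.succ_mul]
          omega
    obtain ⟨t, ht, htle⟩ := key n 0 (by omega) (s.setNat a 0 0)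
      (by rw [← hs]; exact congrFun (Function.update_of_ne ha0.symm _ _) 0)
      (by simp [State.setNat])
    refine ⟨_, .seq (.natSet s a (.const 0) (.const 0)) (s'' := (for_ a p).den ω s) (t' := t) ?_, ?_⟩
    · rw [den, hs]
      exact ht
    · have h1 : 1 ≤ n ^ (p.depth + 1) := Nat.one_le_pow _ _ hn
      have h2 : n ≤ n ^ (p.depth + 1) := Nat.le_self_pow (by omega) n
      have h3 : n * (p.timeConst * n ^ p.depth + 12) = p.timeConst * n ^ (p.depth + 1) + 12 * n := by
        ring
      rw [timeConst, depth, add_mul]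
      simp only [NatExpr.cost]
      omega

end Cmd
end Machine
end SphereSep

namespace SphereSep
open Metric RealRAM

/-! ### Geometric tests by rational arithmetic -/

section Expressions

theorem natMem_setNat_of_ne {s : State} {a b i v : ℕ} (h : b ≠ a) :
    (s.setNat a i v).natMem b = s.natMem b := Function.update_of_ne h _ _

theorem natMem_setNat_self (s : State) (a i v : ℕ) :
    (s.setNat a i v).natMem a = Function.update (s.natMem a) i v := by
  simp [State.setNat]

theorem realMem_setNat (s : State) (a i v : ℕ) : (s.setNat a i v).realMem = s.realMem := rfl

theorem realMem_setReal_of_ne {s : State} {a b i : ℕ} {v : ℝ} (h : b ≠ a) :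
    (s.setReal a i v).realMem b = s.realMem b := Function.update_of_ne h _ _

theorem realMem_setReal_self (s : State) (a i : ℕ) (v : ℝ) :
    (s.setReal a i v).realMem a = Function.update (s.realMem a) i v := by
  simp [State.setReal]

theorem natMem_setReal (s : State) (a i : ℕ) (v : ℝ) : (s.setReal a i v).natMem = s.natMem := rfl

/-- The sum of the first `k` expressions of a sequence. -/
def sumExpr (f : ℕ → RealExpr) : ℕ → RealExpr
  | 0 => .const 0
  | k + 1 => .add (sumExpr f k) (f k)

theorem eval_sumExpr (s : State) (f : ℕ → RealExpr) (k : ℕ) :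
    (sumExpr f k).eval s = ∑ a ∈ Finset.range k, (f a).eval s := by
  induction k with
  | zero => simp [sumExpr, RealExpr.eval]
  | succ k ih => rw [sumExpr, RealExpr.eval, ih, Finset.sum_range_succ]

/-- The conjunction of the first `k` tests of a sequence. -/
def allTest (f : ℕ → Test) : ℕ → Test
  | 0 => .natLt (.const 0) (.const 1)
  | k + 1 => .and (allTest f k) (f k)

theorem holds_allTest (s : State) (f : ℕ → Test) (k : ℕ) :
    (allTest f k).Holds s ↔ ∀ a < k, (f a).Holds s := by
  induction k with
  | zero => simp [allTest, Test.Holds, NatExpr.eval]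
  | succ k ih =>
    rw [allTest, Test.Holds, ih]
    constructor
    · rintro ⟨h, h'⟩ a ha
      rcases Nat.lt_succ_iff_lt_or_eq.1 ha with h1 | rfl
      · exact h a h1
      · exact h'
    · exact fun h => ⟨fun a ha => h a (by omega), h k (by omega)⟩

/-- Disjunction of tests. -/
def orTest (b b' : Test) : Test := .not (.and (.not b) (.not b'))

theorem holds_orTest (s : State) (b b' : Test) :
    (orTest b b').Holds s ↔ b.Holds s ∨ b'.Holds s := by
  simp only [orTest, Test.Holds]
  tauto

/-- The test `x ≤ y`. -/
def leTest (x y : RealExpr) : Test := .not (.realLt y x)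

theorem holds_leTest (s : State) (x y : RealExpr) :
    (leTest x y).Holds s ↔ x.eval s ≤ y.eval s := by
  simp only [leTest, Test.Holds, not_lt]

/-- The test whether a cell of an array of natural numbers is not zero. -/
def flagTest (a : ℕ) (i : NatExpr) : Test := .natLt (.const 0) (.get a i)

theorem holds_flagTest (s : State) (a : ℕ) (i : NatExpr) :
    (flagTest a i).Holds s ↔ s.natMem a (i.eval s) ≠ 0 := by
  simp only [flagTest, Test.Holds, NatExpr.eval, Nat.pos_iff_ne_zero]

/-- The test whether two natural numbers are equal. -/
def eqTest (i j : NatExpr) : Test := .and (.not (.natLt i j)) (.not (.natLt j i))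

theorem holds_eqTest (s : State) (i j : NatExpr) :
    (eqTest i j).Holds s ↔ i.eval s = j.eval s := by
  simp only [eqTest, Test.Holds]
  omega

/-- The square of an expression. -/
def sqExpr (x : RealExpr) : RealExpr := .mul x x

theorem eval_sqExpr (s : State) (x : RealExpr) : (sqExpr x).eval s = x.eval s ^ 2 := by
  rw [sqExpr, RealExpr.eval, sq]

variable {d n : ℕ}

/-- The memory holds the centers and the radii. -/
def HasInput (c : Fin n → EuclideanSpace ℝ (Fin d)) (r : Fin n → ℝ) (s : State) : Prop :=
  s.natMem 0 0 = n ∧ (∀ (a : Fin d) (i : Fin n), s.realMem a i = c i a) ∧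
    ∀ i : Fin n, s.realMem d i = r i

variable {c : Fin n → EuclideanSpace ℝ (Fin d)} {r : Fin n → ℝ} {s : State}

theorem HasInput.congr (h : HasInput c r s) {s' : State} (h0 : s'.natMem 0 = s.natMem 0)
    (hr : ∀ a ≤ d, s'.realMem a = s.realMem a) : HasInput c r s' := by
  refine ⟨by rw [h0, h.1], fun a i => ?_, fun i => ?_⟩
  · rw [hr a a.2.le, h.2.1]
  · rw [hr d le_rfl, h.2.2]

/-- The `a`-th coordinate of the point chosen on the `i`-th sphere. -/
def ptExpr (d a : ℕ) (i : NatExpr) : RealExpr :=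
  if a = 0 then .add (.get 0 i) (.get d i) else .get a i

theorem eval_ptExpr (h : HasInput c r s) {i : NatExpr} {i' : Fin n} (hi : i.eval s = i')
    (a : Fin d) : (ptExpr d a i).eval s = pt c r i' a := by
  unfold ptExpr pt
  by_cases ha : (a : ℕ) = 0
  · have h1 := h.2.1 a i'
    rw [ha] at h1
    simp [ha, RealExpr.eval, hi, h1, h.2.2]
  · simp [ha, RealExpr.eval, hi, h.2.1]

theorem eval_sum_sq {x y : EuclideanSpace ℝ (Fin d)} {f g : ℕ → RealExpr}
    (hf : ∀ a : Fin d, (f a).eval s = x a) (hg : ∀ a : Fin d, (g a).eval s = y a) :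
    (sumExpr (fun a => sqExpr (.sub (f a) (g a))) d).eval s = dist x y ^ 2 := by
  rw [eval_sumExpr, EuclideanSpace.dist_eq, Real.sq_sqrt
    (Finset.sum_nonneg fun _ _ => sq_nonneg _), Finset.sum_range]
  refine Finset.sum_congr rfl fun a _ => ?_
  rw [eval_sqExpr, RealExpr.eval, hf, hg, Real.dist_eq, sq_abs]

/-- The square of the distance of two centers. -/
def distExpr (d : ℕ) (i j : NatExpr) : RealExpr :=
  sumExpr (fun a => sqExpr (.sub (.get a i) (.get a j))) d

/-- The square of the distance of a center from the point chosen on a sphere. -/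
def centerPtExpr (d : ℕ) (i j : NatExpr) : RealExpr :=
  sumExpr (fun a => sqExpr (.sub (.get a i) (ptExpr d a j))) d

/-- The square of the distance of the points chosen on two spheres. -/
def ptPtExpr (d : ℕ) (i j : NatExpr) : RealExpr :=
  sumExpr (fun a => sqExpr (.sub (ptExpr d a i) (ptExpr d a j))) d

section Eval
variable {i j : NatExpr} {i' j' : Fin n}

theorem eval_radius (h : HasInput c r s) (hi : i.eval s = i') :
    (RealExpr.get d i).eval s = r i' := by
  rw [RealExpr.eval, hi, h.2.2]

theorem eval_distExpr (h : HasInput c r s) (hi : i.eval s = i') (hj : j.eval s = j') :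
    (distExpr d i j).eval s = dist (c i') (c j') ^ 2 :=
  eval_sum_sq (fun a => by rw [RealExpr.eval, hi, h.2.1]) fun a => by rw [RealExpr.eval, hj, h.2.1]

theorem eval_centerPtExpr (h : HasInput c r s) (hi : i.eval s = i') (hj : j.eval s = j') :
    (centerPtExpr d i j).eval s = dist (c i') (pt c r j') ^ 2 :=
  eval_sum_sq (fun a => by rw [RealExpr.eval, hi, h.2.1]) fun a => eval_ptExpr h hj a

theorem eval_ptPtExpr (h : HasInput c r s) (hi : i.eval s = i') (hj : j.eval s = j') :
    (ptPtExpr d i j).eval s = dist (pt c r i') (pt c r j') ^ 2 :=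
  eval_sum_sq (fun a => eval_ptExpr h hi a) fun a => eval_ptExpr h hj a

/-- The test whether two different spheres intersect. -/
def adjTest (d : ℕ) (i j : NatExpr) : Test :=
  .and (.not (eqTest i j)) (.and
    (leTest (sqExpr (.sub (.get d i) (.get d j))) (distExpr d i j))
    (leTest (distExpr d i j) (sqExpr (.add (.get d i) (.get d j)))))

theorem holds_adjTest (hd : 2 ≤ d) (hr : ∀ i, 0 < r i) (h : HasInput c r s) (hi : i.eval s = i')
    (hj : j.eval s = j') : (adjTest d i j).Holds s ↔ (sphereGraph c r).Adj i' j' := by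
  simp only [adjTest, Test.Holds, holds_eqTest, holds_leTest, eval_sqExpr, RealExpr.eval,
    eval_distExpr h hi hj, hi, hj, h.2.2]
  have h1 := hr i'
  have h2 := hr j'
  rw [sq_le_sq, abs_of_nonneg (dist_nonneg (x := c i') (y := c j')),
    sq_le_sq₀ dist_nonneg (by linarith), ← spheres_meet_iff hd h1 h2, ← Fin.ext_iff]
  exact Iff.rfl

/-- The test whether the sphere `i` lies inside the sphere `k`. -/
def insideTest (d : ℕ) (i k : NatExpr) : Test :=
  .and (.realLt (.get d i) (.get d k))
    (.realLt (distExpr d i k) (sqExpr (.sub (.get d k) (.get d i))))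

/-- The comparison of radii comes first because squares may be compared only when `r j' - r i'` is
nonnegative. -/
theorem holds_insideTest_iff (h : HasInput c r s) (hi : i.eval s = i') (hj : j.eval s = j') :
    (insideTest d i j).Holds s ↔ dist (c i') (c j') + r i' < r j' := by
  simp only [insideTest, Test.Holds, eval_sqExpr, RealExpr.eval, eval_distExpr h hi hj, hi, hj,
    h.2.2]
  have h3 : 0 ≤ dist (c i') (c j') := dist_nonneg
  constructor
  · rintro ⟨h4, h5⟩
    rw [sq_lt_sq₀ h3 (by linarith)] at h5
    linarith
  · intro h4
    refine ⟨by linarith, ?_⟩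
    rw [sq_lt_sq₀ h3 (by linarith)]
    linarith

theorem holds_insideTest (hd : 2 ≤ d) (hr : ∀ i, 0 < r i) (h : HasInput c r s)
    (hi : i.eval s = i') (hj : j.eval s = j') :
    (insideTest d i j).Holds s ↔ sphere (c i') (r i') ⊆ side (c j') (r j') true := by
  rw [holds_insideTest_iff h hi hj, sphere_subset_side_true_iff hd (hr i')]

/-- The test whether the sphere `i` lies outside the sphere `k`. -/
def outsideTest (d : ℕ) (i k : NatExpr) : Test :=
  orTest (.realLt (sqExpr (.add (.get d i) (.get d k))) (distExpr d i k)) (insideTest d k i)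

theorem holds_outsideTest (hd : 2 ≤ d) (hr : ∀ i, 0 < r i) (h : HasInput c r s)
    (hi : i.eval s = i') (hj : j.eval s = j') :
    (outsideTest d i j).Holds s ↔ sphere (c i') (r i') ⊆ side (c j') (r j') false := by
  have h1 := hr i'
  have h2 := hr j'
  rw [outsideTest, holds_orTest, holds_insideTest_iff h hj hi, sphere_subset_side_false_iff hd h1]
  simp only [Test.Holds, eval_sqExpr, RealExpr.eval, eval_distExpr h hi hj, hi, hj, h.2.2]
  rw [sq_lt_sq₀ (by linarith) dist_nonneg, dist_comm (c j')]

/-- The test whether the points chosen on two spheres have supremum distance at most `R`. -/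
def nearTest (d : ℕ) (i j : NatExpr) (R : RealExpr) : Test :=
  allTest (fun a => .and (leTest (.sub (ptExpr d a i) (ptExpr d a j)) R)
    (leTest (.sub (ptExpr d a j) (ptExpr d a i)) R)) d

theorem holds_nearTest (h : HasInput c r s) (hi : i.eval s = i') (hj : j.eval s = j')
    {R : RealExpr} (hR : 0 ≤ R.eval s) :
    (nearTest d i j R).Holds s ↔ dist (coords c r i') (coords c r j') ≤ R.eval s := by
  rw [nearTest, holds_allTest, dist_pi_le_iff hR]
  constructor
  · intro h1 a
    have h2 := h1 a a.2
    simp only [Test.Holds, holds_leTest, RealExpr.eval, eval_ptExpr h hi a, eval_ptExpr h hj a]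
      at h2
    rw [Real.dist_eq, abs_sub_le_iff]
    exact h2
  · intro h1 a ha
    have h2 := h1 ⟨a, ha⟩
    rw [Real.dist_eq, abs_sub_le_iff] at h2
    have h3 := eval_ptExpr h hi ⟨a, ha⟩
    have h4 := eval_ptExpr h hj ⟨a, ha⟩
    simp only at h3 h4
    simp only [Test.Holds, holds_leTest, RealExpr.eval, h3, h4]
    exact h2

/-- The test whether the sphere `i` meets the annulus of radii `R` and `2 R` around the point
chosen on the sphere `j`. -/
def annulusTest (d : ℕ) (i j : NatExpr) (R : RealExpr) : Test :=
  .and (orTest (leTest R (.get d i))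
      (leTest (sqExpr (.sub R (.get d i))) (centerPtExpr d i j)))
    (.and (leTest (centerPtExpr d i j) (sqExpr (.add (.add R R) (.get d i))))
      (orTest (leTest (.get d i) (.add R R))
        (leTest (sqExpr (.sub (.get d i) (.add R R))) (centerPtExpr d i j))))

/-- The distances from `q` to points of the sphere fill the interval from `|dist c₁ q - r₁|` to
`dist c₁ q + r₁`; the condition says that it meets `[R, 2R]`. -/
theorem exists_mem_sphere_annulus_iff (hd : 2 ≤ d) (c₁ q : EuclideanSpace ℝ (Fin d)) {r₁ R : ℝ}
    (hr : 0 < r₁) (hR : 0 < R) :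
    (∃ x ∈ sphere c₁ r₁, R ≤ dist x q ∧ dist x q ≤ 2 * R) ↔
      R ≤ dist c₁ q + r₁ ∧ dist c₁ q ≤ 2 * R + r₁ ∧ r₁ ≤ 2 * R + dist c₁ q := by
  constructor
  · rintro ⟨x, hx, h1, h2⟩
    rw [mem_sphere] at hx
    have h3 := dist_triangle x c₁ q
    have h4 := dist_triangle_left c₁ q x
    have h5 := dist_triangle_right x c₁ q
    refine ⟨?_, ?_, ?_⟩ <;> linarith
  · rintro ⟨h1, h2, h3⟩
    have key : ∀ t, R ≤ t → t ≤ 2 * R → |r₁ - t| ≤ dist c₁ q → dist c₁ q ≤ r₁ + t →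
        ∃ x ∈ sphere c₁ r₁, R ≤ dist x q ∧ dist x q ≤ 2 * R := by
      intro t ht ht' h4 h5
      obtain ⟨x, hx, hx'⟩ := (spheres_meet_iff hd hr (by linarith : 0 < t)).2 ⟨h4, h5⟩
      rw [mem_sphere] at hx'
      exact ⟨x, hx, by rw [hx']; exact ht, by rw [hx']; exact ht'⟩
    have h0 : 0 ≤ dist c₁ q := dist_nonneg
    -- This is the smallest distance that can lie in both intervals.
    refine key (max R |dist c₁ q - r₁|) (le_max_left _ _) (max_le (by linarith) ?_) ?_ ?_
    · rw [abs_le]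
      constructor <;> linarith
    · rcases max_cases R |dist c₁ q - r₁| with ⟨h, h'⟩ | ⟨h, h'⟩ <;> rw [h]
      · rw [abs_le] at h' ⊢
        constructor <;> linarith
      · rcases abs_cases (dist c₁ q - r₁) with ⟨h6, h7⟩ | ⟨h6, h7⟩ <;> rw [h6, abs_le] <;>
          constructor <;> linarith
    · rcases le_max_iff.1 (le_refl (max R |dist c₁ q - r₁|)) with h | h
      · have := le_max_right R |dist c₁ q - r₁|
        have := le_abs_self (dist c₁ q - r₁)
        linarith
      · have := le_max_right R |dist c₁ q - r₁|
        have := le_abs_self (dist c₁ q - r₁)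
        linarith

theorem holds_annulusTest (hd : 2 ≤ d) (hr : ∀ i, 0 < r i) (h : HasInput c r s)
    (hi : i.eval s = i') (hj : j.eval s = j') {R : RealExpr} (hR : 0 < R.eval s) :
    (annulusTest d i j R).Holds s ↔ ∃ x ∈ sphere (c i') (r i'),
      R.eval s ≤ dist x (pt c r j') ∧ dist x (pt c r j') ≤ 2 * R.eval s := by
  have hri := hr i'
  rw [exists_mem_sphere_annulus_iff hd _ _ hri hR]
  simp only [annulusTest, Test.Holds, holds_orTest, holds_leTest, eval_sqExpr, RealExpr.eval,
    eval_centerPtExpr h hi hj, hi, h.2.2]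
  have h0 : 0 ≤ dist (c i') (pt c r j') := dist_nonneg
  refine and_congr ?_ (and_congr ?_ ?_)
  · rcases le_or_gt (R.eval s) (r i') with h1 | h1
    · exact iff_of_true (Or.inl h1) (by linarith)
    · rw [sq_le_sq₀ (by linarith) h0, or_iff_right (not_le.2 h1)]
      constructor <;> intro <;> linarith
  · rw [sq_le_sq₀ h0 (by linarith)]
    constructor <;> intro <;> linarith
  · rcases le_or_gt (r i') (R.eval s + R.eval s) with h1 | h1
    · exact iff_of_true (Or.inl h1) (by linarith)
    · rw [sq_le_sq₀ (by linarith) h0, or_iff_right (not_le.2 h1)]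
      constructor <;> intro <;> linarith

/-- The test whether the sphere `i` meets the sphere of radius `t` around the point chosen on the
sphere `j`. -/
def meetTest (d : ℕ) (i j : NatExpr) (t : RealExpr) : Test :=
  .and (leTest (sqExpr (.sub (.get d i) t)) (centerPtExpr d i j))
    (leTest (centerPtExpr d i j) (sqExpr (.add (.get d i) t)))

theorem holds_meetTest (hd : 2 ≤ d) (hr : ∀ i, 0 < r i) (h : HasInput c r s)
    (hi : i.eval s = i') (hj : j.eval s = j') {t : RealExpr} (ht : 0 < t.eval s) :
    (meetTest d i j t).Holds s ↔
      (sphere (c i') (r i') ∩ sphere (pt c r j') (t.eval s)).Nonempty := by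
  have hri := hr i'
  rw [spheres_meet_iff hd hri ht]
  simp only [meetTest, Test.Holds, holds_leTest, eval_sqExpr, RealExpr.eval,
    eval_centerPtExpr h hi hj, hi, h.2.2]
  rw [sq_le_sq, abs_of_nonneg (dist_nonneg (x := c i')), sq_le_sq₀ dist_nonneg (by linarith)]

end Eval
end Expressions
end SphereSep

namespace SphereSep
open Metric RealRAM

/-! ### Loops that count, fill arrays and compute maxima -/

section Loops
variable {ω : Tape} {n : ℕ}

/-- Two states agree outside the arrays that a program writes. -/
structure Frame (p : Cmd) (s s' : State) : Prop where
  nat : ∀ b, ¬ p.WritesNat b → s'.natMem b = s.natMem b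
  real : ∀ b, ¬ p.WritesReal b → s'.realMem b = s.realMem b

theorem frame_den (p : Cmd) (s : State) : Frame p s (p.den ω s) :=
  ⟨fun _ hb => Cmd.natMem_den hb s, fun _ hb => Cmd.realMem_den hb s⟩

open Classical in
theorem card_filter_lt_succ (P : Fin n → Prop) {k : ℕ} (hk : k < n) :
    ({i : Fin n | (i : ℕ) < k + 1 ∧ P i} : Finset (Fin n)) =
      if P ⟨k, hk⟩ then insert ⟨k, hk⟩ ({i : Fin n | (i : ℕ) < k ∧ P i} : Finset (Fin n))
      else ({i : Fin n | (i : ℕ) < k ∧ P i} : Finset (Fin n)) := by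
  have heq : ∀ i : Fin n, (i : ℕ) < k + 1 ↔ i = ⟨k, hk⟩ ∨ (i : ℕ) < k := by
    intro i
    rw [Fin.ext_iff]
    simp only
    omega
  split_ifs with h
  · ext i
    simp only [Finset.mem_filter, Finset.mem_univ, true_and, Finset.mem_insert, heq]
    constructor
    · rintro ⟨h1 | h1, h2⟩
      · exact Or.inl h1
      · exact Or.inr ⟨h1, h2⟩
    · rintro (h1 | h1)
      · exact ⟨Or.inl h1, h1 ▸ h⟩
      · exact ⟨Or.inr h1.1, h1.2⟩
  · ext i
    simp only [Finset.mem_filter, Finset.mem_univ, true_and, heq]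
    constructor
    · rintro ⟨h1 | h1, h2⟩
      · exact absurd (h1 ▸ h2) h
      · exact ⟨h1, h2⟩
    · exact fun h1 => ⟨Or.inr h1.1, h1.2⟩

/-- Count the indices `j` that pass a test. -/
def countCmd (j res : ℕ) (T : Test) : Cmd :=
  .seq (.natSet res (.const 0) (.const 0))
    (.for_ j (.cond T (.natSet res (.const 0) (.add (cell res) (.const 1))) .skip))

theorem writesNat_countCmd {j res : ℕ} {T : Test} {b : ℕ} :
    (countCmd j res T).WritesNat b ↔ b = res ∨ b = j := by
  simp [countCmd, Cmd.WritesNat]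
  tauto

theorem writesReal_countCmd {j res : ℕ} {T : Test} {b : ℕ} :
    ¬ (countCmd j res T).WritesReal b := by
  simp [countCmd, Cmd.WritesReal]

theorem wf_countCmd {j res : ℕ} {T : Test} (hj : j ≠ 0) (hres : res ≠ 0) (hjr : j ≠ res) :
    (countCmd j res T).WF := by
  simp [countCmd, Cmd.WF, Cmd.WritesNat, hj, hres.symm, hjr]

-- The test is evaluated in the midst of the loop, when counter and result have changed. Hence its
-- meaning is required in all states that agree with the initial one outside the written arrays.
open Classical in
theorem natMem_countCmd {j res : ℕ} (hj : j ≠ 0) (hres : res ≠ 0) (hjr : j ≠ res) {T : Test}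
    {s : State} (hn : s.natMem 0 0 = n) (P : Fin n → Prop)
    (hT : ∀ (k : ℕ) (hk : k < n) (s' : State), Frame (countCmd j res T) s s' →
      s'.natMem j 0 = k → (T.Holds s' ↔ P ⟨k, hk⟩)) :
    ((countCmd j res T).den ω s).natMem res 0 = ({i | P i} : Finset (Fin n)).card := by
  rw [countCmd, Cmd.den]
  set s₁ := (Cmd.natSet res (.const 0) (.const 0)).den ω s with hs₁
  have hs₁0 : s₁.natMem 0 = s.natMem 0 := natMem_setNat_of_ne hres.symm
  have hwf := wf_countCmd (T := T) hj hres hjr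
  have key := Cmd.den_for (ω := ω) (s := s₁) hwf.2 (fun k s' => s'.natMem res 0 =
    ({i : Fin n | (i : ℕ) < k ∧ P i} : Finset (Fin n)).card) ?_ ?_
  · rw [hs₁0, hn] at key
    rw [key]
    congr 1
    ext i
    simp
  · simp [natMem_setNat_of_ne hjr.symm, hs₁, Cmd.den, natMem_setNat_self, NatExpr.eval]
  · intro k hk s' hf hf' hk' hI
    rw [hs₁0, hn] at hk
    have hfr : Frame (countCmd j res T) s s' := by
      refine ⟨fun b hb => ?_, fun b _ => ?_⟩
      · rw [writesNat_countCmd, not_or] at hb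
        rw [hf b (by simp [Cmd.WritesNat, hb.1, hb.2]), hs₁]
        exact natMem_setNat_of_ne hb.1
      · rw [hf' b (by simp [Cmd.WritesReal])]
        rfl
    rw [natMem_setNat_of_ne hjr.symm, Cmd.den, card_filter_lt_succ P hk]
    have hPk := hT k hk s' hfr hk'
    by_cases h : T.Holds s'
    · rw [if_pos h, if_pos (hPk.1 h), Finset.card_insert_of_notMem (by simp), ← hI]
      simp [Cmd.den, natMem_setNat_self, NatExpr.eval]
    · rw [if_neg h, if_neg (fun hp => h (hPk.2 hp)), ← hI]
      rfl

/-- Rule for loops that fill an array. -/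
theorem natMem_for_fill {a A : ℕ} {p : Cmd} (hwf : (Cmd.for_ a p).WF) (hA : A ≠ a) {s : State}
    (hn : s.natMem 0 0 = n) (Q : Fin n → ℕ → Prop)
    (hstep : ∀ (k : ℕ) (hk : k < n) (s' : State), Frame (.for_ a p) s s' →
      s'.natMem a 0 = k → (∀ l, k ≤ l → s'.natMem A l = s.natMem A l) →
      (∀ l ≠ k, (p.den ω s').natMem A l = s'.natMem A l) ∧ Q ⟨k, hk⟩ ((p.den ω s').natMem A k)) :
    ∀ i : Fin n, Q i (((Cmd.for_ a p).den ω s).natMem A i) := by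
  have key := Cmd.den_for (ω := ω) (s := s) hwf (fun k s' =>
    (∀ l, k ≤ l → s'.natMem A l = s.natMem A l) ∧
      ∀ i : Fin n, (i : ℕ) < k → Q i (s'.natMem A i)) ?_ ?_
  · rw [hn] at key
    exact fun i => key.2 i i.2
  · exact ⟨fun l _ => by rw [natMem_setNat_of_ne hA], fun i hi => absurd hi (Nat.not_lt_zero _)⟩
  · rintro k hk s' hf hf' hk' ⟨h1, h2⟩
    rw [hn] at hk
    obtain ⟨h3, h4⟩ := hstep k hk s' ⟨hf, hf'⟩ hk' h1
    refine ⟨fun l hl => ?_, fun i hi => ?_⟩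
    · rw [natMem_setNat_of_ne hA, h3 l (by omega), h1 l (by omega)]
    · rw [natMem_setNat_of_ne hA]
      rcases Nat.lt_succ_iff_lt_or_eq.1 hi with h5 | h5
      · rw [h3 i (by omega)]
        exact h2 i h5
      · subst h5
        exact h4

/-- Replace the content of cell `0` of an array of real numbers by the maximum of it and the
absolute values of differences of the first `k` coordinates of two points. -/
def coordMaxCmd (d res : ℕ) (i j : NatExpr) : ℕ → Cmd
  | 0 => .skip
  | k + 1 => .seq (coordMaxCmd d res i j k) (.seq
      (.cond (.realLt (rcell res) (.sub (ptExpr d k i) (ptExpr d k j)))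
        (.realSet res (.const 0) (.sub (ptExpr d k i) (ptExpr d k j))) .skip)
      (.cond (.realLt (rcell res) (.sub (ptExpr d k j) (ptExpr d k i)))
        (.realSet res (.const 0) (.sub (ptExpr d k j) (ptExpr d k i))) .skip))

theorem writesNat_coordMaxCmd {d res : ℕ} {i j : NatExpr} {k b : ℕ} :
    ¬ (coordMaxCmd d res i j k).WritesNat b := by
  induction k with
  | zero => simp [coordMaxCmd, Cmd.WritesNat]
  | succ k ih => simp [coordMaxCmd, Cmd.WritesNat, ih]

theorem writesReal_coordMaxCmd {d res : ℕ} {i j : NatExpr} {k b : ℕ}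
    (h : (coordMaxCmd d res i j k).WritesReal b) : b = res := by
  induction k with
  | zero => simp [coordMaxCmd, Cmd.WritesReal] at h
  | succ k ih =>
    simp only [coordMaxCmd, Cmd.WritesReal, or_false] at h
    tauto

theorem wf_coordMaxCmd {d res : ℕ} {i j : NatExpr} {k : ℕ} : (coordMaxCmd d res i j k).WF := by
  induction k with
  | zero => simp [coordMaxCmd, Cmd.WF]
  | succ k ih => simp [coordMaxCmd, Cmd.WF, ih]

theorem not_draws_coordMaxCmd {d res : ℕ} {i j : NatExpr} {k : ℕ} :
    ¬ (coordMaxCmd d res i j k).Draws := by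
  induction k with
  | zero => simp [coordMaxCmd, Cmd.Draws]
  | succ k ih => simp [coordMaxCmd, Cmd.Draws, ih]

theorem depth_coordMaxCmd {d res : ℕ} {i j : NatExpr} {k : ℕ} :
    (coordMaxCmd d res i j k).depth = 0 := by
  induction k with
  | zero => simp [coordMaxCmd, Cmd.depth]
  | succ k ih => simp [coordMaxCmd, Cmd.depth, ih]

theorem realMem_cond_max (s : State) (res : ℕ) (x : RealExpr) :
    ((Cmd.cond (.realLt (rcell res) x) (.realSet res (.const 0) x) .skip).den ω s).realMem res 0 =
      max (s.realMem res 0) (x.eval s) := by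
  have hh : (Test.realLt (rcell res) x).Holds s ↔ s.realMem res 0 < x.eval s := Iff.rfl
  rw [Cmd.den]
  by_cases h : s.realMem res 0 < x.eval s
  · rw [if_pos (hh.2 h), max_eq_right h.le]
    simp [Cmd.den, realMem_setReal_self, NatExpr.eval]
  · rw [if_neg (mt hh.1 h), max_eq_left (not_lt.1 h)]
    rfl

section Spread
variable {d : ℕ} {c : Fin n → EuclideanSpace ℝ (Fin d)} {r : Fin n → ℝ} {s : State}

theorem eval_eq_of_natMem {s' : State} (h : s'.natMem = s.natMem) (i : NatExpr) :
    i.eval s' = i.eval s := by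
  induction i with
  | const => rfl
  | get a i ih => simp only [NatExpr.eval, ih, h]
  | add x y hx hy => simp only [NatExpr.eval, hx, hy]
  | sub x y hx hy => simp only [NatExpr.eval, hx, hy]

theorem natMem_eq_of_not_writes {p : Cmd} (h : ∀ b, ¬ p.WritesNat b) (s : State) :
    (p.den ω s).natMem = s.natMem := funext fun b => Cmd.natMem_den (h b) s

theorem realMem_coordMaxCmd (h : HasInput c r s) {res : ℕ} (hres : d < res) {i j : NatExpr}
    {i' j' : Fin n} (hi : i.eval s = i') (hj : j.eval s = j') (h0 : 0 ≤ s.realMem res 0) :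
    ((coordMaxCmd d res i j d).den ω s).realMem res 0 =
      max (s.realMem res 0) (dist (coords c r i') (coords c r j')) := by
  -- The partial maximum is described by bounds from both sides: it dominates the old value and the
  -- differences seen so far, and it is the old value or at most the full supremum distance.
  have key : ∀ k ≤ d, ∀ M, M = ((coordMaxCmd d res i j k).den ω s).realMem res 0 →
      s.realMem res 0 ≤ M ∧
      (∀ a : Fin d, (a : ℕ) < k → |coords c r i' a - coords c r j' a| ≤ M) ∧
      (M = s.realMem res 0 ∨ M ≤ dist (coords c r i') (coords c r j')) := by
    intro k
    induction k with
    | zero =>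
      rintro - M rfl
      exact ⟨le_rfl, fun a ha => absurd ha (Nat.not_lt_zero _), Or.inl rfl⟩
    | succ k ih =>
      intro hk M hM
      obtain ⟨h1, h2, h3⟩ := ih (by omega) _ rfl
      set s₁ := (coordMaxCmd d res i j k).den ω s with hs₁
      have hn₁ : s₁.natMem = s.natMem := natMem_eq_of_not_writes (fun b => writesNat_coordMaxCmd) s
      have hin₁ : HasInput c r s₁ := h.congr (by rw [hn₁]) fun a ha =>
        Cmd.realMem_den (fun hw => by have := writesReal_coordMaxCmd hw; omega) s
      have hi₁ : i.eval s₁ = i' := by rw [eval_eq_of_natMem hn₁, hi]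
      have hj₁ : j.eval s₁ = j' := by rw [eval_eq_of_natMem hn₁, hj]
      set q₁ : Cmd := .cond (.realLt (rcell res) (.sub (ptExpr d k i) (ptExpr d k j)))
        (.realSet res (.const 0) (.sub (ptExpr d k i) (ptExpr d k j))) .skip with hq₁
      set s₂ := q₁.den ω s₁ with hs₂
      have hn₂ : s₂.natMem = s₁.natMem := natMem_eq_of_not_writes
        (fun b => by simp [hq₁, Cmd.WritesNat]) s₁
      have hin₂ : HasInput c r s₂ := hin₁.congr (by rw [hn₂]) fun a ha =>
        Cmd.realMem_den (by simp only [hq₁, Cmd.WritesReal, or_false]; omega) s₁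
      have hi₂ : i.eval s₂ = i' := by rw [eval_eq_of_natMem hn₂, hi₁]
      have hj₂ : j.eval s₂ = j' := by rw [eval_eq_of_natMem hn₂, hj₁]
      have e1 := eval_ptExpr hin₁ hi₁ ⟨k, hk⟩
      have e2 := eval_ptExpr hin₁ hj₁ ⟨k, hk⟩
      have e3 := eval_ptExpr hin₂ hi₂ ⟨k, hk⟩
      have e4 := eval_ptExpr hin₂ hj₂ ⟨k, hk⟩
      simp only at e1 e2 e3 e4
      rw [coordMaxCmd, Cmd.den, Cmd.den, ← hs₁, ← hq₁, ← hs₂, realMem_cond_max, hs₂, hq₁,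
        realMem_cond_max, ← hq₁, ← hs₂, RealExpr.eval, RealExpr.eval, e1, e2, e3, e4, max_assoc]
        at hM
      have habs : max (pt c r i' ⟨k, hk⟩ - pt c r j' ⟨k, hk⟩)
          (pt c r j' ⟨k, hk⟩ - pt c r i' ⟨k, hk⟩) =
          |coords c r i' ⟨k, hk⟩ - coords c r j' ⟨k, hk⟩| := by
        rw [abs_eq_max_neg, neg_sub]
        rfl
      rw [habs] at hM
      refine ⟨?_, fun a ha => ?_, ?_⟩
      · rw [hM]
        exact h1.trans (le_max_left _ _)
      · rw [hM]
        rcases Nat.lt_succ_iff_lt_or_eq.1 ha with h5 | h5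
        · exact (h2 a h5).trans (le_max_left _ _)
        · have : a = ⟨k, hk⟩ := Fin.ext h5
          rw [this]
          exact le_max_right _ _
      · have h6 : |coords c r i' ⟨k, hk⟩ - coords c r j' ⟨k, hk⟩| ≤
            dist (coords c r i') (coords c r j') := by
          rw [← Real.dist_eq]
          exact dist_le_pi_dist _ _ _
        rcases max_cases (s₁.realMem res 0)
          |coords c r i' ⟨k, hk⟩ - coords c r j' ⟨k, hk⟩| with h7 | h7
        · rw [h7.1] at hM
          rw [hM]
          exact h3
        · rw [h7.1] at hM
          rw [hM]
          exact Or.inr h6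
  obtain ⟨h1, h2, h3⟩ := key d le_rfl _ rfl
  apply le_antisymm
  · rcases h3 with h3 | h3
    · rw [h3]
      exact le_max_left _ _
    · exact h3.trans (le_max_right _ _)
  · refine max_le h1 ((dist_pi_le_iff (h0.trans h1)).2 fun a => h2 a a.2)

/-- Compute the largest supremum distance of a point from the points that pass a test. -/
def spreadCmd (d j res : ℕ) (i : NatExpr) (T : Test) : Cmd :=
  .seq (.realSet res (.const 0) (.const 0))
    (.for_ j (.cond T (coordMaxCmd d res i (cell j) d) .skip))

theorem writesNat_spreadCmd {j res : ℕ} {i : NatExpr} {T : Test} {b : ℕ} :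
    (spreadCmd d j res i T).WritesNat b ↔ b = j := by
  simp [spreadCmd, Cmd.WritesNat, writesNat_coordMaxCmd]

theorem writesReal_spreadCmd {j res : ℕ} {i : NatExpr} {T : Test} {b : ℕ}
    (h : (spreadCmd d j res i T).WritesReal b) : b = res := by
  simp only [spreadCmd, Cmd.WritesReal, or_false] at h
  rcases h with h | h
  · exact h
  · exact writesReal_coordMaxCmd h

theorem wf_spreadCmd {j res : ℕ} (hj : j ≠ 0) {i : NatExpr} {T : Test} :
    (spreadCmd d j res i T).WF := by
  simp [spreadCmd, Cmd.WF, Cmd.WritesNat, writesNat_coordMaxCmd, wf_coordMaxCmd, hj]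

theorem spread_insert {X : Type*} [PseudoMetricSpace X] (y : Fin n → X) (V : Finset (Fin n))
    (i l : Fin n) : spread y (insert l V) i = max (spread y V i) (dist (y i) (y l)) := by
  rw [spread, Finset.sup_insert, spread, ← coe_nndist, max_comm]
  rfl

open Classical in
theorem realMem_spreadCmd (h : HasInput c r s) {j res : ℕ} (hj : j ≠ 0)
    (hres : d < res) {i : NatExpr} {i' : Fin n} {T : Test}
    (hi : ∀ s', Frame (spreadCmd d j res i T) s s' → i.eval s' = i') (P : Fin n → Prop)
    (hT : ∀ (k : ℕ) (hk : k < n) (s' : State), Frame (spreadCmd d j res i T) s s' →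
      s'.natMem j 0 = k → (T.Holds s' ↔ P ⟨k, hk⟩)) :
    ((spreadCmd d j res i T).den ω s).realMem res 0 =
      spread (coords c r) ({l | P l} : Finset (Fin n)) i' := by
  rw [spreadCmd, Cmd.den]
  set s₁ := (Cmd.realSet res (.const 0) (.const 0)).den ω s with hs₁
  have hs₁0 : s₁.natMem = s.natMem := rfl
  have hwf := wf_spreadCmd (d := d) (res := res) (i := i) (T := T) hj
  have key := Cmd.den_for (ω := ω) (s := s₁) hwf.2 (fun k s' => s'.realMem res 0 =
    spread (coords c r) ({l : Fin n | (l : ℕ) < k ∧ P l} : Finset (Fin n)) i') ?_ ?_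
  · rw [hs₁0, h.1] at key
    rw [key]
    congr 1
    ext i
    simp
  · simp [realMem_setNat, hs₁, Cmd.den, realMem_setReal_self, NatExpr.eval, RealExpr.eval, spread]
  · intro k hk s' hf hf' hk' hI
    rw [hs₁0, h.1] at hk
    have hfr : Frame (spreadCmd d j res i T) s s' := by
      refine ⟨fun b hb => ?_, fun b hb => ?_⟩
      · rw [writesNat_spreadCmd] at hb
        rw [hf b (by simp [Cmd.WritesNat, writesNat_coordMaxCmd, hb]), hs₁0]
      · simp only [spreadCmd, Cmd.WritesReal, or_false, not_or] at hb
        rw [hf' b (by simp only [Cmd.WritesReal, or_false]; exact hb.2), hs₁]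
        exact realMem_setReal_of_ne hb.1
    have hin : HasInput c r s' := h.congr (hfr.nat 0 (by rw [writesNat_spreadCmd]; exact hj.symm))
      fun a ha => hfr.real a fun hw => by have := writesReal_spreadCmd hw; omega
    rw [realMem_setNat, Cmd.den, card_filter_lt_succ P hk]
    have hPk := hT k hk s' hfr hk'
    by_cases hh : T.Holds s'
    · rw [if_pos hh, if_pos (hPk.1 hh), spread_insert, ← hI]
      exact realMem_coordMaxCmd hin hres (hi s' hfr) hk'
        (by rw [hI]; exact spread_nonneg _ _ _)
    · rw [if_neg hh, if_neg (fun hp => hh (hPk.2 hp)), ← hI]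
      rfl

end Spread
end Loops
end SphereSep

namespace SphereSep
open Metric RealRAM

/-! ### Filling an array with the outcomes of a test -/

section Fill
variable {ω : Tape} {n : ℕ}

theorem Frame.trans {p q : Cmd} {s s' s'' : State} (h : Frame p s s') (h' : Frame q s' s'')
    (hn : ∀ b, q.WritesNat b → p.WritesNat b) (hr : ∀ b, q.WritesReal b → p.WritesReal b) :
    Frame p s s'' :=
  ⟨fun b hb => (h'.nat b (mt (hn b) hb)).trans (h.nat b hb),
    fun b hb => (h'.real b (mt (hr b) hb)).trans (h.real b hb)⟩

/-- The non-zero cells of an array describe a set of indices. -/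
def Flags (a : ℕ) (P : Fin n → Prop) (s : State) : Prop := ∀ i : Fin n, s.natMem a i ≠ 0 ↔ P i

theorem Flags.congr {a : ℕ} {P : Fin n → Prop} {s s' : State} (h : Flags a P s)
    (hs : s'.natMem a = s.natMem a) : Flags a P s' := fun i => by rw [hs, h i]

theorem Flags.holds {a : ℕ} {P : Fin n → Prop} {s : State} (h : Flags a P s) {i : NatExpr}
    {i' : Fin n} (hi : i.eval s = i') : (flagTest a i).Holds s ↔ P i' := by
  rw [holds_flagTest, hi, h]

/-- Store in an array for which indices a test holds, after some preparation. -/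
def fillCmd (a A : ℕ) (p : Cmd) (T : Test) : Cmd :=
  .for_ a (.seq p (.cond T (.natSet A (cell a) (.const 1)) (.natSet A (cell a) (.const 0))))

theorem writesNat_fillCmd {a A : ℕ} {p : Cmd} {T : Test} {b : ℕ} :
    (fillCmd a A p T).WritesNat b ↔ b = a ∨ p.WritesNat b ∨ b = A := by
  simp [fillCmd, Cmd.WritesNat]

theorem writesReal_fillCmd {a A : ℕ} {p : Cmd} {T : Test} {b : ℕ} :
    (fillCmd a A p T).WritesReal b ↔ p.WritesReal b := by
  simp [fillCmd, Cmd.WritesReal]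

theorem draws_fillCmd {a A : ℕ} {p : Cmd} {T : Test} : (fillCmd a A p T).Draws ↔ p.Draws := by
  simp [fillCmd, Cmd.Draws]

theorem wf_fillCmd {a A : ℕ} {p : Cmd} {T : Test} :
    (fillCmd a A p T).WF ↔
      p.WF ∧ a ≠ 0 ∧ (¬ p.WritesNat a ∧ a ≠ A) ∧ ¬ p.WritesNat 0 ∧ 0 ≠ A := by
  simp [fillCmd, Cmd.WF, Cmd.WritesNat]

theorem depth_fillCmd {a A : ℕ} {p : Cmd} {T : Test} :
    (fillCmd a A p T).depth = p.depth + 1 := by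
  simp [fillCmd, Cmd.depth]

/-- The predicate `R` records what the preparation `p` establishes for the current index. That cell
`k` of `A` is still unchanged when the test is made allows the test to read it, so an array of flags
can be updated in place. -/
theorem flags_fillCmd {a A : ℕ} {p : Cmd} {T : Test} (hwf : (fillCmd a A p T).WF)
    (hpA : ¬ p.WritesNat A) {s : State} (hn : s.natMem 0 0 = n) (P : Fin n → Prop)
    (R : Fin n → State → Prop)
    (hp : ∀ (k : Fin n) (s' : State), Frame (fillCmd a A p T) s s' → s'.natMem a 0 = k →
      R k (p.den ω s'))
    (hT : ∀ (k : Fin n) (s' : State), Frame (fillCmd a A p T) s s' → s'.natMem a 0 = k →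
      s'.natMem A k = s.natMem A k → R k s' → (T.Holds s' ↔ P k)) :
    Flags A P ((fillCmd a A p T).den ω s) := by
  obtain ⟨-, -, ⟨hpa, haA⟩, -⟩ := wf_fillCmd.1 hwf
  refine natMem_for_fill hwf haA.symm hn (fun i v => v ≠ 0 ↔ P i) fun k hk s' hf hk' hA => ?_
  have hc : (p.den ω s').natMem a 0 = k := by rw [Cmd.natMem_den hpa, hk']
  have hA' : (p.den ω s').natMem A = s'.natMem A := Cmd.natMem_den hpA s'
  have hf' : Frame (fillCmd a A p T) s (p.den ω s') :=
    hf.trans (frame_den p s') (fun b hb => writesNat_fillCmd.2 (Or.inr (Or.inl hb)))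
      fun b hb => writesReal_fillCmd.2 hb
  have h := hT ⟨k, hk⟩ _ hf' hc (by rw [hA']; exact hA k le_rfl) (hp ⟨k, hk⟩ s' hf hk')
  rw [Cmd.den, Cmd.den]
  by_cases hh : T.Holds (p.den ω s')
  · rw [if_pos hh, Cmd.den, natMem_setNat_self]
    simp only [NatExpr.eval, hc, Function.update_self, hA']
    exact ⟨fun l hl => Function.update_of_ne hl _ _, iff_of_true one_ne_zero (h.1 hh)⟩
  · rw [if_neg hh, Cmd.den, natMem_setNat_self]
    simp only [NatExpr.eval, hc, Function.update_self, hA']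
    exact ⟨fun l hl => Function.update_of_ne hl _ _,
      iff_of_false (fun h0 => h0 rfl) (fun h0 => hh (h.2 h0))⟩

end Fill

/-! ### The search as a program -/

section Find

theorem filter_mem_univ {n : ℕ} (V : Finset (Fin n)) [DecidablePred (fun i => i ∈ V)] :
    ({i | i ∈ V} : Finset (Fin n)) = V := by
  ext
  simp

variable {ω : Tape} {d n : ℕ} {c : Fin n → EuclideanSpace ℝ (Fin d)} {r : Fin n → ℝ}

/-- Find the last index in the subfamily. -/
def startCmd : Cmd :=
  .seq (.natSet 8 (.const 0) (.const 0))
    (.for_ 4 (.cond (flagTest 2 (cell 4)) (.natSet 8 (.const 0) (cell 4)) .skip))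

theorem natMem_startCmd [NeZero n] {U : Finset (Fin n)} {s : State} (hn : s.natMem 0 0 = n)
    (hU : Flags 2 (· ∈ U) s) : (startCmd.den ω s).natMem 8 0 = startIndex U := by
  rw [startCmd, Cmd.den]
  set s₁ := (Cmd.natSet 8 (.const 0) (.const 0)).den ω s with hs₁
  have hs₁n : ∀ b, b ≠ 8 → s₁.natMem b = s.natMem b := fun b hb => natMem_setNat_of_ne hb
  have hs₁8 : s₁.natMem 8 0 = 0 := by simp [hs₁, Cmd.den, natMem_setNat_self, NatExpr.eval]
  -- Later members overwrite earlier ones, so the cell holds the largest member so far; while none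
  -- has been seen it holds the default `0`, in agreement with `startIndex`.
  have key := Cmd.den_for (ω := ω) (s := s₁) (a := 4)
    (p := .cond (flagTest 2 (cell 4)) (.natSet 8 (.const 0) (cell 4)) .skip)
    (by simp [Cmd.WF, Cmd.WritesNat])
    (fun k s' => (s'.natMem 8 0 = 0 ∧ ∀ i ∈ U, ¬ (i : ℕ) < k) ∨
      ∃ i ∈ U, s'.natMem 8 0 = i ∧ ∀ j ∈ U, (j : ℕ) < k → j ≤ i) ?_ ?_
  · rw [hs₁n 0 (by norm_num), hn] at key
    rcases key with ⟨h1, h2⟩ | ⟨i, hi, h1, h2⟩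
    · rw [startIndex, dif_neg, h1, Fin.val_zero]
      rintro ⟨i, hi⟩
      exact h2 i hi i.2
    · rw [h1, startIndex, dif_pos ⟨i, hi⟩]
      exact congrArg _ (le_antisymm (U.le_max' i hi) (Finset.max'_le _ _ _ fun j hj => h2 j hj j.2))
  · exact Or.inl ⟨by rw [natMem_setNat_of_ne (by norm_num), hs₁8], fun i _ => Nat.not_lt_zero _⟩
  · intro k hk s' hf _ hk' hI
    rw [hs₁n 0 (by norm_num), hn] at hk
    have hU' : Flags 2 (· ∈ U) s' := hU.congr <| by
      rw [hf 2 (by simp [Cmd.WritesNat]), hs₁n 2 (by norm_num)]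
    have hT := hU'.holds (i := cell 4) (i' := ⟨k, hk⟩) hk'
    rw [natMem_setNat_of_ne (by norm_num), Cmd.den]
    by_cases h : (⟨k, hk⟩ : Fin n) ∈ U
    · rw [if_pos (hT.2 h)]
      refine Or.inr ⟨_, h, ?_, fun j _ hjk => Fin.le_def.2 (Nat.lt_succ_iff.1 hjk)⟩
      simp [Cmd.den, natMem_setNat_self, NatExpr.eval, hk']
    · rw [if_neg (mt hT.1 h)]
      have hlt : ∀ j ∈ U, (j : ℕ) < k + 1 → (j : ℕ) < k := fun j hj hjk => by
        rcases Nat.lt_succ_iff_lt_or_eq.1 hjk with h1 | h1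
        · exact h1
        · exact absurd (by rwa [show (⟨k, hk⟩ : Fin n) = j from Fin.ext h1.symm]) h
      rcases hI with ⟨h1, h2⟩ | ⟨i, hi, h1, h2⟩
      · exact Or.inl ⟨h1, fun i hi hik => h2 i hi (hlt i hi hik)⟩
      · exact Or.inr ⟨i, hi, h1, fun j hj hjk => h2 j hj (hlt j hj hjk)⟩

/-- The test whether a sphere belongs to the subfamily and is near to the candidate. -/
def candidateTest (d : ℕ) : Test :=
  .and (flagTest 2 (cell 5))
    (nearTest d (cell 9) (cell 5) (.div (rcell (d + 2)) (.const 4)))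

/-- The test whether the candidate improves the current ball. -/
def improvesTest (d : ℕ) : Test :=
  .and (flagTest 2 (cell 9)) (.and (.realLt (.const 0) (rcell (d + 2)))
    (leTest (.ofNat (cell 10)) (.mul (.const (cellBound d)) (.ofNat (cell 6)))))

/-- Replace the current ball by the one around the candidate. -/
def moveCmd (d : ℕ) : Cmd :=
  -- The new radius is collected in a separate array because `candidateTest` reads the old one
  -- throughout the loop.
  .seq (spreadCmd d 5 (d + 3) (cell 9) (candidateTest d))
    (.seq (.realSet (d + 2) (.const 0) (rcell (d + 3))) (.natSet 8 (.const 0) (cell 9)))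

/-- One step of the search. -/
def searchStepCmd (d : ℕ) : Cmd :=
  .cond (.natLt (cell 9) (cell 0))
    (.seq (countCmd 5 6 (candidateTest d)) (.cond (improvesTest d) (moveCmd d)
      (.natSet 9 (.const 0) (.add (cell 9) (.const 1))))) .skip

/-- The memory holds a state of the search. -/
structure HoldsSearch (c : Fin n → EuclideanSpace ℝ (Fin d)) (r : Fin n → ℝ) (U : Finset (Fin n))
    (x : SearchState n) (s : State) : Prop where
  input : HasInput c r s
  family : Flags 2 (· ∈ U) s
  card : s.natMem 10 0 = U.card
  ptr : s.natMem 9 0 = x.ptr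
  ctr : s.natMem 8 0 = x.ctr
  rad : s.realMem (d + 2) 0 = x.rad
  nonneg : 0 ≤ x.rad

theorem HoldsSearch.congr {U : Finset (Fin n)} {x : SearchState n} {s s' : State}
    (h : HoldsSearch c r U x s)
    (hn : ∀ b, b = 0 ∨ b = 2 ∨ b = 8 ∨ b = 9 ∨ b = 10 → s'.natMem b = s.natMem b)
    (hr : ∀ a ≤ d + 2, s'.realMem a = s.realMem a) : HoldsSearch c r U x s' where
  input := h.input.congr (hn 0 (by simp)) fun a ha => hr a (by omega)
  family := h.family.congr (hn 2 (by simp))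
  card := by rw [hn 10 (by simp), h.card]
  ptr := by rw [hn 9 (by simp), h.ptr]
  ctr := by rw [hn 8 (by simp), h.ctr]
  rad := by rw [hr _ le_rfl, h.rad]
  nonneg := h.nonneg

theorem holds_candidateTest {U : Finset (Fin n)} {x : SearchState n} {s : State}
    (h : HoldsSearch c r U x s) (hx : x.ptr < n) {l : Fin n} (hl : s.natMem 5 0 = l) :
    (candidateTest d).Holds s ↔ l ∈ nearby (coords c r) U (x.rad / 4) ⟨x.ptr, hx⟩ := by
  have hR : (RealExpr.div (rcell (d + 2)) (.const 4)).eval s = x.rad / 4 := by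
    simp [RealExpr.eval, NatExpr.eval, h.rad]
  have h1 := h.family.holds (i := cell 5) hl
  have h2 := holds_nearTest h.input (i := cell 9) (j := cell 5) (i' := ⟨x.ptr, hx⟩) h.ptr hl
    (R := .div (rcell (d + 2)) (.const 4)) (by rw [hR]; have := h.nonneg; positivity)
  rw [hR] at h2
  rw [candidateTest, Test.Holds, h1, h2, nearby, Finset.mem_filter]

theorem holdsSearch_searchStepCmd {U : Finset (Fin n)} {x : SearchState n} {s : State}
    (h : HoldsSearch c r U x s) :
    HoldsSearch c r U (searchStep (coords c r) U (cellBound d) x)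
      ((searchStepCmd d).den ω s) := by
  classical
  rw [searchStepCmd, Cmd.den, searchStep]
  have h0 : (Test.natLt (cell 9) (cell 0)).Holds s ↔ x.ptr < n := by
    simp only [Test.Holds, NatExpr.eval, h.ptr, h.input.1]
  by_cases hx : x.ptr < n
  swap
  · rw [if_neg (mt h0.1 hx), dif_neg hx]
    exact h
  rw [if_pos (h0.2 hx), dif_pos hx, Cmd.den]
  set s₁ := (countCmd 5 6 (candidateTest d)).den ω s with hs₁
  have hfr : ∀ s', Frame (countCmd 5 6 (candidateTest d)) s s' → HoldsSearch c r U x s' :=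
    fun s' hf => h.congr (fun b hb => hf.nat b (by rw [writesNat_countCmd]; omega))
      fun a _ => hf.real a writesReal_countCmd
  have h1 : HoldsSearch c r U x s₁ := hfr s₁ (frame_den _ _)
  have hcnt : s₁.natMem 6 0 = (nearby (coords c r) U (x.rad / 4) ⟨x.ptr, hx⟩).card := by
    rw [hs₁, natMem_countCmd (by norm_num) (by norm_num) (by norm_num) h.input.1
      (fun l => l ∈ nearby (coords c r) U (x.rad / 4) ⟨x.ptr, hx⟩)
      fun k hk s' hf hk' => holds_candidateTest (hfr s' hf) hx hk', filter_mem_univ]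
  have hG : (improvesTest d).Holds s₁ ↔ Improves (coords c r) U (cellBound d) x.rad ⟨x.ptr, hx⟩ := by
    rw [improvesTest, Test.Holds, Test.Holds, holds_leTest,
      h1.family.holds (i := cell 9) (i' := ⟨x.ptr, hx⟩) h1.ptr, Improves]
    refine and_congr_right' (and_congr ?_ ?_)
    · simp [Test.Holds, RealExpr.eval, NatExpr.eval, h1.rad]
    · simp only [RealExpr.eval, NatExpr.eval, h1.card, hcnt]
      norm_cast
  rw [Cmd.den]
  by_cases hI : Improves (coords c r) U (cellBound d) x.rad ⟨x.ptr, hx⟩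
  · rw [if_pos (hG.2 hI), if_pos hI, moveCmd, Cmd.den]
    set s₂ := (spreadCmd d 5 (d + 3) (cell 9) (candidateTest d)).den ω s₁ with hs₂
    have hfr' : ∀ s', Frame (spreadCmd d 5 (d + 3) (cell 9) (candidateTest d)) s₁ s' →
        HoldsSearch c r U x s' := fun s' hf => h1.congr
      (fun b hb => hf.nat b (by rw [writesNat_spreadCmd]; omega))
      fun a ha => hf.real a fun hw => by have := writesReal_spreadCmd hw; omega
    have h2 : HoldsSearch c r U x s₂ := hfr' s₂ (frame_den _ _)
    have hsp : s₂.realMem (d + 3) 0 = spread (coords c r)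
        (nearby (coords c r) U (x.rad / 4) ⟨x.ptr, hx⟩) ⟨x.ptr, hx⟩ := by
      rw [hs₂, realMem_spreadCmd h1.input (by norm_num) (by omega) (i' := ⟨x.ptr, hx⟩)
        (fun s' hf => (hfr' s' hf).ptr)
        (fun l => l ∈ nearby (coords c r) U (x.rad / 4) ⟨x.ptr, hx⟩)
        fun k hk s' hf hk' => holds_candidateTest (hfr' s' hf) hx hk', filter_mem_univ]
    simp only [Cmd.den, NatExpr.eval, RealExpr.eval, natMem_setReal, h2.ptr, hsp]
    refine ⟨h2.input.congr ?_ fun a ha => ?_, h2.family.congr ?_, ?_, ?_, ?_, ?_, spread_nonneg _ _ _⟩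
    · rw [natMem_setNat_of_ne (by norm_num), natMem_setReal]
    · rw [realMem_setNat, realMem_setReal_of_ne (by omega)]
    · rw [natMem_setNat_of_ne (by norm_num), natMem_setReal]
    · rw [natMem_setNat_of_ne (by norm_num), natMem_setReal, h2.card]
    · rw [natMem_setNat_of_ne (by norm_num), natMem_setReal, h2.ptr]
    · rw [natMem_setNat_self, Function.update_self]
    · rw [realMem_setNat, realMem_setReal_self, Function.update_self]
  · rw [if_neg (mt hG.1 hI), if_neg hI]
    simp only [Cmd.den, NatExpr.eval, h1.ptr]
    refine ⟨h1.input.congr ?_ fun a ha => rfl, h1.family.congr ?_, ?_, ?_, ?_, h1.rad, h1.nonneg⟩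
    · rw [natMem_setNat_of_ne (by norm_num)]
    · rw [natMem_setNat_of_ne (by norm_num)]
    · rw [natMem_setNat_of_ne (by norm_num), h1.card]
    · rw [natMem_setNat_self, Function.update_self]
    · rw [natMem_setNat_of_ne (by norm_num), h1.ctr]

/-- Prepare the search. -/
def prepareCmd (d : ℕ) : Cmd :=
  .seq (countCmd 5 10 (flagTest 2 (cell 5))) (.seq startCmd
    (.seq (spreadCmd d 5 (d + 2) (cell 8) (flagTest 2 (cell 5)))
      (.natSet 9 (.const 0) (.const 0))))

/-- Find a small ball that contains a definite proportion of the subfamily. -/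
def findCmd (d : ℕ) : Cmd :=
  -- A loop makes `n` passes only, so each pass performs two of the `2n` steps of the search.
  .seq (prepareCmd d) (.for_ 4 (.seq (searchStepCmd d) (searchStepCmd d)))

theorem holdsSearch_prepareCmd [NeZero n] {U : Finset (Fin n)} {s : State}
    (h : HasInput c r s) (hU : Flags 2 (· ∈ U) s) :
    HoldsSearch c r U ⟨0, startIndex U, spread (coords c r) U (startIndex U)⟩
      ((prepareCmd d).den ω s) := by
  classical
  simp only [prepareCmd, Cmd.den, NatExpr.eval]
  set s₁ := (countCmd 5 10 (flagTest 2 (cell 5))).den ω s with hs₁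
  set s₂ := startCmd.den ω s₁ with hs₂
  set s₃ := (spreadCmd d 5 (d + 2) (cell 8) (flagTest 2 (cell 5))).den ω s₂ with hs₃
  have n₁ : ∀ s', Frame (countCmd 5 10 (flagTest 2 (cell 5))) s s' →
      ∀ b, b = 0 ∨ b = 2 → s'.natMem b = s.natMem b := fun s' hf b hb =>
    hf.nat b (by rw [writesNat_countCmd]; omega)
  have hc : s₁.natMem 10 0 = U.card := by
    rw [hs₁, natMem_countCmd (by norm_num) (by norm_num) (by norm_num) h.1 (fun l => l ∈ U)
      fun k hk s' hf hk' => (hU.congr (n₁ s' hf 2 (by simp))).holds (i' := ⟨k, hk⟩) hk',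
      filter_mem_univ]
  have i₁ : HasInput c r s₁ := h.congr (n₁ s₁ (frame_den _ _) 0 (by simp))
    fun a _ => Cmd.realMem_den writesReal_countCmd s
  have u₁ : Flags 2 (· ∈ U) s₁ := hU.congr (n₁ s₁ (frame_den _ _) 2 (by simp))
  have n₂ : ∀ b, b ≠ 4 → b ≠ 8 → s₂.natMem b = s₁.natMem b := fun b h4 h8 =>
    Cmd.natMem_den (by simp [startCmd, Cmd.WritesNat, h4, h8]) s₁
  have i₂ : HasInput c r s₂ := i₁.congr (n₂ 0 (by norm_num) (by norm_num))
    fun a _ => Cmd.realMem_den (by simp [startCmd, Cmd.WritesReal]) s₁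
  have u₂ : Flags 2 (· ∈ U) s₂ := u₁.congr (n₂ 2 (by norm_num) (by norm_num))
  have c₂ : s₂.natMem 8 0 = startIndex U := natMem_startCmd i₁.1 u₁
  have n₃ : ∀ s', Frame (spreadCmd d 5 (d + 2) (cell 8) (flagTest 2 (cell 5))) s₂ s' →
      ∀ b, b ≠ 5 → s'.natMem b = s₂.natMem b := fun s' hf b hb =>
    hf.nat b (by rw [writesNat_spreadCmd]; exact hb)
  have hsp : s₃.realMem (d + 2) 0 = spread (coords c r) U (startIndex U) := by
    rw [hs₃, realMem_spreadCmd i₂ (by norm_num) (by omega) (i' := startIndex U)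
      (fun s' hf => by rw [NatExpr.eval, n₃ s' hf 8 (by norm_num)]; exact c₂) (fun l => l ∈ U)
      fun k hk s' hf hk' => (u₂.congr (n₃ s' hf 2 (by norm_num))).holds (i' := ⟨k, hk⟩) hk',
      filter_mem_univ]
  have m₃ : ∀ b, b ≠ 5 → s₃.natMem b = s₂.natMem b := n₃ s₃ (frame_den _ _)
  have i₃ : HasInput c r s₃ := i₂.congr (m₃ 0 (by norm_num)) fun a ha =>
    Cmd.realMem_den (fun hw => by have := writesReal_spreadCmd hw; omega) s₂
  refine ⟨i₃.congr (natMem_setNat_of_ne (by norm_num)) fun _ _ => rfl,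
    (u₂.congr (m₃ 2 (by norm_num))).congr (natMem_setNat_of_ne (by norm_num)), ?_, ?_, ?_, hsp,
    spread_nonneg _ _ _⟩
  · rw [natMem_setNat_of_ne (by norm_num), m₃ 10 (by norm_num), n₂ 10 (by norm_num) (by norm_num), hc]
  · rw [natMem_setNat_self, Function.update_self]
  · rw [natMem_setNat_of_ne (by norm_num), m₃ 8 (by norm_num), c₂]

theorem wf_searchStepCmd : (searchStepCmd d).WF := by
  simp [searchStepCmd, moveCmd, Cmd.WF, wf_countCmd, wf_spreadCmd]

theorem writesNat_searchStepCmd {b : ℕ} :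
    (searchStepCmd d).WritesNat b → b = 5 ∨ b = 6 ∨ b = 8 ∨ b = 9 := by
  simp only [searchStepCmd, moveCmd, Cmd.WritesNat, writesNat_countCmd, writesNat_spreadCmd,
    or_false, false_or]
  omega

theorem holdsSearch_findCmd [NeZero n] {U : Finset (Fin n)} {s : State}
    (h : HasInput c r s) (hU : Flags 2 (· ∈ U) s) :
    HoldsSearch c r U (found c r U) ((findCmd d).den ω s) := by
  have h0 := holdsSearch_prepareCmd (ω := ω) h hU
  rw [findCmd, Cmd.den]
  set s₁ := (prepareCmd d).den ω s
  have key := Cmd.den_for (ω := ω) (s := s₁) (a := 4) (p := .seq (searchStepCmd d) (searchStepCmd d))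
    ⟨⟨wf_searchStepCmd, wf_searchStepCmd⟩, by norm_num,
      fun h => by rcases h with h | h <;> have := writesNat_searchStepCmd h <;> omega,
      fun h => by rcases h with h | h <;> have := writesNat_searchStepCmd h <;> omega⟩
    (fun k s' => HoldsSearch c r U ((searchStep (coords c r) U (cellBound d))^[2 * k]
      ⟨0, startIndex U, spread (coords c r) U (startIndex U)⟩) s') ?_ ?_
  · rw [h0.input.1] at key
    exact key
  · exact h0.congr (fun b hb => natMem_setNat_of_ne (by omega)) fun _ _ => rfl
  · intro k _ s' _ _ _ hI
    rw [show 2 * (k + 1) = 2 * k + 1 + 1 by ring, Function.iterate_succ_apply',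
      Function.iterate_succ_apply', Cmd.den]
    exact (holdsSearch_searchStepCmd (holdsSearch_searchStepCmd hI)).congr
      (fun b hb => natMem_setNat_of_ne (by omega)) fun _ _ => rfl

end Find
end SphereSep

namespace SphereSep
open Metric RealRAM

/-! ### One cut as a program -/

section Cut
variable {ω : Tape} {d n : ℕ} {c : Fin n → EuclideanSpace ℝ (Fin d)} {r : Fin n → ℝ}

-- An existential condition on a second index is decided by counting its witnesses in an inner loop.
open Classical in
theorem flags_fillCmd_countCmd {A : ℕ} (hA : A = 1 ∨ 6 < A) {T₀ T : Test} {s : State}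
    (hn : s.natMem 0 0 = n) (P₀ : Fin n → Fin n → Prop) (P : Fin n → Prop)
    (hT₀ : ∀ (k l : Fin n) (s' : State), Frame (fillCmd 4 A (countCmd 5 6 T₀) T) s s' →
      s'.natMem 4 0 = k → s'.natMem 5 0 = l → (T₀.Holds s' ↔ P₀ k l))
    (hT : ∀ (k : Fin n) (s' : State), Frame (fillCmd 4 A (countCmd 5 6 T₀) T) s s' →
      s'.natMem 4 0 = k → s'.natMem A k = s.natMem A k →
      s'.natMem 6 0 = ({l | P₀ k l} : Finset (Fin n)).card → (T.Holds s' ↔ P k)) :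
    Flags A P ((fillCmd 4 A (countCmd 5 6 T₀) T).den ω s) := by
  refine flags_fillCmd ?_ ?_ hn P
    (fun k s' => s'.natMem 6 0 = ({l | P₀ k l} : Finset (Fin n)).card) ?_ hT
  · rw [wf_fillCmd, writesNat_countCmd, writesNat_countCmd]
    exact ⟨wf_countCmd (by norm_num) (by norm_num) (by norm_num), by norm_num, by omega,
      by norm_num, by omega⟩
  · rw [writesNat_countCmd]
    omega
  · intro k s' hf hk
    refine natMem_countCmd (by norm_num) (by norm_num) (by norm_num) ?_ (fun l => P₀ k l)
      fun l hl s'' hf' hl' => hT₀ k ⟨l, hl⟩ s''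
        (hf.trans hf' (fun b hb => writesNat_fillCmd.2 (Or.inr (Or.inl hb)))
          fun b hb => absurd hb writesReal_countCmd) ?_ hl'
    · rw [hf.nat 0 (by rw [writesNat_fillCmd, writesNat_countCmd]; omega), hn]
    · rw [hf'.nat 4 (by rw [writesNat_countCmd]; norm_num), hk]

/-- The radius of the inner sphere of the annulus. -/
def innerExpr (d : ℕ) : RealExpr := .mul (.const d) (rcell (d + 2))

/-- The radius of the sphere along which the subfamily is cut. -/
def cutExpr (d : ℕ) : RealExpr := .mul (innerExpr d) (.add (.const 1) (rcell (d + 4)))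

variable [NeZero n]

/-- The memory holds the data of a cut. -/
structure HoldsCut (c : Fin n → EuclideanSpace ℝ (Fin d)) (r : Fin n → ℝ) (U : Finset (Fin n))
    (u : unitInterval) (Z : Set (Fin n)) (s : State) : Prop where
  input : HasInput c r s
  critical : Flags 14 (· ∈ Z) s
  ctr : s.natMem 8 0 = (found c r U).ctr
  rad : s.realMem (d + 2) 0 = (found c r U).rad
  rand : s.realMem (d + 4) 0 = u

variable {U : Finset (Fin n)} {u : unitInterval} {Z : Set (Fin n)} {s : State}

theorem HoldsCut.congr (h : HoldsCut c r U u Z s) {s' : State}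
    (hn : ∀ b, b = 0 ∨ b = 8 ∨ b = 14 → s'.natMem b = s.natMem b)
    (hr : ∀ a, s'.realMem a = s.realMem a) : HoldsCut c r U u Z s' where
  input := h.input.congr (hn 0 (by simp)) fun a _ => hr a
  critical := h.critical.congr (hn 14 (by simp))
  ctr := by rw [hn 8 (by simp), h.ctr]
  rad := by rw [hr, h.rad]
  rand := by rw [hr, h.rand]

theorem HoldsCut.of_frame (h : HoldsCut c r U u Z s) {p : Cmd} {s' : State} (hf : Frame p s s')
    (hn : ∀ b, b = 0 ∨ b = 8 ∨ b = 14 → ¬ p.WritesNat b) (hr : ∀ b, ¬ p.WritesReal b) :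
    HoldsCut c r U u Z s' := h.congr (fun b hb => hf.nat b (hn b hb)) fun a => hf.real a (hr a)

theorem eval_innerExpr (h : HoldsCut c r U u Z s) :
    (innerExpr d).eval s = (layout c r U).ρ := by
  simp [innerExpr, RealExpr.eval, NatExpr.eval, h.rad, layout]

theorem eval_cutExpr (h : HoldsCut c r U u Z s) :
    (cutExpr d).eval s = (layout c r U).radius u := by
  have h1 := eval_innerExpr h
  simp only [cutExpr, RealExpr.eval, NatExpr.eval, h1, h.rand, Layout.radius, Rat.cast_one]

/-- Find out which side of each sphere is its cap. -/
def capSideCmd (d : ℕ) : Cmd :=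
  fillCmd 4 11 (.seq
      (countCmd 5 6 (.and (flagTest 2 (cell 5)) (insideTest d (cell 5) (cell 4))))
      (countCmd 5 7 (.and (flagTest 2 (cell 5)) (outsideTest d (cell 5) (cell 4)))))
    (orTest (.realLt (.get d (cell 4)) (innerExpr d)) (.not (.natLt (cell 7) (cell 6))))

theorem writesNat_capSideCmd {b : ℕ} (h : (capSideCmd d).WritesNat b) :
    b = 4 ∨ b = 5 ∨ b = 6 ∨ b = 7 ∨ b = 11 := by
  simp only [capSideCmd, writesNat_fillCmd, Cmd.WritesNat, writesNat_countCmd] at h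
  omega

theorem writesReal_capSideCmd {b : ℕ} : ¬ (capSideCmd d).WritesReal b := by
  simp [capSideCmd, writesReal_fillCmd, Cmd.WritesReal, writesReal_countCmd]

theorem flags_capSideCmd (hd : 2 ≤ d) (hr : ∀ i, 0 < r i) (h : HoldsCut c r U u Z s)
    (hU : Flags 2 (· ∈ U) s) :
    Flags 11 (fun k => (layout c r U).capSide k = true) ((capSideCmd d).den ω s) := by
  classical
  set S := layout c r U with hS
  have hH : ∀ s', Frame (capSideCmd d) s s' → HoldsCut c r U u Z s' ∧ Flags 2 (· ∈ U) s' :=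
    fun s' hf => ⟨h.of_frame hf (fun b hb hw => by have := writesNat_capSideCmd hw; omega)
      fun b => writesReal_capSideCmd,
      hU.congr (hf.nat 2 fun hw => by have := writesNat_capSideCmd hw; omega)⟩
  refine flags_fillCmd ?_ ?_ h.input.1 _ (fun k s' => s'.natMem 6 0 = (S.onSide k true).card ∧
    s'.natMem 7 0 = (S.onSide k false).card) ?_ ?_
  · simp [wf_fillCmd, Cmd.WF, wf_countCmd, Cmd.WritesNat, writesNat_countCmd]
  · simp [Cmd.WritesNat, writesNat_countCmd]
  · intro k s' hf hk
    set T₁ : Test := .and (flagTest 2 (cell 5)) (insideTest d (cell 5) (cell 4)) with hT₁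
    set T₂ : Test := .and (flagTest 2 (cell 5)) (outsideTest d (cell 5) (cell 4)) with hT₂
    rw [Cmd.den]
    set s₁ := (countCmd 5 6 T₁).den ω s' with hs₁
    have hf₁ : ∀ s'', Frame (countCmd 5 6 T₁) s' s'' → Frame (capSideCmd d) s s'' :=
      fun s'' hf' => hf.trans hf'
        (fun b hb => writesNat_fillCmd.2 (Or.inr (Or.inl (Or.inl hb))))
        fun b hb => absurd hb writesReal_countCmd
    have hf₂ : ∀ s'', Frame (countCmd 5 7 T₂) s₁ s'' → Frame (capSideCmd d) s s'' :=
      fun s'' hf' => (hf₁ s₁ (frame_den _ _)).trans hf'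
        (fun b hb => writesNat_fillCmd.2 (Or.inr (Or.inl (Or.inr hb))))
        fun b hb => absurd hb writesReal_countCmd
    have hk₁ : ∀ s'', Frame (countCmd 5 6 T₁) s' s'' → s''.natMem 4 0 = k := fun s'' hf' => by
      rw [hf'.nat 4 (by rw [writesNat_countCmd]; norm_num), hk]
    have hk₂ : ∀ s'', Frame (countCmd 5 7 T₂) s₁ s'' → s''.natMem 4 0 = k := fun s'' hf' => by
      rw [hf'.nat 4 (by rw [writesNat_countCmd]; norm_num), hk₁ s₁ (frame_den _ _)]
    constructor
    · rw [Cmd.natMem_den (by rw [writesNat_countCmd]; norm_num), hs₁,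
        natMem_countCmd (by norm_num) (by norm_num) (by norm_num) (hH s' hf).1.input.1
          (fun l => l ∈ S.onSide k true) ?_, filter_mem_univ]
      intro l hl s'' hf' hl'
      obtain ⟨h1, h2⟩ := hH s'' (hf₁ s'' hf')
      rw [hT₁, Test.Holds, h2.holds (i := cell 5) (i' := ⟨l, hl⟩) hl',
        holds_insideTest hd hr h1.input (i := cell 5) (j := cell 4) (i' := ⟨l, hl⟩) hl' (hk₁ s'' hf'),
        Layout.onSide, Finset.mem_filter]
      exact Iff.rfl
    · rw [natMem_countCmd (by norm_num) (by norm_num) (by norm_num)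
          (hH s₁ (hf₁ s₁ (frame_den _ _))).1.input.1
          (fun l => l ∈ S.onSide k false) ?_, filter_mem_univ]
      intro l hl s'' hf' hl'
      obtain ⟨h1, h2⟩ := hH s'' (hf₂ s'' hf')
      rw [hT₂, Test.Holds, h2.holds (i := cell 5) (i' := ⟨l, hl⟩) hl',
        holds_outsideTest hd hr h1.input (i := cell 5) (j := cell 4) (i' := ⟨l, hl⟩) hl' (hk₂ s'' hf'),
        Layout.onSide, Finset.mem_filter]
      exact Iff.rfl
  · rintro k s' hf hk - ⟨h6, h7⟩
    obtain ⟨h1, -⟩ := hH s' hf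
    rw [holds_orTest, Test.Holds, eval_innerExpr h1, eval_radius h1.input (i := cell 4) hk,
      Layout.capSide, decide_eq_true_iff]
    refine or_congr Iff.rfl ?_
    simp only [Test.Holds, NatExpr.eval, h6, h7, not_lt]

/-- Find the relevant spheres. -/
def relevantCmd (d : ℕ) : Cmd :=
  fillCmd 4 12 .skip (.and (flagTest 2 (cell 4)) (annulusTest d (cell 4) (cell 8) (innerExpr d)))

theorem writesNat_relevantCmd {b : ℕ} (h : (relevantCmd d).WritesNat b) : b = 4 ∨ b = 12 := by
  simpa [relevantCmd, writesNat_fillCmd, Cmd.WritesNat] using h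

theorem writesReal_relevantCmd {b : ℕ} : ¬ (relevantCmd d).WritesReal b := by
  simp [relevantCmd, writesReal_fillCmd, Cmd.WritesReal]

theorem flags_relevantCmd (hd : 2 ≤ d) (hr : ∀ i, 0 < r i) (h : HoldsCut c r U u Z s)
    (hU : Flags 2 (· ∈ U) s) (hρ : 0 < (layout c r U).ρ) :
    Flags 12 (· ∈ (layout c r U).relevant) ((relevantCmd d).den ω s) := by
  classical
  refine flags_fillCmd (by simp [wf_fillCmd, Cmd.WF, Cmd.WritesNat]) (by simp [Cmd.WritesNat])
    h.input.1 _ (fun _ _ => True) (fun _ _ _ _ => trivial) fun k s' hf hk _ _ => ?_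
  have h1 : HoldsCut c r U u Z s' := h.of_frame (p := relevantCmd d) hf
    (fun b hb hw => by have := writesNat_relevantCmd hw; omega) fun b => writesReal_relevantCmd
  have h2 : Flags 2 (· ∈ U) s' := hU.congr
    (Frame.nat (p := relevantCmd d) hf 2 fun hw => by have := writesNat_relevantCmd hw; omega)
  have h3 := holds_annulusTest hd hr h1.input (i := cell 4) (j := cell 8) hk h1.ctr
    (R := innerExpr d) (by rw [eval_innerExpr h1]; exact hρ)
  rw [Test.Holds, h2.holds (i := cell 4) hk, h3, eval_innerExpr h1, Layout.relevant,
    Finset.mem_filter]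
  exact Iff.rfl

/-- The test whether the sphere `i` lies in the cap of the sphere `k`. -/
def capTest (d : ℕ) (k i : NatExpr) : Test :=
  orTest (.and (flagTest 11 k) (insideTest d i k)) (.and (.not (flagTest 11 k)) (outsideTest d i k))

theorem holds_capTest (hd : 2 ≤ d) (hr : ∀ i, 0 < r i) (h : HasInput c r s)
    (hc : Flags 11 (fun k => (layout c r U).capSide k = true) s) {k i : NatExpr} {k' i' : Fin n}
    (hk : k.eval s = k') (hi : i.eval s = i') :
    (capTest d k i).Holds s ↔ (layout c r U).InCap k' i' := by
  rw [capTest, holds_orTest, Test.Holds, Test.Holds, Test.Holds, hc.holds hk,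
    holds_insideTest hd hr h hi hk, holds_outsideTest hd hr h hi hk, Layout.InCap]
  cases (layout c r U).capSide k' with
  | true => simp [layout]
  | false => simp [layout]

/-- Find the spheres that are hit and exposed. -/
def hitCmd (d : ℕ) : Cmd :=
  fillCmd 4 13 (countCmd 5 6
      (.and (flagTest 12 (cell 5)) (.and (flagTest 14 (cell 5)) (capTest d (cell 5) (cell 4)))))
    (.and (flagTest 12 (cell 4)) (.and
      (orTest (leTest (innerExpr d) (.get d (cell 4))) (meetTest d (cell 4) (cell 8) (cutExpr d)))
      (.not (.natLt (.const 0) (cell 6)))))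

theorem writesNat_hitCmd {b : ℕ} (h : (hitCmd d).WritesNat b) :
    b = 4 ∨ b = 5 ∨ b = 6 ∨ b = 13 := by
  simp only [hitCmd, writesNat_fillCmd, writesNat_countCmd] at h
  omega

theorem writesReal_hitCmd {b : ℕ} : ¬ (hitCmd d).WritesReal b := by
  simp [hitCmd, writesReal_fillCmd, writesReal_countCmd]

theorem flags_hitCmd (hd : 2 ≤ d) (hr : ∀ i, 0 < r i) (h : HoldsCut c r U u Z s)
    (hc : Flags 11 (fun k => (layout c r U).capSide k = true) s)
    (hR : Flags 12 (· ∈ (layout c r U).relevant) s) (hρ : 0 < (layout c r U).ρ) :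
    Flags 13 (fun i => (layout c r U).Hit ((layout c r U).radius u) i ∧
      (layout c r U).Exposed Z i) ((hitCmd d).den ω s) := by
  set S := layout c r U with hS
  have hH : ∀ s', Frame (hitCmd d) s s' → HoldsCut c r U u Z s' ∧
      Flags 11 (fun k => S.capSide k = true) s' ∧ Flags 12 (· ∈ S.relevant) s' :=
    fun s' hf => ⟨h.of_frame hf (fun b hb hw => by have := writesNat_hitCmd hw; omega)
      fun b => writesReal_hitCmd,
      hc.congr (hf.nat 11 fun hw => by have := writesNat_hitCmd hw; omega),
      hR.congr (hf.nat 12 fun hw => by have := writesNat_hitCmd hw; omega)⟩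
  refine flags_fillCmd_countCmd (by norm_num) h.input.1
    (fun i k => k ∈ S.relevant ∧ k ∈ Z ∧ S.InCap k i) _ ?_ ?_
  · intro i k s' hf hi hk
    obtain ⟨h1, h2, h3⟩ := hH s' hf
    rw [Test.Holds, Test.Holds, h3.holds (i := cell 5) hk, h1.critical.holds (i := cell 5) hk,
      holds_capTest hd hr h1.input h2 (k := cell 5) (i := cell 4) hk hi]
  · intro i s' hf hi _ h6
    obtain ⟨h1, h2, h3⟩ := hH s' hf
    have ht : (cutExpr d).eval s' = S.radius u := eval_cutExpr h1
    have hm := holds_meetTest hd hr h1.input (i := cell 4) (j := cell 8) hi h1.ctr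
      (t := cutExpr d) (by rw [ht]; exact hρ.trans_le (Layout.le_radius hρ u))
    -- The sphere is exposed exactly when the number of relevant critical spheres with it in their
    -- caps is zero.
    have he : (Test.not (.natLt (.const 0) (cell 6))).Holds s' ↔ S.Exposed Z i := by
      simp only [Test.Holds, NatExpr.eval, h6, not_lt, Nat.le_zero, Finset.card_eq_zero,
        Finset.filter_eq_empty_iff, Finset.mem_univ, true_imp_iff, Layout.Exposed]
      refine forall_congr' fun k => ?_
      tauto
    rw [Test.Holds, Test.Holds, he, h3.holds (i := cell 4) hi, holds_orTest, holds_leTest, hm, ht,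
      eval_innerExpr h1, eval_radius h1.input (i := cell 4) hi, ← and_assoc]
    exact Iff.rfl

/-- Remove spheres. -/
def removeCmd (d : ℕ) : Cmd :=
  fillCmd 4 1 (countCmd 5 6
      (.and (flagTest 13 (cell 5)) (.and (flagTest 14 (cell 5)) (adjTest d (cell 5) (cell 4)))))
    (orTest (flagTest 1 (cell 4)) (.and (flagTest 2 (cell 4))
      (orTest (flagTest 13 (cell 4)) (.natLt (.const 0) (cell 6)))))

theorem writesNat_removeCmd {b : ℕ} (h : (removeCmd d).WritesNat b) :
    b = 4 ∨ b = 5 ∨ b = 6 ∨ b = 1 := by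
  simp only [removeCmd, writesNat_fillCmd, writesNat_countCmd] at h
  omega

theorem writesReal_removeCmd {b : ℕ} : ¬ (removeCmd d).WritesReal b := by
  simp [removeCmd, writesReal_fillCmd, writesReal_countCmd]

theorem flags_removeCmd (hd : 2 ≤ d) (hr : ∀ i, 0 < r i) (h : HoldsCut c r U u Z s)
    (hU : Flags 2 (· ∈ U) s) {X : Fin n → Prop} (hX : Flags 1 X s)
    (hE : Flags 13 (fun i => (layout c r U).Hit ((layout c r U).radius u) i ∧
      (layout c r U).Exposed Z i) s) :
    Flags 1 (fun i => X i ∨ i ∈ (layout c r U).cut ((layout c r U).radius u) Z)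
      ((removeCmd d).den ω s) := by
  classical
  set S := layout c r U with hS
  set t := S.radius u with ht
  have hH : ∀ s', Frame (removeCmd d) s s' → HoldsCut c r U u Z s' ∧
      Flags 2 (· ∈ U) s' ∧ Flags 13 (fun i => S.Hit t i ∧ S.Exposed Z i) s' :=
    fun s' hf => ⟨h.of_frame hf (fun b hb hw => by have := writesNat_removeCmd hw; omega)
      fun b => writesReal_removeCmd,
      hU.congr (hf.nat 2 fun hw => by have := writesNat_removeCmd hw; omega),
      hE.congr (hf.nat 13 fun hw => by have := writesNat_removeCmd hw; omega)⟩
  refine flags_fillCmd_countCmd (by norm_num) h.input.1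
    (fun i j => (S.Hit t j ∧ S.Exposed Z j) ∧ j ∈ Z ∧ (sphereGraph c r).Adj j i) _ ?_ ?_
  · intro i j s' hf hi hj
    obtain ⟨h1, h2, h3⟩ := hH s' hf
    rw [Test.Holds, Test.Holds, h3.holds (i := cell 5) hj, h1.critical.holds (i := cell 5) hj,
      holds_adjTest hd hr h1.input (i := cell 5) (j := cell 4) hj hi]
  · intro i s' hf hi hA h6
    obtain ⟨h1, h2, h3⟩ := hH s' hf
    have hx : (flagTest 1 (cell 4)).Holds s' ↔ X i := by
      rw [holds_flagTest, NatExpr.eval, NatExpr.eval, hi, hA, hX i]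
    have he : (Test.natLt (.const 0) (cell 6)).Holds s' ↔
        ∃ j, (S.Hit t j ∧ S.Exposed Z j) ∧ j ∈ Z ∧ (sphereGraph c r).Adj j i := by
      simp only [Test.Holds, NatExpr.eval, h6, Finset.card_pos, Finset.Nonempty,
        Finset.mem_filter, Finset.mem_univ, true_and]
    rw [holds_orTest, hx, Test.Holds, holds_orTest, h2.holds (i := cell 4) hi,
      h3.holds (i := cell 4) hi, he, Layout.cut, Finset.mem_filter]
    simp only [and_assoc]
    exact Iff.rfl

/-- Restrict the subfamily to the spheres that remain to be cut. -/
def restrictCmd (d : ℕ) : Cmd :=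
  fillCmd 4 2 .skip (.and (flagTest 2 (cell 4))
    (.realLt (sqExpr (cutExpr d)) (ptPtExpr d (cell 4) (cell 8))))

theorem writesNat_restrictCmd {b : ℕ} (h : (restrictCmd d).WritesNat b) : b = 4 ∨ b = 2 := by
  simpa [restrictCmd, writesNat_fillCmd, Cmd.WritesNat] using h

theorem writesReal_restrictCmd {b : ℕ} : ¬ (restrictCmd d).WritesReal b := by
  simp [restrictCmd, writesReal_fillCmd, Cmd.WritesReal]

theorem flags_restrictCmd (h : HoldsCut c r U u Z s) (hU : Flags 2 (· ∈ U) s)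
    (hρ : 0 < (layout c r U).ρ) :
    Flags 2 (fun i => i ∈ U ∧ (layout c r U).radius u < dist (pt c r i) (layout c r U).q)
      ((restrictCmd d).den ω s) := by
  refine flags_fillCmd (by simp [wf_fillCmd, Cmd.WF, Cmd.WritesNat]) (by simp [Cmd.WritesNat])
    h.input.1 _ (fun _ _ => True) (fun _ _ _ _ => trivial) fun k s' hf hk hA _ => ?_
  have h1 : HoldsCut c r U u Z s' := h.of_frame (p := restrictCmd d) hf
    (fun b hb hw => by have := writesNat_restrictCmd hw; omega) fun b => writesReal_restrictCmd
  have hu : (flagTest 2 (cell 4)).Holds s' ↔ k ∈ U := by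
    rw [holds_flagTest, NatExpr.eval, NatExpr.eval, hk, hA, hU k]
  rw [Test.Holds, hu, Test.Holds, eval_sqExpr, eval_cutExpr h1,
    eval_ptPtExpr h1.input (i := cell 4) (j := cell 8) hk h1.ctr,
    sq_lt_sq₀ (hρ.trans_le (Layout.le_radius hρ u)).le dist_nonneg]
  exact Iff.rfl

/-- Cut the subfamily. -/
def cutCmd (d : ℕ) : Cmd :=
  .seq (capSideCmd d) (.seq (relevantCmd d) (.seq (hitCmd d) (.seq (removeCmd d) (restrictCmd d))))

/-- The subfamily in array `2` is overwritten last, since earlier stages of the cut still read it.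
-/
theorem flags_cutCmd (hd : 2 ≤ d) (hr : ∀ i, 0 < r i) (h : HoldsCut c r U u Z s)
    (hU : Flags 2 (· ∈ U) s) {X : Fin n → Prop} (hX : Flags 1 X s)
    (hrad : (found c r U).rad ≠ 0) :
    Flags 1 (fun i => X i ∨ i ∈ removed c r U u Z) ((cutCmd d).den ω s) ∧
      Flags 2 (· ∈ next c r U u) ((cutCmd d).den ω s) := by
  have hρ := layout_rho_pos hd hrad
  simp only [cutCmd, Cmd.den]
  set s₁ := (capSideCmd d).den ω s with hs₁
  set s₂ := (relevantCmd d).den ω s₁ with hs₂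
  set s₃ := (hitCmd d).den ω s₂ with hs₃
  set s₄ := (removeCmd d).den ω s₃ with hs₄
  have n₁ : ∀ b, b ≠ 4 → b ≠ 5 → b ≠ 6 → b ≠ 7 → b ≠ 11 → s₁.natMem b = s.natMem b :=
    fun b _ _ _ _ _ => Cmd.natMem_den (fun hw => by have := writesNat_capSideCmd hw; omega) s
  have n₂ : ∀ b, b ≠ 4 → b ≠ 12 → s₂.natMem b = s₁.natMem b :=
    fun b _ _ => Cmd.natMem_den (fun hw => by have := writesNat_relevantCmd hw; omega) s₁
  have n₃ : ∀ b, b ≠ 4 → b ≠ 5 → b ≠ 6 → b ≠ 13 → s₃.natMem b = s₂.natMem b :=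
    fun b _ _ _ _ => Cmd.natMem_den (fun hw => by have := writesNat_hitCmd hw; omega) s₂
  have n₄ : ∀ b, b ≠ 4 → b ≠ 5 → b ≠ 6 → b ≠ 1 → s₄.natMem b = s₃.natMem b :=
    fun b _ _ _ _ => Cmd.natMem_den (fun hw => by have := writesNat_removeCmd hw; omega) s₃
  have h₁ : HoldsCut c r U u Z s₁ := h.congr (fun b hb => by apply n₁ <;> omega)
    fun a => Cmd.realMem_den writesReal_capSideCmd s
  have h₂ : HoldsCut c r U u Z s₂ := h₁.congr (fun b hb => by apply n₂ <;> omega)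
    fun a => Cmd.realMem_den writesReal_relevantCmd s₁
  have h₃ : HoldsCut c r U u Z s₃ := h₂.congr (fun b hb => by apply n₃ <;> omega)
    fun a => Cmd.realMem_den writesReal_hitCmd s₂
  have h₄ : HoldsCut c r U u Z s₄ := h₃.congr (fun b hb => by apply n₄ <;> omega)
    fun a => Cmd.realMem_den writesReal_removeCmd s₃
  have u₁ : Flags 2 (· ∈ U) s₁ := hU.congr (by apply n₁ <;> norm_num)
  have u₂ : Flags 2 (· ∈ U) s₂ := u₁.congr (by apply n₂ <;> norm_num)
  have u₃ : Flags 2 (· ∈ U) s₃ := u₂.congr (by apply n₃ <;> norm_num)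
  have u₄ : Flags 2 (· ∈ U) s₄ := u₃.congr (by apply n₄ <;> norm_num)
  have x₁ : Flags 1 X s₁ := hX.congr (by apply n₁ <;> norm_num)
  have x₂ : Flags 1 X s₂ := x₁.congr (by apply n₂ <;> norm_num)
  have x₃ : Flags 1 X s₃ := x₂.congr (by apply n₃ <;> norm_num)
  have c₁ := flags_capSideCmd (ω := ω) hd hr h hU
  have r₂ := flags_relevantCmd (ω := ω) hd hr h₁ u₁ hρ
  have e₃ := flags_hitCmd (ω := ω) hd hr h₂ (c₁.congr (by apply n₂ <;> norm_num)) r₂ hρ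
  have x₄ := flags_removeCmd (ω := ω) hd hr h₃ u₃ x₃ e₃
  constructor
  · rw [removed, if_neg hrad]
    exact x₄.congr (Cmd.natMem_den (fun hw => by have := writesNat_restrictCmd hw; omega) s₄)
  · rw [next, if_neg hrad]
    simp only [Finset.mem_filter]
    exact flags_restrictCmd h₄ u₄ hρ

end Cut
end SphereSep

namespace SphereSep
open Metric RealRAM

/-! ### The complete program -/

section Program
variable {ω : Tape} {d n : ℕ} {c : Fin n → EuclideanSpace ℝ (Fin d)} {r : Fin n → ℝ}

/-- Remove the whole subfamily. -/
def clearCmd : Cmd :=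
  .seq (fillCmd 4 1 .skip (orTest (flagTest 1 (cell 4)) (flagTest 2 (cell 4))))
    (fillCmd 4 2 .skip (.natLt (.const 0) (.const 0)))

theorem flags_clearCmd {s : State} (hn : s.natMem 0 0 = n) {X U : Fin n → Prop} (hX : Flags 1 X s)
    (hU : Flags 2 U s) :
    Flags 1 (fun i => X i ∨ U i) (clearCmd.den ω s) ∧
      Flags 2 (fun _ : Fin n => False) (clearCmd.den ω s) := by
  rw [clearCmd, Cmd.den]
  set p := fillCmd 4 1 .skip (orTest (flagTest 1 (cell 4)) (flagTest 2 (cell 4))) with hp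
  have hf : ∀ s' b, Frame p s s' → b ≠ 4 → b ≠ 1 → s'.natMem b = s.natMem b :=
    fun s' b hf h4 h1 => hf.nat b (by simp [hp, writesNat_fillCmd, Cmd.WritesNat, h4, h1])
  have h1 : Flags 1 (fun i => X i ∨ U i) (p.den ω s) := by
    refine flags_fillCmd (by simp [wf_fillCmd, Cmd.WF, Cmd.WritesNat]) (by simp [Cmd.WritesNat])
      hn _ (fun _ _ => True) (fun _ _ _ _ => trivial) fun k s' hf' hk hA _ => ?_
    have hu : Flags 2 U s' := hU.congr (hf s' 2 hf' (by norm_num) (by norm_num))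
    rw [holds_orTest, hu.holds (i := cell 4) hk, holds_flagTest, NatExpr.eval, NatExpr.eval, hk, hA,
      hX k]
  constructor
  · exact h1.congr (Cmd.natMem_den (by simp [writesNat_fillCmd, Cmd.WritesNat]) _)
  · refine flags_fillCmd (by simp [wf_fillCmd, Cmd.WF, Cmd.WritesNat]) (by simp [Cmd.WritesNat])
      ?_ _ (fun _ _ => True) (fun _ _ _ _ => trivial) fun k s' _ _ _ _ => ?_
    · rw [hf _ 0 (frame_den _ _) (by norm_num) (by norm_num), hn]
    · simp [Test.Holds]

/-- One round of the algorithm. -/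
def roundCmd (d : ℕ) : Cmd :=
  -- The number is drawn before the branch, even if it is not used, so that round `m` always reads
  -- the tape entry `n + m`.
  .seq (findCmd d) (.seq (.sample (d + 4) (.const 0))
    (.cond (.realLt (.const 0) (rcell (d + 2))) (cutCmd d) clearCmd))

theorem writesNat_findCmd {b : ℕ} (h : (findCmd d).WritesNat b) : 4 ≤ b ∧ b ≤ 10 := by
  by_cases hs : (searchStepCmd d).WritesNat b
  · have := writesNat_searchStepCmd hs
    omega
  · simp only [findCmd, prepareCmd, startCmd, Cmd.WritesNat, writesNat_countCmd,
      writesNat_spreadCmd, or_false, hs] at h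
    omega

theorem not_draws_countCmd {j res : ℕ} {T : Test} : ¬ (countCmd j res T).Draws := by
  simp [countCmd, Cmd.Draws]

theorem not_draws_spreadCmd {j res : ℕ} {i : NatExpr} {T : Test} :
    ¬ (spreadCmd d j res i T).Draws := by
  simp [spreadCmd, Cmd.Draws, not_draws_coordMaxCmd]

theorem not_draws_findCmd : ¬ (findCmd d).Draws := by
  simp [findCmd, prepareCmd, startCmd, searchStepCmd, moveCmd, Cmd.Draws, not_draws_countCmd,
    not_draws_spreadCmd]

theorem not_draws_cutCmd : ¬ (cutCmd d).Draws := by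
  simp [cutCmd, capSideCmd, relevantCmd, hitCmd, removeCmd, restrictCmd, draws_fillCmd, Cmd.Draws,
    not_draws_countCmd]

theorem not_draws_clearCmd : ¬ clearCmd.Draws := by
  simp [clearCmd, draws_fillCmd, Cmd.Draws]

theorem writesNat_cutCmd {b : ℕ} (h : (cutCmd d).WritesNat b) :
    b ≠ 0 ∧ b ≤ 13 := by
  rcases h with h | h | h | h | h
  · have := writesNat_capSideCmd h
    omega
  · have := writesNat_relevantCmd h
    omega
  · have := writesNat_hitCmd h
    omega
  · have := writesNat_removeCmd h
    omega
  · have := writesNat_restrictCmd h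
    omega

theorem writesNat_clearCmd {b : ℕ} (h : clearCmd.WritesNat b) : b ≠ 0 ∧ b ≤ 4 := by
  simp only [clearCmd, Cmd.WritesNat, writesNat_fillCmd, false_or] at h
  omega

theorem not_writesReal_cutCmd {b : ℕ} : ¬ (cutCmd d).WritesReal b := by
  simp [cutCmd, Cmd.WritesReal, writesReal_capSideCmd, writesReal_relevantCmd, writesReal_hitCmd,
    writesReal_removeCmd, writesReal_restrictCmd]

theorem not_writesReal_clearCmd {b : ℕ} : ¬ clearCmd.WritesReal b := by
  simp [clearCmd, Cmd.WritesReal, writesReal_fillCmd]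

/-- The memory holds the state of the algorithm after `m` rounds. -/
structure HoldsRound [NeZero n] (c : Fin n → EuclideanSpace ℝ (Fin d)) (r : Fin n → ℝ) (ω : Tape)
    (m : ℕ) (s : State) : Prop where
  input : HasInput c r s
  family : Flags 2 (· ∈ hist c r ω m) s
  removed : Flags 1 (fun i => ∃ k < m, i ∈ removedAt c r ω k) s
  critical : Flags 14 (· ∈ critical (sphereGraph c r) ω) s
  drawn : s.drawn = n + m

theorem holdsRound_roundCmd [NeZero n] (hd : 2 ≤ d) (hr : ∀ i, 0 < r i) {m : ℕ} {s : State}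
    (h : HoldsRound c r ω m s) : HoldsRound c r ω (m + 1) ((roundCmd d).den ω s) := by
  have hS := holdsSearch_findCmd (ω := ω) h.input h.family
  rw [roundCmd, Cmd.den, Cmd.den]
  set s₁ := (findCmd d).den ω s with hs₁
  have n₁ : ∀ b, b ≤ 3 ∨ b = 14 → s₁.natMem b = s.natMem b :=
    fun b hb => Cmd.natMem_den (fun hw => by have := writesNat_findCmd hw; omega) s
  set s₂ := (Cmd.sample (d + 4) (.const 0)).den ω s₁ with hs₂
  have n₂ : s₂.natMem = s₁.natMem := rfl
  have hd₁ : s₁.drawn = n + m := by rw [hs₁, Cmd.drawn_den not_draws_findCmd, h.drawn]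
  have hd₂ : s₂.drawn = n + (m + 1) := by rw [← add_assoc, ← hd₁]; rfl
  have r₂ : ∀ a, a ≠ d + 4 → s₂.realMem a = s₁.realMem a :=
    fun a ha => realMem_setReal_of_ne ha
  have u₂ : s₂.realMem (d + 4) 0 = (ω (n + m) : ℝ) := by
    simp [hs₂, Cmd.den, State.setReal, NatExpr.eval, hd₁]
  have i₂ : HasInput c r s₂ := hS.input.congr rfl fun a ha => r₂ a (by omega)
  have f₂ : Flags 2 (· ∈ hist c r ω m) s₂ := hS.family
  have c₂ : Flags 14 (· ∈ critical (sphereGraph c r) ω) s₂ := h.critical.congr (n₁ 14 (by simp))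
  have x₂ : Flags 1 (fun i => ∃ k < m, i ∈ removedAt c r ω k) s₂ :=
    h.removed.congr (n₁ 1 (by simp))
  have hrad : s₂.realMem (d + 2) 0 = (found c r (hist c r ω m)).rad := by
    rw [r₂ _ (by omega), hS.rad]
  have hsucc : ∀ i, (∃ k < m + 1, i ∈ removedAt c r ω k) ↔
      (∃ k < m, i ∈ removedAt c r ω k) ∨ i ∈ removed c r (hist c r ω m) (ω (n + m))
        (SphereSep.critical (sphereGraph c r) ω) := by
    intro i
    simp only [Nat.lt_succ_iff_lt_or_eq, or_and_right, exists_or, exists_eq_left]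
    exact Iff.rfl
  have hT : (Test.realLt (.const 0) (rcell (d + 2))).Holds s₂ ↔
      (found c r (hist c r ω m)).rad ≠ 0 := by
    simp only [Test.Holds, RealExpr.eval, NatExpr.eval, hrad, Rat.cast_zero]
    exact ⟨ne_of_gt, rad_pos⟩
  rw [Cmd.den]
  by_cases h0 : (found c r (hist c r ω m)).rad ≠ 0
  · rw [if_pos (hT.2 h0)]
    have hC : HoldsCut c r (hist c r ω m) (ω (n + m))
        (SphereSep.critical (sphereGraph c r) ω) s₂ := ⟨i₂, c₂, hS.ctr, hrad, u₂⟩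
    obtain ⟨h1, h2⟩ := flags_cutCmd (ω := ω) hd hr hC f₂ x₂ h0
    refine ⟨i₂.congr (Cmd.natMem_den (fun hw => (writesNat_cutCmd hw).1 rfl) s₂)
      fun a _ => Cmd.realMem_den not_writesReal_cutCmd s₂, h2, ?_,
      c₂.congr (Cmd.natMem_den (fun hw => by have := writesNat_cutCmd hw; omega) s₂), ?_⟩
    · exact fun i => (h1 i).trans (hsucc i).symm
    · rw [Cmd.drawn_den not_draws_cutCmd, hd₂]
  · rw [if_neg (mt hT.1 h0)]
    obtain ⟨h1, h2⟩ := flags_clearCmd (ω := ω) i₂.1 x₂ f₂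
    rw [not_not] at h0
    refine ⟨i₂.congr (Cmd.natMem_den (fun hw => (writesNat_clearCmd hw).1 rfl) s₂)
      fun a _ => Cmd.realMem_den not_writesReal_clearCmd s₂, ?_, ?_,
      c₂.congr (Cmd.natMem_den (fun hw => by have := writesNat_clearCmd hw; omega) s₂), ?_⟩
    · intro i
      rw [h2 i, hist, next, if_pos h0]
      simp
    · exact fun i => (h1 i).trans ((hsucc i).trans (by rw [SphereSep.removed, if_pos h0])).symm
    · rw [Cmd.drawn_den not_draws_clearCmd, hd₂]

/-- Compute the degrees and select the critical vertices. -/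
def initCmd (d : ℕ) : Cmd :=
  .for_ 4 (.seq (countCmd 5 6 (adjTest d (cell 4) (cell 5))) (.seq (.sample (d + 1) (.const 0))
    (.seq (.cond (.realLt (.mul (rcell (d + 1)) (.ofNat (cell 6))) (.const 1))
        (.natSet 14 (cell 4) (.const 1)) (.natSet 14 (cell 4) (.const 0)))
      (.natSet 2 (cell 4) (cell 6)))))

theorem writesNat_initCmd {b : ℕ} (h : (initCmd d).WritesNat b) :
    b = 2 ∨ b = 4 ∨ b = 5 ∨ b = 6 ∨ b = 14 := by
  simp only [initCmd, Cmd.WritesNat, writesNat_countCmd, false_or] at h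
  omega

theorem writesReal_initCmd {b : ℕ} (h : (initCmd d).WritesReal b) : b = d + 1 := by
  simpa [initCmd, Cmd.WritesReal, writesReal_countCmd] using h

theorem wf_initCmd : (initCmd d).WF := by
  simp [initCmd, Cmd.WF, wf_countCmd, Cmd.WritesNat, writesNat_countCmd]

/-- Vertex `k` draws the tape entry `k`, so the stored flags agree with `critical`. The degrees
themselves serve as flags of the initial subfamily: they are nonzero exactly at the non-isolated
vertices. -/
theorem holdsRound_initCmd [NeZero n] (hd : 2 ≤ d) (hr : ∀ i, 0 < r i) {s : State}
    (h : HasInput c r s) (hX : ∀ i, s.natMem 1 i = 0) (h0 : s.drawn = 0) :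
    HoldsRound c r ω 0 ((initCmd d).den ω s) := by
  classical
  have key := Cmd.den_for (ω := ω) (s := s) (wf_initCmd (d := d)) (fun k s' => s'.drawn = k ∧
    ∀ i : Fin n, (i : ℕ) < k → (s'.natMem 14 i ≠ 0 ↔ i ∈ critical (sphereGraph c r) ω) ∧
      s'.natMem 2 i = ((sphereGraph c r).neighborSet i).ncard) ⟨h0, by simp⟩ ?_
  · rw [h.1] at key
    obtain ⟨h1, h2⟩ := key
    refine ⟨h.congr (Cmd.natMem_den (fun hw => by have := writesNat_initCmd hw; omega) s)
      fun a ha => Cmd.realMem_den (fun hw => by have := writesReal_initCmd hw; omega) s,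
      fun i => ?_, fun i => ?_, fun i => (h2 i i.2).1, h1⟩
    · simp only [hist, Finset.mem_filter, Finset.mem_univ, true_and, Nat.one_le_iff_ne_zero]
      rw [← (h2 i i.2).2]
      exact Iff.rfl
    · rw [Cmd.natMem_den (fun hw => by have := writesNat_initCmd hw; omega) s, hX]
      simp
  · rintro k hk s' hf hf' hk' ⟨h1, h2⟩
    rw [h.1] at hk
    rw [Cmd.den, Cmd.den]
    set p := countCmd 5 6 (adjTest d (cell 4) (cell 5)) with hp
    set s₁ := p.den ω s' with hs₁
    have i' : HasInput c r s' := h.congr (hf 0 fun hw => by have := writesNat_initCmd hw; omega)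
      fun a ha => hf' a fun hw => by have := writesReal_initCmd hw; omega
    have hc : s₁.natMem 6 0 = ((sphereGraph c r).neighborSet ⟨k, hk⟩).ncard := by
      rw [hs₁, natMem_countCmd (by norm_num) (by norm_num) (by norm_num) i'.1
        (fun l => (sphereGraph c r).Adj ⟨k, hk⟩ l) ?_, ← Set.ncard_coe_finset]
      · congr 1
        ext
        simp
      · intro l hl s'' hf'' hl'
        exact holds_adjTest hd hr (i'.congr (hf''.nat 0 (by rw [writesNat_countCmd]; norm_num))
          fun a _ => hf''.real a writesReal_countCmd) (i := cell 4) (j := cell 5)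
          (i' := ⟨k, hk⟩) (j' := ⟨l, hl⟩)
          (by rw [NatExpr.eval, hf''.nat 4 (by rw [writesNat_countCmd]; norm_num)]; exact hk') hl'
    have hk₁ : s₁.natMem 4 0 = k := by
      rw [Cmd.natMem_den (by rw [writesNat_countCmd]; norm_num), hk']
    have hn₁ : ∀ b, b = 2 ∨ b = 14 → s₁.natMem b = s'.natMem b := fun b hb =>
      Cmd.natMem_den (by rw [writesNat_countCmd]; omega) s'
    have hd₁ : s₁.drawn = k := by rw [hs₁, Cmd.drawn_den not_draws_countCmd, h1]
    set s₂ := (Cmd.sample (d + 1) (.const 0)).den ω s₁ with hs₂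
    have n₂ : s₂.natMem = s₁.natMem := rfl
    have hT : (Test.realLt (.mul (rcell (d + 1)) (.ofNat (cell 6))) (.const 1)).Holds s₂ ↔
        (⟨k, hk⟩ : Fin n) ∈ critical (sphereGraph c r) ω := by
      have : s₂.realMem (d + 1) 0 = (ω k : ℝ) := by
        simp [hs₂, Cmd.den, State.setReal, NatExpr.eval, hd₁]
      simp only [Test.Holds, RealExpr.eval, NatExpr.eval, this, n₂, hc, Rat.cast_one]
      exact Iff.rfl
    set q : Cmd := .cond (.realLt (.mul (rcell (d + 1)) (.ofNat (cell 6))) (.const 1))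
      (.natSet 14 (cell 4) (.const 1)) (.natSet 14 (cell 4) (.const 0)) with hq
    obtain ⟨v, hv, hs₃⟩ : ∃ v : ℕ, (v ≠ 0 ↔ (⟨k, hk⟩ : Fin n) ∈ critical (sphereGraph c r) ω) ∧
        q.den ω s₂ = s₂.setNat 14 k v := by
      have h4 : (cell 4).eval s₂ = k := hk₁
      rw [hq, Cmd.den, Cmd.den, Cmd.den, h4]
      by_cases hh : (⟨k, hk⟩ : Fin n) ∈ critical (sphereGraph c r) ω
      · exact ⟨1, iff_of_true one_ne_zero hh, by rw [if_pos (hT.2 hh)]; rfl⟩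
      · exact ⟨0, iff_of_false (fun h => h rfl) hh, by rw [if_neg (mt hT.1 hh)]; rfl⟩
    rw [Cmd.den, hs₃, Cmd.den]
    have h4 : (cell 4).eval (s₂.setNat 14 k v) = k := by
      rw [NatExpr.eval, natMem_setNat_of_ne (by norm_num)]
      exact hk₁
    have h6 : (cell 6).eval (s₂.setNat 14 k v) =
        ((sphereGraph c r).neighborSet ⟨k, hk⟩).ncard := by
      rw [NatExpr.eval, natMem_setNat_of_ne (by norm_num)]
      exact hc
    rw [h4, h6]
    refine ⟨congrArg (· + 1) hd₁, fun i hi => ?_⟩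
    rw [natMem_setNat_of_ne (by norm_num), natMem_setNat_of_ne (by norm_num), natMem_setNat_self,
      natMem_setNat_of_ne (by norm_num), natMem_setNat_self, natMem_setNat_of_ne (by norm_num), n₂,
      hn₁ 2 (by simp), hn₁ 14 (by simp)]
    rcases Nat.lt_succ_iff_lt_or_eq.1 hi with h5 | h5
    · rw [Function.update_of_ne h5.ne, Function.update_of_ne h5.ne]
      exact h2 i h5
    · subst h5
      rw [Function.update_self, Function.update_self]
      exact ⟨hv, rfl⟩

/-- Run a program several times. -/
def repeatCmd (p : Cmd) : ℕ → Cmd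
  | 0 => .skip
  | k + 1 => .seq (repeatCmd p k) p

/-- The algorithm. -/
def separatorCmd (d : ℕ) : Cmd := .seq (initCmd d) (repeatCmd (roundCmd d) (cellBound d))

theorem holdsRound_repeatCmd [NeZero n] (hd : 2 ≤ d) (hr : ∀ i, 0 < r i) {s : State}
    (h : HoldsRound c r ω 0 s) (k : ℕ) :
    HoldsRound c r ω k ((repeatCmd (roundCmd d) k).den ω s) := by
  induction k with
  | zero => exact h
  | succ k ih => exact holdsRound_roundCmd hd hr ih

theorem writesNat_repeatCmd {p : Cmd} {k b : ℕ} (h : (repeatCmd p k).WritesNat b) :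
    p.WritesNat b := by
  induction k with
  | zero => exact absurd h id
  | succ k ih => exact h.elim ih id

theorem wf_repeatCmd {p : Cmd} (h : p.WF) (k : ℕ) : (repeatCmd p k).WF := by
  induction k with
  | zero => trivial
  | succ k ih => exact ⟨ih, h⟩

/-- The number of rounds depends on `d` only; they are unrolled in the program text and add no
nesting level. -/
theorem depth_repeatCmd_le (p : Cmd) (k : ℕ) : (repeatCmd p k).depth ≤ p.depth := by
  induction k with
  | zero => exact Nat.zero_le _
  | succ k ih => exact max_le ih le_rfl

theorem depth_countCmd {j res : ℕ} {T : Test} : (countCmd j res T).depth = 1 := by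
  simp [countCmd, Cmd.depth]

theorem depth_spreadCmd {j res : ℕ} {i : NatExpr} {T : Test} :
    (spreadCmd d j res i T).depth = 1 := by
  simp [spreadCmd, Cmd.depth, depth_coordMaxCmd]

theorem depth_roundCmd : (roundCmd d).depth = 2 := by
  simp [roundCmd, findCmd, prepareCmd, startCmd, searchStepCmd, moveCmd, cutCmd, clearCmd,
    capSideCmd, relevantCmd, hitCmd, removeCmd, restrictCmd, Cmd.depth, depth_countCmd,
    depth_spreadCmd, depth_fillCmd]

theorem depth_separatorCmd_le : (separatorCmd d).depth ≤ 2 := by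
  refine max_le ?_ ((depth_repeatCmd_le _ _).trans depth_roundCmd.le)
  simp [initCmd, Cmd.depth, depth_countCmd]

theorem wf_roundCmd : (roundCmd d).WF := by
  refine ⟨⟨?_, ⟨wf_searchStepCmd, wf_searchStepCmd⟩, by norm_num, ?_, ?_⟩, trivial, ?_, ?_⟩
  · simp [prepareCmd, startCmd, Cmd.WF, wf_countCmd, wf_spreadCmd, Cmd.WritesNat]
  · rintro (h | h) <;> have := writesNat_searchStepCmd h <;> omega
  · rintro (h | h) <;> have := writesNat_searchStepCmd h <;> omega
  · simp [cutCmd, capSideCmd, relevantCmd, hitCmd, removeCmd, restrictCmd, Cmd.WF, wf_fillCmd,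
      wf_countCmd, Cmd.WritesNat, writesNat_countCmd]
  · simp [clearCmd, Cmd.WF, wf_fillCmd, Cmd.WritesNat]

theorem not_writesNat_zero_separatorCmd : ¬ (separatorCmd d).WritesNat 0 := by
  rintro (h | h)
  · have := writesNat_initCmd h
    omega
  · rcases writesNat_repeatCmd h with h | h | h | h
    · have := writesNat_findCmd h
      omega
    · exact h
    · exact (writesNat_cutCmd h).1 rfl
    · exact (writesNat_clearCmd h).1 rfl

theorem hasInput_sphereInput (c : Fin n → EuclideanSpace ℝ (Fin d)) (r : Fin n → ℝ) :
    HasInput c r (sphereInput c r) := by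
  refine ⟨by simp [sphereInput], fun a i => ?_, fun i => ?_⟩ <;> simp [sphereInput]

theorem output_den_separatorCmd [NeZero n] (hd : 2 ≤ d) (hr : ∀ i, 0 < r i) :
    output n ((separatorCmd d).den ω (sphereInput c r)) = separator c r ω := by
  have h := holdsRound_repeatCmd hd hr (holdsRound_initCmd (ω := ω) hd hr
    (hasInput_sphereInput c r) (fun i => by simp [sphereInput]) rfl) (cellBound d)
  ext i
  exact h.removed i

theorem exists_runs_separatorCmd (hn : 1 ≤ n) (c : Fin n → EuclideanSpace ℝ (Fin d)) (r : Fin n → ℝ)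
    (ω : Tape) : ∃ t : ℕ, Runs ω (separatorCmd d).compile (sphereInput c r) t
      ((separatorCmd d).den ω (sphereInput c r)) ∧ t ≤ (separatorCmd d).timeConst * n ^ 2 := by
  obtain ⟨t, ht, hle⟩ := Cmd.runs_compile (ω := ω) (separatorCmd d)
    ⟨wf_initCmd, wf_repeatCmd wf_roundCmd _⟩ hn not_writesNat_zero_separatorCmd (sphereInput c r)
    (hasInput_sphereInput c r).1
  exact ⟨t, ht, hle.trans (Nat.mul_le_mul_left _ (Nat.pow_le_pow_right hn depth_separatorCmd_le))⟩

end Program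
end SphereSep


theorem theorem5p2 (d : ℕ) (hd : 2 ≤ d) :
    ∃ (C T : ℝ) (P : RealRAM.Prog),
      ∀ (n : ℕ) (_ : 2 ≤ n) (c : Fin n → EuclideanSpace ℝ (Fin d)) (r : Fin n → ℝ)
        (_ : ∀ i, 0 < r i),
        (∀ ω : RealRAM.Tape, ∃ (t : ℕ) (s : RealRAM.State),
          RealRAM.Runs ω P (RealRAM.sphereInput c r) t s ∧ (t : ℝ) ≤ T * (n : ℝ) ^ 2) ∧
        (1 / 2 : ENNReal) ≤ RealRAM.tapeLaw {ω | ∃ (t : ℕ) (s : RealRAM.State),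
          RealRAM.Runs ω P (RealRAM.sphereInput c r) t s ∧
          IsBalancedSeparator (sphereGraph c r) (RealRAM.output n s) ∧
          ((RealRAM.output n s).ncard : ℝ) ≤
            C * (∑ i, (((sphereGraph c r).neighborSet i).ncard : ℝ) ^ (1 / ((d : ℝ) - 1))) ^
              (1 - 1 / (d : ℝ))} := by
  refine ⟨SphereSep.sizeConst d, (SphereSep.separatorCmd d).timeConst,
    (SphereSep.separatorCmd d).compile, fun n hn c r hr => ⟨fun ω => ?_, ?_⟩⟩
  · obtain ⟨t, ht, hle⟩ := SphereSep.exists_runs_separatorCmd (by omega) c r ω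
    exact ⟨t, _, ht, by exact_mod_cast hle⟩
  · have : NeZero n := ⟨by omega⟩
    -- Balance holds for every tape, so the success event contains the event of the size bound;
    -- monotonicity of the measure requires no measurability of the former.
    refine (SphereSep.half_le_measure_separator (c := c) hd hr).trans
      (MeasureTheory.measure_mono fun ω hω => ?_)
    obtain ⟨t, ht, -⟩ := SphereSep.exists_runs_separatorCmd (by omega) c r ω
    refine ⟨t, _, ht, ?_, ?_⟩
    · rw [SphereSep.output_den_separatorCmd hd hr]
      exact SphereSep.isBalancedSeparator_separator hd hn hr ω
    · rw [SphereSep.output_den_separatorCmd hd hr]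
      exact hω
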